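/- **Conventions.** All subcategories are full and closed under isomorphisms; an additive subcategory contains $0$ and is closed under finite direct sums; functors between additive categories are additive. Let $\mathcal A$ be an additive category with additive endofunctors $\Sigma,\Omega$. For an additive subcategory $\mathcal X$ and a subcategory $\mathcal C$ of $\mathcal A$, the category $\mathcal C/\mathcal X$ has the objects of $\mathcal C$ and $\mathrm{Hom}_{\mathcal C/\mathcal X}(A,B)=\mathrm{Hom}_{\mathcal A}(A,B)/\mathcal X(A,B)$, where $\mathcal X(A,B)$ is the subgroup of morphisms factoring through an object of $\mathcal X$; $\underline f$ is the class of $f$. A morphism $f:A\to B$ is $\mathcal X$-monic if $\mathrm{Hom}(B,Y)\to\mathrm{Hom}(A,Y)$ is surjective for all $Y\in\mathcal X$; if moreover $B\in\mathcal X$ it is an $\mathcal X$-preenvelope. Dually: $\mathcal X$-epic, $\mathcal X$-precover. A morphism $g:B\to C$ is a weak cokernel of $f:A\to B$ if $gf=0$ and every $k$ with $kf=0$ factors through $g$; dually weak kernel. A right $\Sigma$-sequence is a sequence $A\xrightarrow f B\xrightarrow g C\xrightarrow h\Sigma A$; it is a right $\mathcal C$-sequence if $C\in\mathcal C$, $g$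 is a weak cokernel of $f$ and $h$ is a weak cokernel of $g$. Dually, a left $\mathcal F$-sequence is $\Omega C\xrightarrow f A\xrightarrow g B\xrightarrow h C$ with $A\in\mathcal F$, $g$ a weak kernel of $h$ and $f$ a weak kernel of $g$. Morphisms and isomorphisms of right (left) sequences are triples of morphisms making all squares commute, with $\Sigma$ (resp. $\Omega$) applied to the first (resp. third) at the extra end. **Right triangulated categories.** $(\mathcal T,\Psi,\Delta)$, with $\mathcal T$ additive, $\Psi$ an additive endofunctor and $\Delta$ a class of right $\Psi$-sequences closed under isomorphisms, is right triangulated if: (RT1) every $f:A\to B$ begins some sequence in $\Delta$, and $0\to A\xrightarrow{1}A\to\Psi(0)$ is in $\Delta$; (RT2) if $A\xrightarrow fB\xrightarrow gC\xrightarrow h\Psi A$ is in $\Delta$, so is $B\xrightarrow gC\xrightarrow h\Psi A\xrightarrow{-\Psi f}\Psi B$; (RT3) any $(\alpha,\beta)$ commuting with the first morphisms of two sequences in $\Delta$ extends to a morphism $(\alpha,\beta,\gamma)$ of sequences; (RT4) given $A\xrightarrow fB\xrightarrow lC'\xrightarrow m\Psi A$, $B\xrightarrow gC\xrightarrow kA'\xrightarrow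 j\Psi B$, $A\xrightarrow{gf}C\xrightarrow pB'\xrightarrow q\Psi A$ in $\Delta$, there are $r:C'\to B'$, $s:B'\to A'$ with $rl=pg$, $qr=m$, $sp=k$, $js=\Psi(f)q$ and $C'\xrightarrow rB'\xrightarrow sA'\xrightarrow{\Psi(l)j}\Psi C'$ in $\Delta$. Left triangulated categories are defined dually. A **pre-triangulated category** $(\mathcal T,\Psi,\Phi,\Delta,\nabla)$ consists of a right triangulated structure $(\Psi,\Delta)$ and a left triangulated structure $(\Phi,\nabla)$ on $\mathcal T$ such that $\Psi$ is left adjoint to $\Phi$, with unit $\eta$ and counit $\varepsilon$ for which the following holds for every $A\xrightarrow fB\xrightarrow gC\xrightarrow h\Psi A$ in $\Delta$ and $\Phi C'\xrightarrow{f'}A'\xrightarrow{g'}B'\xrightarrow{h'}C'$ in $\nabla$: if $\alpha:A\to\Phi C'$ and $\beta:B\to A'$ satisfy $\beta f=f'\alpha$, there is $\gamma:C\to B'$ with $\gamma g=g'\beta$ and $h'\gamma=\varepsilon_{C'}\Psi(\alpha)h$; if $\alpha:\Psi A\to C'$ and $\beta:C\to B'$ satisfy $\alpha h=h'\beta$,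 there is $\gamma:B\to A'$ with $g'\gamma=\beta g$ and $\gamma f=f'\Phi(\alpha)\eta_A$. **Partial right triangulated categories.** Let $\mathcal X\subseteq\mathcal C$ be additive subcategories of $\mathcal A$ and $\mathrm R(\mathcal C)$ a class of right $\mathcal C$-sequences ("right $\mathcal C$-triangles") closed under isomorphisms and finite direct sums. $(\mathcal A,\Sigma,\mathrm R(\mathcal C),\mathcal X)$ is partial right triangulated if: (PRT1) (i) each $A\in\mathcal C$ has a right $\mathcal C$-triangle $A\xrightarrow iX\to U\to\Sigma A$ with $i$ an $\mathcal X$-preenvelope; (ii) for each $f:A\to B$ in $\mathcal C$, $A\xrightarrow{\binom1f}A\oplus B\xrightarrow{(f,-1)}B\xrightarrow0\Sigma A$ is in $\mathrm R(\mathcal C)$; (iii) if $A\xrightarrow iX\to U\to\Sigma A$ is in $\mathrm R(\mathcal C)$ with $A\in\mathcal C$ and $i$ an $\mathcal X$-preenvelope, then for each $f:A\to B$ in $\mathcal C$ there is a right $\mathcal C$-triangle $A\xrightarrow{\binom if}X\oplus B\to N\to\Sigma A$; (PRT2) for any morphism $(\alpha,\beta,\gamma)$ of right $\mathcal C$-triangles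 from $A\xrightarrow fB\to C\to\Sigma A$ to $A'\to X\xrightarrow sU\to\Sigma A'$ with $X\in\mathcal X$, if $\alpha$ factors through $f$ then $\gamma$ factors through $s$; (PRT3) is (RT3) for $\mathrm R(\mathcal C)$; (PRT4) is (RT4) for triples of triangles in $\mathrm R(\mathcal C)$ in which $f,g$ are $\mathcal X$-monics between objects of $\mathcal C$, with the additional conclusion that $r$ is $\mathcal X$-monic. Partial left triangulated categories $(\mathcal A,\Omega,\mathrm L(\mathcal F),\mathcal X)$ are defined dually. **The induced structure.** Let $(\mathcal A,\Sigma,\mathrm R(\mathcal C),\mathcal X)$ be partial right triangulated. For each $A\in\mathcal C$ fix a right $\mathcal C$-triangle $A\xrightarrow{i^A}X^A\xrightarrow{p^A}U^A\xrightarrow{q^A}\Sigma A$ with $i^A$ an $\mathcal X$-preenvelope. The endofunctor $\Sigma^{\mathcal X}$ of $\mathcal C/\mathcal X$ sends $A$ to $U^A$ and $\underline f:A\to B$ to $\underline\kappa$ for any morphism $(f,\sigma,\kappa)$ between the fixed triangles. A standard right triangle is $A\xrightarrow{\underline f}B\xrightarrow{\underline g}C\xrightarrow{\underline\xi}\Sigma^{\mathcal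 X}A$ for a right $\mathcal C$-triangle $A\xrightarrow fB\xrightarrow gC\xrightarrow h\Sigma A$ with $f$ an $\mathcal X$-monic in $\mathcal C$ and a morphism $(1,\delta,\xi)$ from it to the fixed triangle of $A$; $\Delta^{\mathcal X}$ is the class of right $\Sigma^{\mathcal X}$-sequences isomorphic to standard ones. A subcategory $\mathcal G$ with $\mathcal X\subseteq\mathcal G\subseteq\mathcal C$ is special preenveloping if each $A\in\mathcal C$ has a right $\mathcal C$-triangle $A\xrightarrow{j^A}R(A)\to W^A\to\Sigma A$ (one is fixed) with $j^A$ a $\mathcal G$-preenvelope and $\mathrm{Hom}_{\mathcal C/\mathcal X}(W^A,\mathcal G)=0$. Then $R$ becomes a functor $\mathcal C/\mathcal X\to\mathcal G/\mathcal X$, with $R(\underline f)=\underline{\hat f}$ whenever $\hat fj^A=j^Bf$, and $\underline j^A$ identifies $A$ with $R(A)$ for $A\in\mathcal G$. $\mathcal G$ is stabilizing if for every $\underline f:A\to B$ in $\mathcal C/\mathcal X$ and all $A\xrightarrow{\underline f}B\to C\to\Sigma^{\mathcal X}A$ and $R(A)\xrightarrow{R(\underline f)}R(B)\to D\to\Sigma^{\mathcal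 X}R(A)$ in $\Delta^{\mathcal X}$ there is $\underline t:C\to D$ such that $(\underline j^A,\underline j^B,\underline t)$ is a morphism of sequences and $R(\underline t)$ is an isomorphism. Put $G^{\mathcal X}=R\,\Sigma^{\mathcal X}E$ with $E:\mathcal G/\mathcal X\hookrightarrow\mathcal C/\mathcal X$; let $\Delta^{\mathcal X}(\mathcal G)$ be the class of right $G^{\mathcal X}$-sequences in $\mathcal G/\mathcal X$ isomorphic to $A\xrightarrow{\underline f}B\xrightarrow{R(\underline g)}R(C)\xrightarrow{R(\underline h)}G^{\mathcal X}A$ for some $A\xrightarrow{\underline f}B\xrightarrow{\underline g}C\xrightarrow{\underline h}\Sigma^{\mathcal X}A$ in $\Delta^{\mathcal X}$ with $A,B\in\mathcal G$ (where $R(\underline g)$ is composed with the identification $B\cong R(B)$). Dually, for a partial left triangulated category with fixed left $\mathcal F$-triangles $\Omega A\xrightarrow{\nu_A}U_A\xrightarrow{\iota_A}X_A\xrightarrow{\pi_A}A$ ($\pi_A$ an $\mathcal X$-precover), one has $\Omega_{\mathcal X}$, $\nabla_{\mathcal X}$, special precovering and stabilizing subcategories $\mathcal G$ of $\mathcal F$,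 the functor $Q:\mathcal F/\mathcal X\to\mathcal G/\mathcal X$, $H_{\mathcal X}=Q\,\Omega_{\mathcal X}E$ with $E:\mathcal G/\mathcal X\hookrightarrow\mathcal F/\mathcal X$, and $\nabla_{\mathcal X}(\mathcal G)$. **Pre-partial triangulated categories.** Let $(\mathcal A,\Sigma,\mathrm R(\mathcal C),\mathcal X)$ be partial right and $(\mathcal A,\Omega,\mathrm L(\mathcal F),\mathcal X)$ partial left triangulated. $(\mathcal A,\Omega,\Sigma,\mathrm L(\mathcal F),\mathrm R(\mathcal C),\mathcal X)$ is pre-partial triangulated if: (a) $\Omega$ is left adjoint to $\Sigma$, via $\psi_{C,A}:\mathrm{Hom}(\Omega C,A)\cong\mathrm{Hom}(C,\Sigma A)$; (b) $\mathcal C\cap\mathcal F$ is (special preenveloping, resp. precovering, and) stabilizing in both structures; (c) for every right $\mathcal C$-triangle $A\xrightarrow fB\xrightarrow gC\xrightarrow h\Sigma A$ with $f$ $\mathcal X$-monic, every left $\mathcal F$-triangle $\Omega N\xrightarrow uL\xrightarrow vM\xrightarrow wN$ with $w$ $\mathcal X$-epic, and every $\beta:B\to M$: (i) if $\gamma:C\to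 N$ satisfies $\gamma g=w\beta$, there is $\alpha:A\to L$ with $v\alpha=\beta f$ and $u\,\Omega(\gamma)=-\alpha\,\psi^{-1}_{C,A}(h)$; (ii) if $\alpha:A\to L$ satisfies $v\alpha=\beta f$, there is $\gamma:C\to N$ with $\gamma g=w\beta$ and $\Sigma(\alpha)h=-\psi_{N,L}(u)\gamma$; (d) for the fixed right $\mathcal C$-triangle of $A\in\mathcal C\cap\mathcal F$, a left $\mathcal F$-triangle $\Omega N\xrightarrow uL\xrightarrow vM\xrightarrow wN$ with $w$ $\mathcal X$-epic, and $\alpha:A\to L$, $\beta:X^A\to M$, $\gamma:U^A\to N$ with $v\alpha=\beta i^A$, $w\beta=\gamma p^A$, $u\,\Omega(\gamma)=-\alpha\,\psi^{-1}_{U^A,A}(q^A)$: if $\gamma$ factors through $w$, then $\alpha$ factors through $i^A$; (e) for the fixed left $\mathcal F$-triangle of $D\in\mathcal C\cap\mathcal F$, a right $\mathcal C$-triangle $A\xrightarrow fB\xrightarrow gC\xrightarrow h\Sigma A$ with $f$ $\mathcal X$-monic, and $\alpha:A\to U_D$, $\beta:B\to X_D$, $\gamma:C\to D$ with $\iota_D\alpha=\beta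 f$, $\pi_D\beta=\gamma g$, $\Sigma(\alpha)h=-\psi_{D,U_D}(\nu_D)\gamma$: if $\alpha$ factors through $f$, then $\gamma$ factors through $\pi_D$. **Theorem.** If $(\mathcal A,\Omega,\Sigma,\mathrm L(\mathcal F),\mathrm R(\mathcal C),\mathcal X)$ is a pre-partial triangulated category, then $$\bigl((\mathcal C\cap\mathcal F)/\mathcal X,\;G^{\mathcal X},\;H_{\mathcal X},\;\Delta^{\mathcal X}(\mathcal C\cap\mathcal F),\;\nabla_{\mathcal X}(\mathcal C\cap\mathcal F)\bigr)$$ is a pre-triangulated category. -/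

import Mathlib

open CategoryTheory CategoryTheory.Limits
open scoped ZeroObject

set_option linter.unusedSectionVars false

universe v u

namespace OneSided

/-! ### Sequences and one-sided triangulated categories -/

section Triangulated

variable {T : Type u} [Category.{v} T]

/-- A right `S`-sequence `A ⟶ B ⟶ C ⟶ S A`. -/
structure RightSeq (S : T ⥤ T) where
  {A : T}
  {B : T}
  {C : T}
  f : A ⟶ B
  g : B ⟶ C
  h : C ⟶ S.obj A

/-- A left `W`-sequence `W C ⟶ A ⟶ B ⟶ C`. -/
structure LeftSeq (W : T ⥤ T) where
  {A : T}
  {B : T}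
  {C : T}
  f : W.obj C ⟶ A
  g : A ⟶ B
  h : B ⟶ C

/-- The right sequences `P` and `Q` are isomorphic. -/
def RightSeq.Isomorphic {S : T ⥤ T} (P Q : RightSeq S) : Prop :=
  ∃ (a : P.A ≅ Q.A) (b : P.B ≅ Q.B) (c : P.C ≅ Q.C),
    P.f ≫ b.hom = a.hom ≫ Q.f ∧ P.g ≫ c.hom = b.hom ≫ Q.g ∧
      P.h ≫ S.map a.hom = c.hom ≫ Q.h

/-- The left sequences `P` and `Q` are isomorphic. -/
def LeftSeq.Isomorphic {W : T ⥤ T} (P Q : LeftSeq W) : Prop :=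
  ∃ (a : P.A ≅ Q.A) (b : P.B ≅ Q.B) (c : P.C ≅ Q.C),
    P.f ≫ a.hom = W.map c.hom ≫ Q.f ∧ P.g ≫ b.hom = a.hom ≫ Q.g ∧
      P.h ≫ c.hom = b.hom ≫ Q.h

variable [Preadditive T]

/-- `(T, S, Δ)` is a right triangulated category: `T` is an additive category, `S` an additive
endofunctor, and the class `Δ` of right `S`-sequences is closed under isomorphisms and satisfies
(RT1)–(RT4). -/
structure IsRightTriangulated (S : T ⥤ T) (Δ : Set (RightSeq S)) : Prop where
  hasZeroObject : HasZeroObject T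
  hasBinaryBiproducts : HasBinaryBiproducts T
  additive : S.Additive
  isoClosed : ∀ P Q : RightSeq S, P.Isomorphic Q → P ∈ Δ → Q ∈ Δ
  rt1_exists : ∀ {A B : T} (f : A ⟶ B), ∃ (C : T) (g : B ⟶ C) (h : C ⟶ S.obj A),
    RightSeq.mk f g h ∈ Δ
  rt1_id : ∀ (Z A : T), IsZero Z →
    RightSeq.mk (S := S) (0 : Z ⟶ A) (𝟙 A) (0 : A ⟶ S.obj Z) ∈ Δ
  rt2 : ∀ {A B C : T} (f : A ⟶ B) (g : B ⟶ C) (h : C ⟶ S.obj A),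
    RightSeq.mk f g h ∈ Δ → RightSeq.mk g h (-S.map f) ∈ Δ
  rt3 : ∀ P ∈ Δ, ∀ Q ∈ Δ, ∀ (α : P.A ⟶ Q.A) (β : P.B ⟶ Q.B), P.f ≫ β = α ≫ Q.f →
    ∃ γ : P.C ⟶ Q.C, P.g ≫ γ = β ≫ Q.g ∧ P.h ≫ S.map α = γ ≫ Q.h
  rt4 : ∀ {A B C C' A' B' : T} (f : A ⟶ B) (l : B ⟶ C') (m : C' ⟶ S.obj A)
    (g : B ⟶ C) (k : C ⟶ A') (j : A' ⟶ S.obj B) (p : C ⟶ B') (q : B' ⟶ S.obj A),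
    RightSeq.mk f l m ∈ Δ → RightSeq.mk g k j ∈ Δ → RightSeq.mk (f ≫ g) p q ∈ Δ →
    ∃ (r : C' ⟶ B') (s : B' ⟶ A'), l ≫ r = g ≫ p ∧ r ≫ q = m ∧ p ≫ s = k ∧
      s ≫ j = q ≫ S.map f ∧ RightSeq.mk r s (j ≫ S.map l) ∈ Δ

/-- `(T, W, Λ)` is a left triangulated category (the dual notion). -/
structure IsLeftTriangulated (W : T ⥤ T) (Λ : Set (LeftSeq W)) : Prop where
  hasZeroObject : HasZeroObject T
  hasBinaryBiproducts : HasBinaryBiproducts T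
  additive : W.Additive
  isoClosed : ∀ P Q : LeftSeq W, P.Isomorphic Q → P ∈ Λ → Q ∈ Λ
  lt1_exists : ∀ {B C : T} (h : B ⟶ C), ∃ (A : T) (f : W.obj C ⟶ A) (g : A ⟶ B),
    LeftSeq.mk f g h ∈ Λ
  lt1_id : ∀ (Z A : T), IsZero Z →
    LeftSeq.mk (W := W) (0 : W.obj Z ⟶ A) (𝟙 A) (0 : A ⟶ Z) ∈ Λ
  lt2 : ∀ {A B C : T} (f : W.obj C ⟶ A) (g : A ⟶ B) (h : B ⟶ C),
    LeftSeq.mk f g h ∈ Λ → LeftSeq.mk (-W.map h) f g ∈ Λ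
  lt3 : ∀ P ∈ Λ, ∀ Q ∈ Λ, ∀ (β : P.B ⟶ Q.B) (γ : P.C ⟶ Q.C), P.h ≫ γ = β ≫ Q.h →
    ∃ α : P.A ⟶ Q.A, P.g ≫ β = α ≫ Q.g ∧ P.f ≫ α = W.map γ ≫ Q.f
  lt4 : ∀ {A B C C' A' B' : T} (f : B ⟶ A) (l : C' ⟶ B) (m : W.obj A ⟶ C')
    (g : C ⟶ B) (k : A' ⟶ C) (j : W.obj B ⟶ A') (p : B' ⟶ C) (q : W.obj A ⟶ B'),
    LeftSeq.mk m l f ∈ Λ → LeftSeq.mk j k g ∈ Λ → LeftSeq.mk q p (g ≫ f) ∈ Λ →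
    ∃ (r : B' ⟶ C') (s : A' ⟶ B'), r ≫ l = p ≫ g ∧ q ≫ r = m ∧ s ≫ p = k ∧
      j ≫ s = W.map f ≫ q ∧ LeftSeq.mk (W.map l ≫ j) s r ∈ Λ

/-- `(T, Ψ, Φ, Δ, Λ)` is a pre-triangulated category: `(Ψ, Δ)` is a right triangulated structure,
`(Φ, Λ)` is a left triangulated structure, `Ψ` is left adjoint to `Φ`, and the two filling
conditions relating `Δ` and `Λ` through the counit and the unit hold. -/
structure IsPretriangulated (Ψ Φ : T ⥤ T) (Δ : Set (RightSeq Ψ)) (Λ : Set (LeftSeq Φ)) :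
    Prop where
  right : IsRightTriangulated Ψ Δ
  left : IsLeftTriangulated Φ Λ
  exists_adj : ∃ adj : Ψ ⊣ Φ,
    (∀ P ∈ Δ, ∀ Q ∈ Λ, ∀ (α : P.A ⟶ Φ.obj Q.C) (β : P.B ⟶ Q.A), P.f ≫ β = α ≫ Q.f →
      ∃ γ : P.C ⟶ Q.B, P.g ≫ γ = β ≫ Q.g ∧
        P.h ≫ Ψ.map α ≫ adj.counit.app Q.C = γ ≫ Q.h) ∧
    (∀ P ∈ Δ, ∀ Q ∈ Λ, ∀ (α : Ψ.obj P.A ⟶ Q.C) (β : P.C ⟶ Q.B), P.h ≫ α = β ≫ Q.h →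
      ∃ γ : P.B ⟶ Q.A, P.g ≫ β = γ ≫ Q.g ∧
        P.f ≫ γ = (adj.unit.app P.A ≫ Φ.map α) ≫ Q.f)

end Triangulated

variable {𝒜 : Type u} [Category.{v} 𝒜] [Preadditive 𝒜] [HasZeroObject 𝒜]
  [HasBinaryBiproducts 𝒜]

/-! ### Additive subcategories, approximations and subfactor categories -/

/-- Full additive subcategories closed under isomorphisms, given by their objects. -/
class IsAdditiveSubcategory (P : ObjectProperty 𝒜) : Prop where
  of_iso : ∀ {A B : 𝒜}, (A ≅ B) → P A → P B
  zero : ∀ Z : 𝒜, IsZero Z → P Z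
  biprod : ∀ {A B : 𝒜}, P A → P B → P (A ⊞ B)

/-- `f` factors through an object of `X`. -/
def FactorsThroughObj (X : ObjectProperty 𝒜) {A B : 𝒜} (f : A ⟶ B) : Prop :=
  ∃ (Y : 𝒜) (_ : X Y) (a : A ⟶ Y) (b : Y ⟶ B), a ≫ b = f

/-- `f : A ⟶ B` is `X`-monic: every morphism from `A` to an object of `X` extends along `f`. -/
def IsRelMonic (X : ObjectProperty 𝒜) {A B : 𝒜} (f : A ⟶ B) : Prop :=
  ∀ ⦃Y : 𝒜⦄, X Y → ∀ k : A ⟶ Y, ∃ t : B ⟶ Y, f ≫ t = k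

/-- `f : A ⟶ B` is `X`-epic: every morphism from an object of `X` to `B` lifts along `f`. -/
def IsRelEpic (X : ObjectProperty 𝒜) {A B : 𝒜} (f : A ⟶ B) : Prop :=
  ∀ ⦃Y : 𝒜⦄, X Y → ∀ k : Y ⟶ B, ∃ t : Y ⟶ A, t ≫ f = k

/-- `f : A ⟶ Y` is an `X`-preenvelope. -/
def IsPreenvelope (X : ObjectProperty 𝒜) {A Y : 𝒜} (f : A ⟶ Y) : Prop :=
  X Y ∧ IsRelMonic X f

/-- `f : Y ⟶ A` is an `X`-precover. -/
def IsPrecover (X : ObjectProperty 𝒜) {Y A : 𝒜} (f : Y ⟶ A) : Prop :=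
  X Y ∧ IsRelEpic X f

/-- `g` is a weak cokernel of `f`. -/
def IsWeakCokernel {A B C : 𝒜} (f : A ⟶ B) (g : B ⟶ C) : Prop :=
  f ≫ g = 0 ∧ ∀ ⦃Z : 𝒜⦄ (k : B ⟶ Z), f ≫ k = 0 → ∃ t : C ⟶ Z, g ≫ t = k

/-- `f` is a weak kernel of `g`. -/
def IsWeakKernel {A B C : 𝒜} (f : A ⟶ B) (g : B ⟶ C) : Prop :=
  f ≫ g = 0 ∧ ∀ ⦃Z : 𝒜⦄ (k : Z ⟶ B), k ≫ g = 0 → ∃ t : Z ⟶ A, t ≫ f = k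

/-- The subgroup `X(A, B)` of the morphisms `A ⟶ B` factoring through an object of `X`. -/
def idealSubgroup (X : ObjectProperty 𝒜) [IsAdditiveSubcategory X] (A B : 𝒜) :
    AddSubgroup (A ⟶ B) where
  carrier := {f | FactorsThroughObj X f}
  zero_mem' := ⟨0, IsAdditiveSubcategory.zero _ (isZero_zero 𝒜), 0, 0, by simp⟩
  add_mem' := by
    rintro f g ⟨Y, hY, a, b, rfl⟩ ⟨Z, hZ, c, d, rfl⟩
    exact ⟨Y ⊞ Z, IsAdditiveSubcategory.biprod hY hZ, biprod.lift a c, biprod.desc b d, by simp⟩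
  neg_mem' := by
    rintro f ⟨Y, hY, a, b, rfl⟩
    exact ⟨Y, hY, -a, b, by simp⟩

lemma mem_idealSubgroup {X : ObjectProperty 𝒜} [IsAdditiveSubcategory X] {A B : 𝒜}
    {f : A ⟶ B} : f ∈ idealSubgroup X A B ↔ FactorsThroughObj X f := Iff.rfl

lemma FactorsThroughObj.comp_left {X : ObjectProperty 𝒜} {A B C : 𝒜} {g : B ⟶ C}
    (hg : FactorsThroughObj X g) (f : A ⟶ B) : FactorsThroughObj X (f ≫ g) := by
  obtain ⟨Y, hY, a, b, rfl⟩ := hg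
  exact ⟨Y, hY, f ≫ a, b, by simp⟩

lemma FactorsThroughObj.comp_right {X : ObjectProperty 𝒜} {A B C : 𝒜} {f : A ⟶ B}
    (hf : FactorsThroughObj X f) (g : B ⟶ C) : FactorsThroughObj X (f ≫ g) := by
  obtain ⟨Y, hY, a, b, rfl⟩ := hf
  exact ⟨Y, hY, a, b ≫ g, by simp⟩

/-- The objects of the factor category `C / X` are the objects of `C`. -/
structure Subfactor (C X : ObjectProperty 𝒜) where
  obj : 𝒜
  property : C obj

namespace Subfactor

section

variable {C X : ObjectProperty 𝒜} [IsAdditiveSubcategory X]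

/-- The composition on `Hom (A, B) / X (A, B)` induced by that of `𝒜`. -/
def comp {A B D : 𝒜} : (A ⟶ B) ⧸ idealSubgroup X A B → (B ⟶ D) ⧸ idealSubgroup X B D →
    (A ⟶ D) ⧸ idealSubgroup X A D :=
  Quotient.map₂ (fun f g => f ≫ g) (by
    intro f f' hf g g' hg
    replace hf := mem_idealSubgroup.1 (QuotientAddGroup.leftRel_apply.1 hf)
    replace hg := mem_idealSubgroup.1 (QuotientAddGroup.leftRel_apply.1 hg)
    refine QuotientAddGroup.leftRel_apply.2 (mem_idealSubgroup.2 ?_)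
    have h := (idealSubgroup X A D).add_mem (mem_idealSubgroup.2 (hf.comp_right g))
      (mem_idealSubgroup.2 (hg.comp_left f'))
    rw [mem_idealSubgroup] at h
    have e : -(f ≫ g) + f' ≫ g' = (-f + f') ≫ g + f' ≫ (-g + g') := by
      simp only [Preadditive.add_comp, Preadditive.comp_add, Preadditive.neg_comp,
        Preadditive.comp_neg]
      abel
    exact e ▸ h)

/-- The factor category `C / X`, with `Hom (A, B) / X (A, B)` as morphisms `A ⟶ B`. -/
instance : Category.{v} (Subfactor C X) where
  Hom A B := (A.obj ⟶ B.obj) ⧸ idealSubgroup X A.obj B.obj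
  id A := QuotientAddGroup.mk (𝟙 A.obj)
  comp f g := comp f g
  id_comp := by
    rintro A B ⟨f⟩
    exact congrArg QuotientAddGroup.mk (Category.id_comp f)
  comp_id := by
    rintro A B ⟨f⟩
    exact congrArg QuotientAddGroup.mk (Category.comp_id f)
  assoc := by
    rintro A B D E ⟨f⟩ ⟨g⟩ ⟨h⟩
    exact congrArg QuotientAddGroup.mk (Category.assoc f g h)

/-- The class in `C / X` of a morphism of `𝒜` between objects of `C`. -/
def cls {A B : Subfactor C X} (f : A.obj ⟶ B.obj) : A ⟶ B :=
  (QuotientAddGroup.mk f : (A.obj ⟶ B.obj) ⧸ idealSubgroup X A.obj B.obj)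

lemma cls_surjective {A B : Subfactor C X} (f : A ⟶ B) :
    ∃ f' : A.obj ⟶ B.obj, cls f' = f := by
  obtain ⟨f'⟩ := f
  exact ⟨f', rfl⟩

lemma cls_comp {A B D : Subfactor C X} (f : A.obj ⟶ B.obj) (g : B.obj ⟶ D.obj) :
    (cls (f ≫ g) : A ⟶ D) = cls (B := B) f ≫ cls g := rfl

lemma cls_id (A : Subfactor C X) : cls (𝟙 A.obj) = 𝟙 A := rfl

lemma cls_eq_iff {A B : Subfactor C X} (f g : A.obj ⟶ B.obj) :
    (cls f : A ⟶ B) = cls g ↔ FactorsThroughObj X (f - g) := by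
  refine (QuotientAddGroup.eq_iff_sub_mem (N := idealSubgroup X A.obj B.obj)).trans ?_
  exact mem_idealSubgroup

instance : Preadditive (Subfactor C X) where
  homGroup A B := inferInstanceAs (AddCommGroup ((A.obj ⟶ B.obj) ⧸ idealSubgroup X A.obj B.obj))
  add_comp := by
    rintro A B D ⟨f⟩ ⟨f'⟩ ⟨g⟩
    exact congrArg QuotientAddGroup.mk (Preadditive.add_comp _ _ _ f f' g)
  comp_add := by
    rintro A B D ⟨f⟩ ⟨g⟩ ⟨g'⟩
    exact congrArg QuotientAddGroup.mk (Preadditive.comp_add _ _ _ f g g')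

lemma cls_add {A B : Subfactor C X} (f g : A.obj ⟶ B.obj) :
    (cls (f + g) : A ⟶ B) = cls f + cls g := rfl

lemma cls_neg {A B : Subfactor C X} (f : A.obj ⟶ B.obj) :
    (cls (-f) : A ⟶ B) = -cls f := rfl

lemma cls_zero (A B : Subfactor C X) : (cls (0 : A.obj ⟶ B.obj) : A ⟶ B) = 0 := rfl

/-- The functor out of `C / X` given on morphisms by a choice of representatives `F f`. -/
def liftFunctor {D : Type*} [Category D] (o : Subfactor C X → D)
    (F : ∀ {A B : Subfactor C X}, (A.obj ⟶ B.obj) → (o A ⟶ o B))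
    (hF : ∀ {A B : Subfactor C X} (f g : A.obj ⟶ B.obj), FactorsThroughObj X (f - g) →
      F (A := A) (B := B) f = F g)
    (hid : ∀ A : Subfactor C X, F (𝟙 A.obj) = 𝟙 (o A))
    (hcomp : ∀ {A B E : Subfactor C X} (f : A.obj ⟶ B.obj) (g : B.obj ⟶ E.obj),
      F (A := A) (B := E) (f ≫ g) = F (B := B) f ≫ F g) : Subfactor C X ⥤ D where
  obj := o
  map {A B} := Quotient.lift (fun f : A.obj ⟶ B.obj => F (A := A) (B := B) f) (by
    intro f g hfg
    rw [← Quotient.eq_iff_equiv] at hfg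
    exact hF f g ((cls_eq_iff f g).1 hfg))
  map_id A := hid A
  map_comp := by
    rintro A B E ⟨f⟩ ⟨g⟩
    exact hcomp f g

end

/-- The embedding `G / X ⥤ C / X` for `G ⊆ C`. -/
def incl {G C : ObjectProperty 𝒜} (X : ObjectProperty 𝒜) [IsAdditiveSubcategory X]
    (hGC : G ≤ C) : Subfactor G X ⥤ Subfactor C X where
  obj A := ⟨A.obj, hGC _ A.property⟩
  map f := f

end Subfactor

/-! ### Partial one-sided triangulated categories -/

/-- A right `C`-sequence. -/
def IsRightCSeq {S : 𝒜 ⥤ 𝒜} (C : ObjectProperty 𝒜) (P : RightSeq S) : Prop :=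
  C P.C ∧ IsWeakCokernel P.f P.g ∧ IsWeakCokernel P.g P.h

/-- A left `F`-sequence. -/
def IsLeftFSeq {W : 𝒜 ⥤ 𝒜} (F : ObjectProperty 𝒜) (P : LeftSeq W) : Prop :=
  F P.A ∧ IsWeakKernel P.g P.h ∧ IsWeakKernel P.f P.g

/-- `(𝒜, S, R, X)` is a partial right triangulated category, where `R` is a class of right
`C`-sequences. Closure under finite direct sums is closure under binary ones: the
empty direct sum belongs to `R` by `prt1_ii` and `isoClosed`. -/
structure IsPartialRightTriangulated (S : 𝒜 ⥤ 𝒜) (C X : ObjectProperty 𝒜)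
    (R : Set (RightSeq S)) : Prop where
  le : X ≤ C
  isRightCSeq : ∀ P ∈ R, IsRightCSeq C P
  isoClosed : ∀ P Q : RightSeq S, P.Isomorphic Q → P ∈ R → Q ∈ R
  directSum : ∀ P ∈ R, ∀ Q ∈ R, RightSeq.mk (biprod.map P.f Q.f) (biprod.map P.g Q.g)
    (biprod.desc (P.h ≫ S.map biprod.inl) (Q.h ≫ S.map biprod.inr)) ∈ R
  prt1_i : ∀ ⦃A : 𝒜⦄, C A → ∃ (Y U : 𝒜) (i : A ⟶ Y) (p : Y ⟶ U) (q : U ⟶ S.obj A),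
    IsPreenvelope X i ∧ RightSeq.mk i p q ∈ R
  prt1_ii : ∀ ⦃A B : 𝒜⦄, C A → C B → ∀ f : A ⟶ B,
    RightSeq.mk (biprod.lift (𝟙 A) f) (biprod.desc f (-𝟙 B)) (0 : B ⟶ S.obj A) ∈ R
  prt1_iii : ∀ P ∈ R, C P.A → IsPreenvelope X P.f → ∀ ⦃B : 𝒜⦄, C B → ∀ f : P.A ⟶ B,
    ∃ (N : 𝒜) (g : P.B ⊞ B ⟶ N) (h : N ⟶ S.obj P.A), RightSeq.mk (biprod.lift P.f f) g h ∈ R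
  prt2 : ∀ P ∈ R, ∀ Q ∈ R, X Q.B → ∀ (α : P.A ⟶ Q.A) (β : P.B ⟶ Q.B) (γ : P.C ⟶ Q.C),
    P.f ≫ β = α ≫ Q.f → P.g ≫ γ = β ≫ Q.g → P.h ≫ S.map α = γ ≫ Q.h →
    (∃ t : P.B ⟶ Q.A, P.f ≫ t = α) → ∃ t : P.C ⟶ Q.B, t ≫ Q.g = γ
  prt3 : ∀ P ∈ R, ∀ Q ∈ R, ∀ (α : P.A ⟶ Q.A) (β : P.B ⟶ Q.B), P.f ≫ β = α ≫ Q.f →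
    ∃ γ : P.C ⟶ Q.C, P.g ≫ γ = β ≫ Q.g ∧ P.h ≫ S.map α = γ ≫ Q.h
  prt4 : ∀ {A B D C' A' B' : 𝒜} (f : A ⟶ B) (l : B ⟶ C') (m : C' ⟶ S.obj A)
    (g : B ⟶ D) (k : D ⟶ A') (j : A' ⟶ S.obj B) (p : D ⟶ B') (q : B' ⟶ S.obj A),
    C A → C B → C D → IsRelMonic X f → IsRelMonic X g →
    RightSeq.mk f l m ∈ R → RightSeq.mk g k j ∈ R → RightSeq.mk (f ≫ g) p q ∈ R →
    ∃ (r : C' ⟶ B') (s : B' ⟶ A'), l ≫ r = g ≫ p ∧ r ≫ q = m ∧ p ≫ s = k ∧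
      s ≫ j = q ≫ S.map f ∧ RightSeq.mk r s (j ≫ S.map l) ∈ R ∧ IsRelMonic X r

/-- `(𝒜, W, L, X)` is a partial left triangulated category, where `L` is a class of left
`F`-sequences (the dual notion). -/
structure IsPartialLeftTriangulated (W : 𝒜 ⥤ 𝒜) (F X : ObjectProperty 𝒜)
    (L : Set (LeftSeq W)) : Prop where
  le : X ≤ F
  isLeftFSeq : ∀ P ∈ L, IsLeftFSeq F P
  isoClosed : ∀ P Q : LeftSeq W, P.Isomorphic Q → P ∈ L → Q ∈ L
  directSum : ∀ P ∈ L, ∀ Q ∈ L, LeftSeq.mk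
    (biprod.lift (W.map biprod.fst ≫ P.f) (W.map biprod.snd ≫ Q.f))
    (biprod.map P.g Q.g) (biprod.map P.h Q.h) ∈ L
  plt1_i : ∀ ⦃A : 𝒜⦄, F A → ∃ (U Y : 𝒜) (n : W.obj A ⟶ U) (i : U ⟶ Y) (p : Y ⟶ A),
    IsPrecover X p ∧ LeftSeq.mk n i p ∈ L
  plt1_ii : ∀ ⦃A B : 𝒜⦄, F A → F B → ∀ f : B ⟶ A,
    LeftSeq.mk (0 : W.obj A ⟶ B) (biprod.lift f (-𝟙 B)) (biprod.desc (𝟙 A) f) ∈ L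
  plt1_iii : ∀ P ∈ L, F P.C → IsPrecover X P.h → ∀ ⦃B : 𝒜⦄, F B → ∀ f : B ⟶ P.C,
    ∃ (N : 𝒜) (n : W.obj P.C ⟶ N) (g : N ⟶ P.B ⊞ B), LeftSeq.mk n g (biprod.desc P.h f) ∈ L
  plt2 : ∀ P ∈ L, ∀ Q ∈ L, X P.B → ∀ (α : P.A ⟶ Q.A) (β : P.B ⟶ Q.B) (γ : P.C ⟶ Q.C),
    P.f ≫ α = W.map γ ≫ Q.f → P.g ≫ β = α ≫ Q.g → P.h ≫ γ = β ≫ Q.h →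
    (∃ t : P.C ⟶ Q.B, t ≫ Q.h = γ) → ∃ t : P.B ⟶ Q.A, P.g ≫ t = α
  plt3 : ∀ P ∈ L, ∀ Q ∈ L, ∀ (β : P.B ⟶ Q.B) (γ : P.C ⟶ Q.C), P.h ≫ γ = β ≫ Q.h →
    ∃ α : P.A ⟶ Q.A, P.g ≫ β = α ≫ Q.g ∧ P.f ≫ α = W.map γ ≫ Q.f
  plt4 : ∀ {A B D C' A' B' : 𝒜} (f : B ⟶ A) (l : C' ⟶ B) (m : W.obj A ⟶ C')
    (g : D ⟶ B) (k : A' ⟶ D) (j : W.obj B ⟶ A') (p : B' ⟶ D) (q : W.obj A ⟶ B'),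
    F A → F B → F D → IsRelEpic X f → IsRelEpic X g →
    LeftSeq.mk m l f ∈ L → LeftSeq.mk j k g ∈ L → LeftSeq.mk q p (g ≫ f) ∈ L →
    ∃ (r : B' ⟶ C') (s : A' ⟶ B'), r ≫ l = p ≫ g ∧ q ≫ r = m ∧ s ≫ p = k ∧
      j ≫ s = W.map f ≫ q ∧ LeftSeq.mk (W.map l ≫ j) s r ∈ L ∧ IsRelEpic X r

/-! ### The suspension on `C / X` and its distinguished right triangles -/

/-- A fixed right `C`-triangle `A ⟶ X^A ⟶ U^A ⟶ S A`, with `A ⟶ X^A` an `X`-preenvelope, for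
each `A` in `C`. -/
structure RightChoice (S : 𝒜 ⥤ 𝒜) (C X : ObjectProperty 𝒜) (R : Set (RightSeq S)) where
  Y : ∀ A : 𝒜, C A → 𝒜
  U : ∀ A : 𝒜, C A → 𝒜
  i : ∀ (A : 𝒜) (hA : C A), A ⟶ Y A hA
  p : ∀ (A : 𝒜) (hA : C A), Y A hA ⟶ U A hA
  q : ∀ (A : 𝒜) (hA : C A), U A hA ⟶ S.obj A
  preenvelope : ∀ (A : 𝒜) (hA : C A), IsPreenvelope X (i A hA)
  mem : ∀ (A : 𝒜) (hA : C A), RightSeq.mk (i A hA) (p A hA) (q A hA) ∈ R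

namespace RightChoice

section

variable {S : 𝒜 ⥤ 𝒜} {C X : ObjectProperty 𝒜} {R : Set (RightSeq S)}

/-- `κ : U^A ⟶ U^B` is a filler `κ^f` of the diagram of fixed right triangles over `f`. -/
def IsFiller (D : RightChoice S C X R) {A B : 𝒜} (hA : C A) (hB : C B) (f : A ⟶ B)
    (κ : D.U A hA ⟶ D.U B hB) : Prop :=
  ∃ σ : D.Y A hA ⟶ D.Y B hB, D.i A hA ≫ σ = f ≫ D.i B hB ∧ D.p A hA ≫ κ = σ ≫ D.p B hB ∧
    D.q A hA ≫ S.map f = κ ≫ D.q B hB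

lemma exists_filler (H : IsPartialRightTriangulated S C X R) (D : RightChoice S C X R)
    {A B : 𝒜} (hA : C A) (hB : C B) (f : A ⟶ B) : ∃ κ, D.IsFiller hA hB f κ := by
  obtain ⟨σ, hσ⟩ := (D.preenvelope A hA).2 (D.preenvelope B hB).1 (f ≫ D.i B hB)
  obtain ⟨κ, h₁, h₂⟩ := H.prt3 _ (D.mem A hA) _ (D.mem B hB) f σ hσ
  exact ⟨κ, σ, hσ, h₁, h₂⟩

lemma filler_unique [S.Additive] (H : IsPartialRightTriangulated S C X R)
    (D : RightChoice S C X R) {A B : 𝒜} (hA : C A) (hB : C B) {f f' : A ⟶ B} {κ κ'}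
    (hκ : D.IsFiller hA hB f κ) (hκ' : D.IsFiller hA hB f' κ')
    (hf : FactorsThroughObj X (f - f')) : FactorsThroughObj X (κ - κ') := by
  obtain ⟨σ, h₁, h₂, h₃⟩ := hκ
  obtain ⟨σ', h₁', h₂', h₃'⟩ := hκ'
  obtain ⟨Z, hZ, a, b, hab⟩ := hf
  obtain ⟨t, ht⟩ := (D.preenvelope A hA).2 hZ a
  obtain ⟨s, hs⟩ := H.prt2 _ (D.mem A hA) _ (D.mem B hB) (D.preenvelope B hB).1 (f - f')
    (σ - σ') (κ - κ') (by simp [Preadditive.comp_sub, Preadditive.sub_comp, h₁, h₁'])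
    (by simp [Preadditive.comp_sub, Preadditive.sub_comp, h₂, h₂'])
    (by simp [Preadditive.comp_sub, Preadditive.sub_comp, S.map_sub, h₃, h₃'])
    ⟨t ≫ b, by simp [reassoc_of% ht, hab]⟩
  exact ⟨_, (D.preenvelope B hB).1, _, _, hs⟩

/-- The functor `S^X : C / X ⥤ C / X`, sending `A` to `U^A` and the class of `f` to that of any
filler `κ^f`. -/
noncomputable def susp [IsAdditiveSubcategory X] [S.Additive]
    (H : IsPartialRightTriangulated S C X R) (D : RightChoice S C X R) :
    Subfactor C X ⥤ Subfactor C X :=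
  Subfactor.liftFunctor (fun A => ⟨D.U A.obj A.property, (H.isRightCSeq _ (D.mem _ _)).1⟩)
    (fun {A B} f => Subfactor.cls (D.exists_filler H A.property B.property f).choose)
    (by
      intro A B f g hfg
      exact (Subfactor.cls_eq_iff _ _).2 (D.filler_unique H _ _
        (D.exists_filler H A.property B.property f).choose_spec
        (D.exists_filler H A.property B.property g).choose_spec hfg))
    (by
      intro A
      rw [← Subfactor.cls_id]
      refine (Subfactor.cls_eq_iff _ _).2 (D.filler_unique H _ _
        (D.exists_filler H A.property A.property (𝟙 A.obj)).choose_spec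
        (f' := 𝟙 A.obj) ⟨𝟙 _, by simp, by simp, by simp⟩ ?_)
      rw [sub_self]
      exact (idealSubgroup X _ _).zero_mem)
    (by
      intro A B E f g
      rw [← Subfactor.cls_comp]
      obtain ⟨σ, h₁, h₂, h₃⟩ := (D.exists_filler H A.property B.property f).choose_spec
      obtain ⟨τ, k₁, k₂, k₃⟩ := (D.exists_filler H B.property E.property g).choose_spec
      refine (Subfactor.cls_eq_iff _ _).2 (D.filler_unique H _ _
        (D.exists_filler H A.property E.property (f ≫ g)).choose_spec
        (f' := f ≫ g) ⟨σ ≫ τ, ?_, ?_, ?_⟩ ?_)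
      · rw [reassoc_of% h₁, k₁, Category.assoc]
      · rw [reassoc_of% h₂, k₂, Category.assoc]
      · rw [S.map_comp, reassoc_of% h₃, k₃, Category.assoc]
      · rw [sub_self]
        exact (idealSubgroup X _ _).zero_mem)

/-- Any filler represents the value of `S^X` on a morphism. -/
lemma susp_map_mk [IsAdditiveSubcategory X] [S.Additive]
    (H : IsPartialRightTriangulated S C X R) (D : RightChoice S C X R)
    {A B : Subfactor C X} (f : A.obj ⟶ B.obj) (κ : D.U A.obj A.property ⟶ D.U B.obj B.property)
    (hκ : D.IsFiller A.property B.property f κ) :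
    (D.susp H).map (Subfactor.cls f : A ⟶ B) =
      Subfactor.cls (A := (D.susp H).obj A) (B := (D.susp H).obj B) κ := by
  refine (Subfactor.cls_eq_iff _ _).2 (D.filler_unique H _ _
    (D.exists_filler H A.property B.property f).choose_spec hκ ?_)
  rw [sub_self]
  exact (idealSubgroup X _ _).zero_mem

end

variable {S : 𝒜 ⥤ 𝒜} [S.Additive] {C X : ObjectProperty 𝒜} [IsAdditiveSubcategory X]
  {R : Set (RightSeq S)}

/-- The standard right triangles of `C / X`: the sequences induced by a right `C`-triangle
`A ⟶ B ⟶ E ⟶ S A` with `f : A ⟶ B` an `X`-monic in `C`, with third morphism the class of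
`ξ`, where `(1, δ, ξ)` is a morphism to the fixed right triangle of `A`. -/
def standard (H : IsPartialRightTriangulated S C X R) (D : RightChoice S C X R) :
    Set (RightSeq (D.susp H)) :=
  {P | ∃ (A B E : Subfactor C X) (f : A.obj ⟶ B.obj) (g : B.obj ⟶ E.obj)
      (h : E.obj ⟶ S.obj A.obj) (δ : B.obj ⟶ D.Y A.obj A.property)
      (ξ : E.obj ⟶ D.U A.obj A.property),
    RightSeq.mk f g h ∈ R ∧ IsRelMonic X f ∧ f ≫ δ = D.i A.obj A.property ∧
    g ≫ ξ = δ ≫ D.p A.obj A.property ∧ h = ξ ≫ D.q A.obj A.property ∧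
    P = RightSeq.mk (Subfactor.cls f : A ⟶ B) (Subfactor.cls g : B ⟶ E)
      (Subfactor.cls (B := (D.susp H).obj A) ξ)}

/-- The distinguished right triangles `Δ^X` of `C / X`. -/
def distinguished (H : IsPartialRightTriangulated S C X R) (D : RightChoice S C X R) :
    Set (RightSeq (D.susp H)) :=
  {P | ∃ Q ∈ D.standard H, P.Isomorphic Q}

end RightChoice

/-! ### The loop functor on `F / X` and its distinguished left triangles -/

/-- A fixed left `F`-triangle `W A ⟶ U_A ⟶ X_A ⟶ A`, with `X_A ⟶ A` an `X`-precover, for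
each `A` in `F`. -/
structure LeftChoice (W : 𝒜 ⥤ 𝒜) (F X : ObjectProperty 𝒜) (L : Set (LeftSeq W)) where
  U : ∀ A : 𝒜, F A → 𝒜
  Y : ∀ A : 𝒜, F A → 𝒜
  ν : ∀ (A : 𝒜) (hA : F A), W.obj A ⟶ U A hA
  ι : ∀ (A : 𝒜) (hA : F A), U A hA ⟶ Y A hA
  π : ∀ (A : 𝒜) (hA : F A), Y A hA ⟶ A
  precover : ∀ (A : 𝒜) (hA : F A), IsPrecover X (π A hA)
  mem : ∀ (A : 𝒜) (hA : F A), LeftSeq.mk (ν A hA) (ι A hA) (π A hA) ∈ L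

namespace LeftChoice

section

variable {W : 𝒜 ⥤ 𝒜} {F X : ObjectProperty 𝒜} {L : Set (LeftSeq W)}

/-- `κ : U_A ⟶ U_B` is a filler of the diagram of fixed left triangles over `f`. -/
def IsFiller (D : LeftChoice W F X L) {A B : 𝒜} (hA : F A) (hB : F B) (f : A ⟶ B)
    (κ : D.U A hA ⟶ D.U B hB) : Prop :=
  ∃ σ : D.Y A hA ⟶ D.Y B hB, D.π A hA ≫ f = σ ≫ D.π B hB ∧ D.ι A hA ≫ σ = κ ≫ D.ι B hB ∧
    D.ν A hA ≫ κ = W.map f ≫ D.ν B hB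

lemma exists_filler (H : IsPartialLeftTriangulated W F X L) (D : LeftChoice W F X L)
    {A B : 𝒜} (hA : F A) (hB : F B) (f : A ⟶ B) : ∃ κ, D.IsFiller hA hB f κ := by
  obtain ⟨σ, hσ⟩ := (D.precover B hB).2 (D.precover A hA).1 (D.π A hA ≫ f)
  obtain ⟨κ, h₁, h₂⟩ := H.plt3 _ (D.mem A hA) _ (D.mem B hB) σ f hσ.symm
  exact ⟨κ, σ, hσ.symm, h₁, h₂⟩

lemma filler_unique [W.Additive] (H : IsPartialLeftTriangulated W F X L)
    (D : LeftChoice W F X L) {A B : 𝒜} (hA : F A) (hB : F B) {f f' : A ⟶ B} {κ κ'}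
    (hκ : D.IsFiller hA hB f κ) (hκ' : D.IsFiller hA hB f' κ')
    (hf : FactorsThroughObj X (f - f')) : FactorsThroughObj X (κ - κ') := by
  obtain ⟨σ, h₁, h₂, h₃⟩ := hκ
  obtain ⟨σ', h₁', h₂', h₃'⟩ := hκ'
  obtain ⟨Z, hZ, a, b, hab⟩ := hf
  obtain ⟨t, ht⟩ := (D.precover B hB).2 hZ b
  obtain ⟨s, hs⟩ := H.plt2 _ (D.mem A hA) _ (D.mem B hB) (D.precover A hA).1 (κ - κ')
    (σ - σ') (f - f') (by simp [Preadditive.comp_sub, Preadditive.sub_comp, W.map_sub, h₃, h₃'])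
    (by simp [Preadditive.comp_sub, Preadditive.sub_comp, h₂, h₂'])
    (by simp [Preadditive.comp_sub, Preadditive.sub_comp, h₁, h₁'])
    ⟨a ≫ t, by simp [ht, hab]⟩
  exact ⟨_, (D.precover A hA).1, _, _, hs⟩

/-- The functor `W_X : F / X ⥤ F / X`, sending `A` to `U_A` and the class of `f` to that of any
filler. -/
noncomputable def loop [IsAdditiveSubcategory X] [W.Additive]
    (H : IsPartialLeftTriangulated W F X L) (D : LeftChoice W F X L) :
    Subfactor F X ⥤ Subfactor F X :=
  Subfactor.liftFunctor (fun A => ⟨D.U A.obj A.property, (H.isLeftFSeq _ (D.mem _ _)).1⟩)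
    (fun {A B} f => Subfactor.cls (D.exists_filler H A.property B.property f).choose)
    (by
      intro A B f g hfg
      exact (Subfactor.cls_eq_iff _ _).2 (D.filler_unique H _ _
        (D.exists_filler H A.property B.property f).choose_spec
        (D.exists_filler H A.property B.property g).choose_spec hfg))
    (by
      intro A
      rw [← Subfactor.cls_id]
      refine (Subfactor.cls_eq_iff _ _).2 (D.filler_unique H _ _
        (D.exists_filler H A.property A.property (𝟙 A.obj)).choose_spec
        (f' := 𝟙 A.obj) ⟨𝟙 _, by simp, by simp, by simp⟩ ?_)
      rw [sub_self]
      exact (idealSubgroup X _ _).zero_mem)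
    (by
      intro A B E f g
      rw [← Subfactor.cls_comp]
      obtain ⟨σ, h₁, h₂, h₃⟩ := (D.exists_filler H A.property B.property f).choose_spec
      obtain ⟨τ, k₁, k₂, k₃⟩ := (D.exists_filler H B.property E.property g).choose_spec
      refine (Subfactor.cls_eq_iff _ _).2 (D.filler_unique H _ _
        (D.exists_filler H A.property E.property (f ≫ g)).choose_spec
        (f' := f ≫ g) ⟨σ ≫ τ, ?_, ?_, ?_⟩ ?_)
      · rw [reassoc_of% h₁, k₁, Category.assoc]
      · rw [reassoc_of% h₂, k₂, Category.assoc]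
      · rw [W.map_comp, reassoc_of% h₃, k₃, Category.assoc]
      · rw [sub_self]
        exact (idealSubgroup X _ _).zero_mem)

/-- Any filler represents the value of `W_X` on a morphism. -/
lemma loop_map_mk [IsAdditiveSubcategory X] [W.Additive]
    (H : IsPartialLeftTriangulated W F X L) (D : LeftChoice W F X L)
    {A B : Subfactor F X} (f : A.obj ⟶ B.obj) (κ : D.U A.obj A.property ⟶ D.U B.obj B.property)
    (hκ : D.IsFiller A.property B.property f κ) :
    (D.loop H).map (Subfactor.cls f : A ⟶ B) =
      Subfactor.cls (A := (D.loop H).obj A) (B := (D.loop H).obj B) κ := by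
  refine (Subfactor.cls_eq_iff _ _).2 (D.filler_unique H _ _
    (D.exists_filler H A.property B.property f).choose_spec hκ ?_)
  rw [sub_self]
  exact (idealSubgroup X _ _).zero_mem

end

variable {W : 𝒜 ⥤ 𝒜} [W.Additive] {F X : ObjectProperty 𝒜} [IsAdditiveSubcategory X]
  {L : Set (LeftSeq W)}

/-- The standard left triangles of `F / X`: the sequences induced by a left `F`-triangle
`W B ⟶ K ⟶ A ⟶ B` with `h : A ⟶ B` an `X`-epic in `F`, with first morphism the class of
`ξ`, where `(ξ, δ, 1)` is a morphism from the fixed left triangle of `B`. -/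
def standard (H : IsPartialLeftTriangulated W F X L) (D : LeftChoice W F X L) :
    Set (LeftSeq (D.loop H)) :=
  {P | ∃ (K A B : Subfactor F X) (f : W.obj B.obj ⟶ K.obj) (g : K.obj ⟶ A.obj)
      (h : A.obj ⟶ B.obj) (δ : D.Y B.obj B.property ⟶ A.obj)
      (ξ : D.U B.obj B.property ⟶ K.obj),
    LeftSeq.mk f g h ∈ L ∧ IsRelEpic X h ∧ δ ≫ h = D.π B.obj B.property ∧
    ξ ≫ g = D.ι B.obj B.property ≫ δ ∧ f = D.ν B.obj B.property ≫ ξ ∧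
    P = LeftSeq.mk (Subfactor.cls (A := (D.loop H).obj B) ξ) (Subfactor.cls g : K ⟶ A)
      (Subfactor.cls h : A ⟶ B)}

/-- The distinguished left triangles `∇_X` of `F / X`. -/
def distinguished (H : IsPartialLeftTriangulated W F X L) (D : LeftChoice W F X L) :
    Set (LeftSeq (D.loop H)) :=
  {P | ∃ Q ∈ D.standard H, P.Isomorphic Q}

end LeftChoice

/-! ### Special preenveloping subcategories -/

/-- `G`, with `X ⊆ G ⊆ C`, is special preenveloping in `C`, with a fixed right `C`-triangle
`A ⟶ R A ⟶ W^A ⟶ S A` for each `A` in `C`, where `j : A ⟶ R A` is a `G`-preenvelope and all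
morphisms from `W^A` to objects of `G` vanish in `C / X`. -/
structure SpecialPreenveloping (S : 𝒜 ⥤ 𝒜) (C X : ObjectProperty 𝒜) (R : Set (RightSeq S))
    (G : ObjectProperty 𝒜) where
  X_le : X ≤ G
  le_C : G ≤ C
  obj : ∀ A : 𝒜, C A → 𝒜
  cone : ∀ A : 𝒜, C A → 𝒜
  j : ∀ (A : 𝒜) (hA : C A), A ⟶ obj A hA
  τ : ∀ (A : 𝒜) (hA : C A), obj A hA ⟶ cone A hA
  ω : ∀ (A : 𝒜) (hA : C A), cone A hA ⟶ S.obj A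
  mem : ∀ (A : 𝒜) (hA : C A), RightSeq.mk (j A hA) (τ A hA) (ω A hA) ∈ R
  preenvelope : ∀ (A : 𝒜) (hA : C A), IsPreenvelope G (j A hA)
  perp : ∀ (A : 𝒜) (hA : C A) ⦃B : 𝒜⦄, G B → ∀ f : cone A hA ⟶ B, FactorsThroughObj X f

namespace SpecialPreenveloping

section

variable {S : 𝒜 ⥤ 𝒜} {C X : ObjectProperty 𝒜} {R : Set (RightSeq S)} {G : ObjectProperty 𝒜}

lemma exists_ext (E : SpecialPreenveloping S C X R G) {A B : 𝒜} (hA : C A) (hB : C B)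
    (f : A ⟶ B) : ∃ f' : E.obj A hA ⟶ E.obj B hB, E.j A hA ≫ f' = f ≫ E.j B hB :=
  (E.preenvelope A hA).2 (E.preenvelope B hB).1 _

lemma ext_unique [IsAdditiveSubcategory X] (H : IsPartialRightTriangulated S C X R)
    (E : SpecialPreenveloping S C X R G) {A B : 𝒜} (hA : C A) (hB : C B) {f g : A ⟶ B}
    {f' g' : E.obj A hA ⟶ E.obj B hB} (hf : E.j A hA ≫ f' = f ≫ E.j B hB)
    (hg : E.j A hA ≫ g' = g ≫ E.j B hB) (hfg : FactorsThroughObj X (f - g)) :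
    FactorsThroughObj X (f' - g') := by
  obtain ⟨Z, hZ, a, b, hab⟩ := hfg
  obtain ⟨t, ht⟩ := (E.preenvelope A hA).2 (E.X_le _ hZ) a
  obtain ⟨l, hl⟩ := ((H.isRightCSeq _ (E.mem A hA)).2.1).2
    (f' - g' - t ≫ b ≫ E.j B hB) (by
      simp only [Preadditive.comp_sub, hf, hg]
      rw [reassoc_of% ht, reassoc_of% hab, Preadditive.sub_comp, sub_self])
  have h₁ : FactorsThroughObj X (E.τ A hA ≫ l) :=
    (E.perp A hA (E.preenvelope B hB).1 l).comp_left _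
  have h₂ : FactorsThroughObj X (t ≫ b ≫ E.j B hB) := ⟨Z, hZ, _, _, rfl⟩
  have h₃ := (idealSubgroup X _ _).add_mem (mem_idealSubgroup.2 h₁) (mem_idealSubgroup.2 h₂)
  have e : E.τ A hA ≫ l = f' - g' - t ≫ b ≫ E.j B hB := hl
  rwa [e, sub_add_cancel] at h₃

/-- The functor `R : C / X ⥤ G / X`, sending `A` to `R A` and the class of `f` to that of any
extension of `f` along the fixed preenvelopes. -/
noncomputable def reflector [IsAdditiveSubcategory X] (H : IsPartialRightTriangulated S C X R)
    (E : SpecialPreenveloping S C X R G) : Subfactor C X ⥤ Subfactor G X :=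
  Subfactor.liftFunctor (fun A => ⟨E.obj A.obj A.property, (E.preenvelope _ _).1⟩)
    (fun {A B} f => Subfactor.cls (E.exists_ext A.property B.property f).choose)
    (by
      intro A B f g hfg
      exact (Subfactor.cls_eq_iff _ _).2 (E.ext_unique H _ _
        (E.exists_ext A.property B.property f).choose_spec
        (E.exists_ext A.property B.property g).choose_spec hfg))
    (by
      intro A
      rw [← Subfactor.cls_id]
      refine (Subfactor.cls_eq_iff _ _).2 (E.ext_unique H _ _
        (E.exists_ext A.property A.property (𝟙 A.obj)).choose_spec (g := 𝟙 A.obj) (by simp) ?_)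
      rw [sub_self]
      exact (idealSubgroup X _ _).zero_mem)
    (by
      intro A B D f g
      rw [← Subfactor.cls_comp]
      refine (Subfactor.cls_eq_iff _ _).2 (E.ext_unique H _ _
        (E.exists_ext A.property D.property (f ≫ g)).choose_spec (g := f ≫ g) ?_ ?_)
      · rw [reassoc_of% (E.exists_ext A.property B.property f).choose_spec,
          (E.exists_ext B.property D.property g).choose_spec, Category.assoc]
      · rw [sub_self]
        exact (idealSubgroup X _ _).zero_mem)

/-- Any extension represents the value of `R` on a morphism. -/
lemma reflector_map_mk [IsAdditiveSubcategory X] (H : IsPartialRightTriangulated S C X R)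
    (E : SpecialPreenveloping S C X R G) {A B : Subfactor C X} (f : A.obj ⟶ B.obj)
    (f' : E.obj A.obj A.property ⟶ E.obj B.obj B.property)
    (hf' : E.j A.obj A.property ≫ f' = f ≫ E.j B.obj B.property) :
    (E.reflector H).map (Subfactor.cls f : A ⟶ B) =
      Subfactor.cls (A := (E.reflector H).obj A) (B := (E.reflector H).obj B) f' := by
  refine (Subfactor.cls_eq_iff _ _).2 (E.ext_unique H _ _
    (E.exists_ext A.property B.property f).choose_spec hf' ?_)
  rw [sub_self]
  exact (idealSubgroup X _ _).zero_mem

/-- The class `A ⟶ R A` of `j` in `C / X`. -/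
noncomputable def unit [IsAdditiveSubcategory X] (H : IsPartialRightTriangulated S C X R)
    (E : SpecialPreenveloping S C X R G) (A : Subfactor C X) :
    A ⟶ (Subfactor.incl X E.le_C).obj ((E.reflector H).obj A) :=
  Subfactor.cls (B := (Subfactor.incl X E.le_C).obj ((E.reflector H).obj A))
    (E.j A.obj A.property)

/-- The class `A ⟶ R A` of `j` in `G / X`, for `A` in `G`. It is the canonical isomorphism
through which `R A` is identified with `A` when `A` is in `G`. -/
noncomputable def unitG [IsAdditiveSubcategory X] (H : IsPartialRightTriangulated S C X R)
    (E : SpecialPreenveloping S C X R G) (A : Subfactor G X) :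
    A ⟶ (E.reflector H).obj ((Subfactor.incl X E.le_C).obj A) :=
  Subfactor.cls (B := (E.reflector H).obj ((Subfactor.incl X E.le_C).obj A))
    (E.j A.obj (E.le_C _ A.property))

end

variable {S : 𝒜 ⥤ 𝒜} [S.Additive] {C X : ObjectProperty 𝒜} [IsAdditiveSubcategory X]
  {R : Set (RightSeq S)} {G : ObjectProperty 𝒜}

/-- The special preenveloping subcategory `G` is stabilizing. -/
def IsStabilizing (H : IsPartialRightTriangulated S C X R) (D : RightChoice S C X R)
    (E : SpecialPreenveloping S C X R G) : Prop :=
  ∀ {A B K M : Subfactor C X} (f : A ⟶ B) (g : B ⟶ K) (h : K ⟶ (D.susp H).obj A)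
    (g' : (Subfactor.incl X E.le_C).obj ((E.reflector H).obj B) ⟶ M)
    (h' : M ⟶ (D.susp H).obj ((Subfactor.incl X E.le_C).obj ((E.reflector H).obj A))),
    RightSeq.mk f g h ∈ D.distinguished H →
    RightSeq.mk ((Subfactor.incl X E.le_C).map ((E.reflector H).map f)) g' h' ∈
      D.distinguished H →
    ∃ t : K ⟶ M, g ≫ t = E.unit H B ≫ g' ∧ h ≫ (D.susp H).map (E.unit H A) = t ≫ h' ∧
      IsIso ((E.reflector H).map t)

/-- The functor `G^X = R ∘ S^X ∘ E : G / X ⥤ G / X`, where `E` is the embedding of `G / X` into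
`C / X`. -/
noncomputable def suspG (H : IsPartialRightTriangulated S C X R) (D : RightChoice S C X R)
    (E : SpecialPreenveloping S C X R G) : Subfactor G X ⥤ Subfactor G X :=
  Subfactor.incl X E.le_C ⋙ D.susp H ⋙ E.reflector H

/-- The standard right triangles of `G / X`: the sequences
`A ⟶ B ⟶ R K ⟶ R (S^X A) = G^X A` induced by distinguished right triangles
`A ⟶ B ⟶ K ⟶ S^X A` of `C / X` with `A` and `B` in `G`. -/
def standardG (H : IsPartialRightTriangulated S C X R) (D : RightChoice S C X R)
    (E : SpecialPreenveloping S C X R G) : Set (RightSeq (E.suspG H D)) :=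
  {P | ∃ (A B : Subfactor G X) (K : Subfactor C X) (f : A ⟶ B)
      (g : (Subfactor.incl X E.le_C).obj B ⟶ K)
      (h : K ⟶ (D.susp H).obj ((Subfactor.incl X E.le_C).obj A)),
    RightSeq.mk ((Subfactor.incl X E.le_C).map f) g h ∈ D.distinguished H ∧
    P = RightSeq.mk (S := E.suspG H D) f (E.unitG H B ≫ (E.reflector H).map g)
      ((E.reflector H).map h)}

/-- The class `Δ^X(G)` of right triangles of `G / X`. -/
def distinguishedG (H : IsPartialRightTriangulated S C X R) (D : RightChoice S C X R)
    (E : SpecialPreenveloping S C X R G) : Set (RightSeq (E.suspG H D)) :=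
  {P | ∃ Q ∈ E.standardG H D, P.Isomorphic Q}

end SpecialPreenveloping

/-! ### Special precovering subcategories -/

/-- `G`, with `X ⊆ G ⊆ F`, is special precovering in `F`, with a fixed left `F`-triangle
`W A ⟶ W_A ⟶ Q A ⟶ A` for each `A` in `F`, where `r : Q A ⟶ A` is a `G`-precover and all
morphisms from objects of `G` to `W_A` vanish in `F / X`. -/
structure SpecialPrecovering (W : 𝒜 ⥤ 𝒜) (F X : ObjectProperty 𝒜) (L : Set (LeftSeq W))
    (G : ObjectProperty 𝒜) where
  X_le : X ≤ G
  le_F : G ≤ F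
  obj : ∀ A : 𝒜, F A → 𝒜
  cocone : ∀ A : 𝒜, F A → 𝒜
  τ : ∀ (A : 𝒜) (hA : F A), W.obj A ⟶ cocone A hA
  ω : ∀ (A : 𝒜) (hA : F A), cocone A hA ⟶ obj A hA
  r : ∀ (A : 𝒜) (hA : F A), obj A hA ⟶ A
  mem : ∀ (A : 𝒜) (hA : F A), LeftSeq.mk (τ A hA) (ω A hA) (r A hA) ∈ L
  precover : ∀ (A : 𝒜) (hA : F A), IsPrecover G (r A hA)
  perp : ∀ (A : 𝒜) (hA : F A) ⦃B : 𝒜⦄, G B → ∀ f : B ⟶ cocone A hA, FactorsThroughObj X f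

namespace SpecialPrecovering

section

variable {W : 𝒜 ⥤ 𝒜} {F X : ObjectProperty 𝒜} {L : Set (LeftSeq W)} {G : ObjectProperty 𝒜}

lemma exists_lift (E : SpecialPrecovering W F X L G) {A B : 𝒜} (hA : F A) (hB : F B)
    (f : A ⟶ B) : ∃ f' : E.obj A hA ⟶ E.obj B hB, f' ≫ E.r B hB = E.r A hA ≫ f :=
  (E.precover B hB).2 (E.precover A hA).1 _

lemma lift_unique [IsAdditiveSubcategory X] (H : IsPartialLeftTriangulated W F X L)
    (E : SpecialPrecovering W F X L G) {A B : 𝒜} (hA : F A) (hB : F B) {f g : A ⟶ B}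
    {f' g' : E.obj A hA ⟶ E.obj B hB} (hf : f' ≫ E.r B hB = E.r A hA ≫ f)
    (hg : g' ≫ E.r B hB = E.r A hA ≫ g) (hfg : FactorsThroughObj X (f - g)) :
    FactorsThroughObj X (f' - g') := by
  obtain ⟨Z, hZ, a, b, hab⟩ := hfg
  obtain ⟨t, ht⟩ := (E.precover B hB).2 (E.X_le _ hZ) b
  obtain ⟨l, hl⟩ := ((H.isLeftFSeq _ (E.mem B hB)).2.1).2
    (f' - g' - (E.r A hA ≫ a) ≫ t) (by
      simp only [Preadditive.sub_comp, hf, hg, Category.assoc, ht, hab]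
      rw [Preadditive.comp_sub, sub_self])
  have h₁ : FactorsThroughObj X (l ≫ E.ω B hB) :=
    (E.perp B hB (E.precover A hA).1 l).comp_right _
  have h₂ : FactorsThroughObj X ((E.r A hA ≫ a) ≫ t) := ⟨Z, hZ, _, _, rfl⟩
  have h₃ := (idealSubgroup X _ _).add_mem (mem_idealSubgroup.2 h₁) (mem_idealSubgroup.2 h₂)
  have e : l ≫ E.ω B hB = f' - g' - (E.r A hA ≫ a) ≫ t := hl
  rwa [e, sub_add_cancel] at h₃

/-- The functor `Q : F / X ⥤ G / X`, sending `A` to `Q A` and the class of `f` to that of any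
lift of `f` along the fixed precovers. -/
noncomputable def coreflector [IsAdditiveSubcategory X] (H : IsPartialLeftTriangulated W F X L)
    (E : SpecialPrecovering W F X L G) : Subfactor F X ⥤ Subfactor G X :=
  Subfactor.liftFunctor (fun A => ⟨E.obj A.obj A.property, (E.precover _ _).1⟩)
    (fun {A B} f => Subfactor.cls (E.exists_lift A.property B.property f).choose)
    (by
      intro A B f g hfg
      exact (Subfactor.cls_eq_iff _ _).2 (E.lift_unique H _ _
        (E.exists_lift A.property B.property f).choose_spec
        (E.exists_lift A.property B.property g).choose_spec hfg))
    (by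
      intro A
      rw [← Subfactor.cls_id]
      refine (Subfactor.cls_eq_iff _ _).2 (E.lift_unique H _ _
        (E.exists_lift A.property A.property (𝟙 A.obj)).choose_spec (g := 𝟙 A.obj) (by simp) ?_)
      rw [sub_self]
      exact (idealSubgroup X _ _).zero_mem)
    (by
      intro A B D f g
      rw [← Subfactor.cls_comp]
      refine (Subfactor.cls_eq_iff _ _).2 (E.lift_unique H _ _
        (E.exists_lift A.property D.property (f ≫ g)).choose_spec (g := f ≫ g) ?_ ?_)
      · rw [Category.assoc, (E.exists_lift B.property D.property g).choose_spec,
          reassoc_of% (E.exists_lift A.property B.property f).choose_spec]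
      · rw [sub_self]
        exact (idealSubgroup X _ _).zero_mem)

/-- Any lift represents the value of `Q` on a morphism. -/
lemma coreflector_map_mk [IsAdditiveSubcategory X] (H : IsPartialLeftTriangulated W F X L)
    (E : SpecialPrecovering W F X L G) {A B : Subfactor F X} (f : A.obj ⟶ B.obj)
    (f' : E.obj A.obj A.property ⟶ E.obj B.obj B.property)
    (hf' : f' ≫ E.r B.obj B.property = E.r A.obj A.property ≫ f) :
    (E.coreflector H).map (Subfactor.cls f : A ⟶ B) =
      Subfactor.cls (A := (E.coreflector H).obj A) (B := (E.coreflector H).obj B) f' := by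
  refine (Subfactor.cls_eq_iff _ _).2 (E.lift_unique H _ _
    (E.exists_lift A.property B.property f).choose_spec hf' ?_)
  rw [sub_self]
  exact (idealSubgroup X _ _).zero_mem

/-- The class `Q A ⟶ A` of `r` in `F / X`. -/
noncomputable def counit [IsAdditiveSubcategory X] (H : IsPartialLeftTriangulated W F X L)
    (E : SpecialPrecovering W F X L G) (A : Subfactor F X) :
    (Subfactor.incl X E.le_F).obj ((E.coreflector H).obj A) ⟶ A :=
  Subfactor.cls (A := (Subfactor.incl X E.le_F).obj ((E.coreflector H).obj A))
    (E.r A.obj A.property)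

/-- The class `Q A ⟶ A` of `r` in `G / X`, for `A` in `G`. It is the canonical isomorphism
through which `Q A` is identified with `A` when `A` is in `G`. -/
noncomputable def counitG [IsAdditiveSubcategory X] (H : IsPartialLeftTriangulated W F X L)
    (E : SpecialPrecovering W F X L G) (A : Subfactor G X) :
    (E.coreflector H).obj ((Subfactor.incl X E.le_F).obj A) ⟶ A :=
  Subfactor.cls (A := (E.coreflector H).obj ((Subfactor.incl X E.le_F).obj A))
    (E.r A.obj (E.le_F _ A.property))

end

variable {W : 𝒜 ⥤ 𝒜} [W.Additive] {F X : ObjectProperty 𝒜} [IsAdditiveSubcategory X]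
  {L : Set (LeftSeq W)} {G : ObjectProperty 𝒜}

/-- The special precovering subcategory `G` is stabilizing. -/
def IsStabilizing (H : IsPartialLeftTriangulated W F X L) (D : LeftChoice W F X L)
    (E : SpecialPrecovering W F X L G) : Prop :=
  ∀ {A B K M : Subfactor F X} (f : (D.loop H).obj B ⟶ M) (g : M ⟶ A) (h : A ⟶ B)
    (f' : (D.loop H).obj ((Subfactor.incl X E.le_F).obj ((E.coreflector H).obj B)) ⟶ K)
    (g' : K ⟶ (Subfactor.incl X E.le_F).obj ((E.coreflector H).obj A)),
    LeftSeq.mk f g h ∈ D.distinguished H →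
    LeftSeq.mk f' g' ((Subfactor.incl X E.le_F).map ((E.coreflector H).map h)) ∈
      D.distinguished H →
    ∃ s : K ⟶ M, g' ≫ E.counit H A = s ≫ g ∧ f' ≫ s = (D.loop H).map (E.counit H B) ≫ f ∧
      IsIso ((E.coreflector H).map s)

/-- The functor `H_X = Q ∘ W_X ∘ E : G / X ⥤ G / X`, where `E` is the embedding of `G / X` into
`F / X`. -/
noncomputable def loopG (H : IsPartialLeftTriangulated W F X L) (D : LeftChoice W F X L)
    (E : SpecialPrecovering W F X L G) : Subfactor G X ⥤ Subfactor G X :=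
  Subfactor.incl X E.le_F ⋙ D.loop H ⋙ E.coreflector H

/-- The standard left triangles of `G / X`: the sequences
`H_X B = Q (W_X B) ⟶ Q K ⟶ A ⟶ B` induced by distinguished left triangles
`W_X B ⟶ K ⟶ A ⟶ B` of `F / X` with `A` and `B` in `G`. -/
def standardG (H : IsPartialLeftTriangulated W F X L) (D : LeftChoice W F X L)
    (E : SpecialPrecovering W F X L G) : Set (LeftSeq (E.loopG H D)) :=
  {P | ∃ (A B : Subfactor G X) (K : Subfactor F X)
      (f : (D.loop H).obj ((Subfactor.incl X E.le_F).obj B) ⟶ K)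
      (g : K ⟶ (Subfactor.incl X E.le_F).obj A) (h : A ⟶ B),
    LeftSeq.mk f g ((Subfactor.incl X E.le_F).map h) ∈ D.distinguished H ∧
    P = LeftSeq.mk (W := E.loopG H D) ((E.coreflector H).map f)
      ((E.coreflector H).map g ≫ E.counitG H A) h}

/-- The class `∇_X(G)` of left triangles of `G / X`. -/
def distinguishedG (H : IsPartialLeftTriangulated W F X L) (D : LeftChoice W F X L)
    (E : SpecialPrecovering W F X L G) : Set (LeftSeq (E.loopG H D)) :=
  {P | ∃ Q ∈ E.standardG H D, P.Isomorphic Q}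

end SpecialPrecovering

/-! ### Pre-partial triangulated categories -/

/-- The structure of a pre-partial triangulated category `(𝒜, W, S, L(F), R(C), X)`, together
with the fixed triangles entering its definition. -/
structure PrePartialTriangulated (W S : 𝒜 ⥤ 𝒜) [W.Additive] [S.Additive]
    (L : Set (LeftSeq W)) (R : Set (RightSeq S)) (F C X : ObjectProperty 𝒜)
    [IsAdditiveSubcategory X] where
  right : IsPartialRightTriangulated S C X R
  left : IsPartialLeftTriangulated W F X L
  rightChoice : RightChoice S C X R
  leftChoice : LeftChoice W F X L
  adj : W ⊣ S
  preenv : SpecialPreenveloping S C X R (C ⊓ F)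
  precov : SpecialPrecovering W F X L (C ⊓ F)
  preenv_stabilizing : preenv.IsStabilizing right rightChoice
  precov_stabilizing : precov.IsStabilizing left leftChoice
  c_i : ∀ P ∈ R, IsRelMonic X P.f → ∀ Q ∈ L, IsRelEpic X Q.h →
    ∀ (β : P.B ⟶ Q.B) (γ : P.C ⟶ Q.C), P.g ≫ γ = β ≫ Q.h →
    ∃ α : P.A ⟶ Q.A, α ≫ Q.g = P.f ≫ β ∧
      W.map γ ≫ Q.f = -((adj.homEquiv P.C P.A).symm P.h ≫ α)
  c_ii : ∀ P ∈ R, IsRelMonic X P.f → ∀ Q ∈ L, IsRelEpic X Q.h →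
    ∀ (β : P.B ⟶ Q.B) (α : P.A ⟶ Q.A), α ≫ Q.g = P.f ≫ β →
    ∃ γ : P.C ⟶ Q.C, P.g ≫ γ = β ≫ Q.h ∧
      P.h ≫ S.map α = -(γ ≫ adj.homEquiv Q.C Q.A Q.f)
  d : ∀ (A : 𝒜) (hC : C A), F A → ∀ Q ∈ L, IsRelEpic X Q.h →
    ∀ (α : A ⟶ Q.A) (β : rightChoice.Y A hC ⟶ Q.B) (γ : rightChoice.U A hC ⟶ Q.C),
    α ≫ Q.g = rightChoice.i A hC ≫ β → rightChoice.p A hC ≫ γ = β ≫ Q.h →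
    W.map γ ≫ Q.f = -((adj.homEquiv (rightChoice.U A hC) A).symm (rightChoice.q A hC) ≫ α) →
    (∃ t : rightChoice.U A hC ⟶ Q.B, t ≫ Q.h = γ) →
    ∃ t : rightChoice.Y A hC ⟶ Q.A, rightChoice.i A hC ≫ t = α
  e : ∀ (D : 𝒜) (hF : F D), C D → ∀ P ∈ R, IsRelMonic X P.f →
    ∀ (α : P.A ⟶ leftChoice.U D hF) (β : P.B ⟶ leftChoice.Y D hF) (γ : P.C ⟶ D),
    α ≫ leftChoice.ι D hF = P.f ≫ β → P.g ≫ γ = β ≫ leftChoice.π D hF →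
    P.h ≫ S.map α = -(γ ≫ adj.homEquiv D (leftChoice.U D hF) (leftChoice.ν D hF)) →
    (∃ t : P.B ⟶ leftChoice.U D hF, P.f ≫ t = α) →
    ∃ t : P.C ⟶ leftChoice.Y D hF, t ≫ leftChoice.π D hF = γ

namespace PrePartialTriangulated

variable {W S : 𝒜 ⥤ 𝒜} [W.Additive] [S.Additive] {L : Set (LeftSeq W)}
  {R : Set (RightSeq S)} {F C X : ObjectProperty 𝒜} [IsAdditiveSubcategory X]

/-- The endofunctor `G^X` of `(C ∩ F) / X`. -/
noncomputable def G (P : PrePartialTriangulated W S L R F C X) :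
    Subfactor (C ⊓ F) X ⥤ Subfactor (C ⊓ F) X :=
  P.preenv.suspG P.right P.rightChoice

/-- The endofunctor `H_X` of `(C ∩ F) / X`. -/
noncomputable def H (P : PrePartialTriangulated W S L R F C X) :
    Subfactor (C ⊓ F) X ⥤ Subfactor (C ⊓ F) X :=
  P.precov.loopG P.left P.leftChoice

/-- The class `Δ^X(C ∩ F)`. -/
def rightTriangles (P : PrePartialTriangulated W S L R F C X) : Set (RightSeq P.G) :=
  P.preenv.distinguishedG P.right P.rightChoice

/-- The class `∇_X(C ∩ F)`. -/
def leftTriangles (P : PrePartialTriangulated W S L R F C X) : Set (LeftSeq P.H) :=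
  P.precov.distinguishedG P.left P.leftChoice

end PrePartialTriangulated

end OneSided

/-! There are three tasks: the right triangulated structure, its dual, and the adjunction together
with the two filling conditions.

Right structure on `C / X`. If `i : A ⟶ Y` is an `X`-preenvelope, then modulo `X` a morphism `f : A
⟶ B` is isomorphic to `(i, f) : A ⟶ Y ⊞ B`, which is `X`-monic and begins a triangle of `R` by
(PRT1)(iii). By (PRT2), the third component of a morphism into a fixed triangle is unique modulo `X`
once its first component is given (`filler_sub`). An identity between connecting morphisms is
therefore proved by exhibiting both sides as fillers of one diagram. With these two tools (RT3)
comes from (PRT3) and (RT4) from (PRT4). Rotation also comes from (PRT4), applied to `f` followed by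
`(δ, i', g)`: the composite is essentially a preenvelope, its cone splits off a summand `E`, and
cancelling that summand identifies the cone of `(δ, i', g)` with the suspension of `A` (`rotation`).

Passage to `(C ∩ F) / X`. The functor `R` is left adjoint to the inclusion into `C / X`. Rotations
and octahedra built in `C / X` involve objects outside the subcategory. Stabilization says exactly
that the reflection of such a triangle is again a triangle of the subcategory
(`map_mem_reflectedTriangles`).

Left structure. It is the right structure of the opposite category. The opposite of `F / X` is not
literally a factor category of `𝒜ᵒᵖ`, so the argument on `C / X` is carried out for an abstract
`RightModel`, of which both are instances.

Adjunction. The bijection is `Hom (R Σ A, B) ≅ Hom (Σ A, B) ≅ Hom (A, Ω B) ≅ Hom (A, Q Ω B)`. For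
the middle step, `γ : U^A ⟶ B` and `α : A ⟶ U_B` are related when they are the outer parts of a
morphism from the fixed right triangle of `A` to the fixed left triangle of `B`. Condition (c)
provides partners on both sides, and (d), (e) show that one partner vanishes modulo `X` exactly when
the other does.

Filling. Both conditions are invariant under isomorphism, so standard representatives suffice. A
first candidate for the filler comes from (c) applied to the rotated triangle. Its defect is a
morphism `U^A ⟶ N`, which (d), exactness of the left triangles and (e) allow to be corrected
(`Gluing.exists_filler`). The second condition is the first one in the opposite category. -/

namespace OneSided

/-! ### Right triangulated categories: formal consequences of (RT1)–(RT3) -/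

section

section Generic

variable {T : Type u} [Category.{v} T]

lemma RightSeq.Isomorphic.refl {S : T ⥤ T} (P : RightSeq S) : P.Isomorphic P :=
  ⟨Iso.refl _, Iso.refl _, Iso.refl _, by simp, by simp, by simp⟩

lemma RightSeq.Isomorphic.symm {S : T ⥤ T} {P Q : RightSeq S} (h : P.Isomorphic Q) :
    Q.Isomorphic P := by
  obtain ⟨a, b, c, h₁, h₂, h₃⟩ := h
  refine ⟨a.symm, b.symm, c.symm, ?_, ?_, ?_⟩
  · simp only [Iso.symm_hom]
    rw [Iso.comp_inv_eq, Category.assoc, h₁, Iso.inv_hom_id_assoc]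
  · simp only [Iso.symm_hom]
    rw [Iso.comp_inv_eq, Category.assoc, h₂, Iso.inv_hom_id_assoc]
  · simp only [Iso.symm_hom]
    rw [← cancel_epi c.hom, Iso.hom_inv_id_assoc, ← reassoc_of% h₃, ← S.map_comp]
    simp

lemma RightSeq.Isomorphic.trans {S : T ⥤ T} {P Q U : RightSeq S} (h : P.Isomorphic Q)
    (h' : Q.Isomorphic U) : P.Isomorphic U := by
  obtain ⟨a, b, c, h₁, h₂, h₃⟩ := h
  obtain ⟨a', b', c', h₁', h₂', h₃'⟩ := h'
  refine ⟨a ≪≫ a', b ≪≫ b', c ≪≫ c', ?_, ?_, ?_⟩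
  · simp [reassoc_of% h₁, h₁']
  · simp [reassoc_of% h₂, h₂']
  · simp [reassoc_of% h₃, h₃']

variable [Preadditive T]

/-- The axioms (RT1)–(RT3) of a right triangulated category. -/
structure IsPreRight (S : T ⥤ T) (Δ : Set (RightSeq S)) : Prop where
  additive : S.Additive
  isoClosed : ∀ P Q : RightSeq S, P.Isomorphic Q → P ∈ Δ → Q ∈ Δ
  rt1_exists : ∀ {A B : T} (f : A ⟶ B), ∃ (C : T) (g : B ⟶ C) (h : C ⟶ S.obj A),
    RightSeq.mk f g h ∈ Δ
  rt1_id : ∀ (Z A : T), IsZero Z →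
    RightSeq.mk (S := S) (0 : Z ⟶ A) (𝟙 A) (0 : A ⟶ S.obj Z) ∈ Δ
  rt2 : ∀ {A B C : T} (f : A ⟶ B) (g : B ⟶ C) (h : C ⟶ S.obj A),
    RightSeq.mk f g h ∈ Δ → RightSeq.mk g h (-S.map f) ∈ Δ
  rt3 : ∀ P ∈ Δ, ∀ Q ∈ Δ, ∀ (α : P.A ⟶ Q.A) (β : P.B ⟶ Q.B), P.f ≫ β = α ≫ Q.f →
    ∃ γ : P.C ⟶ Q.C, P.g ≫ γ = β ≫ Q.g ∧ P.h ≫ S.map α = γ ≫ Q.h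

lemma IsRightTriangulated.isPreRight {S : T ⥤ T} {Δ : Set (RightSeq S)}
    (H : IsRightTriangulated S Δ) : IsPreRight S Δ where
  additive := H.additive
  isoClosed := H.isoClosed
  rt1_exists := H.rt1_exists
  rt1_id := H.rt1_id
  rt2 := H.rt2
  rt3 := H.rt3

/-- Some triangles on `f`, `g` and `f ≫ g` satisfy the conclusion of (RT4). -/
def HasOctahedron {S : T ⥤ T} (Δ : Set (RightSeq S)) {A B D : T} (f : A ⟶ B) (g : B ⟶ D) :
    Prop :=
  ∃ (C' A' B' : T) (l : B ⟶ C') (m : C' ⟶ S.obj A) (k : D ⟶ A') (j : A' ⟶ S.obj B)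
    (p : D ⟶ B') (q : B' ⟶ S.obj A) (r : C' ⟶ B') (s : B' ⟶ A'),
    RightSeq.mk f l m ∈ Δ ∧ RightSeq.mk g k j ∈ Δ ∧ RightSeq.mk (f ≫ g) p q ∈ Δ ∧
    l ≫ r = g ≫ p ∧ r ≫ q = m ∧ p ≫ s = k ∧ s ≫ j = q ≫ S.map f ∧
    RightSeq.mk r s (j ≫ S.map l) ∈ Δ

namespace IsPreRight

variable {S : T ⥤ T} {Δ : Set (RightSeq S)} [HasZeroObject T]

/-- (RT3) towards the triangle `0 ⟶ Z ⟶ Z` turns a morphism killed by `P.f` into a factorization: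
the second morphism of a triangle is a weak cokernel of the first. -/
lemma exists_desc (H : IsPreRight S Δ) {P : RightSeq S} (hP : P ∈ Δ) {Z : T} (k : P.B ⟶ Z)
    (hk : P.f ≫ k = 0) : ∃ t : P.C ⟶ Z, P.g ≫ t = k := by
  obtain ⟨γ, h, -⟩ := H.rt3 P hP _ (H.rt1_id 0 Z (isZero_zero T)) 0 k (by simp [hk])
  exact ⟨γ, by simpa using h⟩

lemma exists_desc' (H : IsPreRight S Δ) {P : RightSeq S} (hP : P ∈ Δ) {Z : T} (k : P.C ⟶ Z)
    (hk : P.g ≫ k = 0) : ∃ t : S.obj P.A ⟶ Z, P.h ≫ t = k :=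
  H.exists_desc (H.rt2 P.f P.g P.h hP) k hk

/-- The difference `e - 𝟙` kills `P.g`, so it factors through `P.h`; it is also killed by `P.h`.
Hence its square is zero, so that `e ≫ e = 2e - 𝟙` and the inverse is `2 - e`. -/
lemma isIso_of_endo (H : IsPreRight S Δ) {P : RightSeq S} (hP : P ∈ Δ) (e : P.C ⟶ P.C)
    (h₁ : P.g ≫ e = P.g) (h₂ : e ≫ P.h = P.h) : IsIso e := by
  obtain ⟨t, ht⟩ := H.exists_desc' hP (e - 𝟙 _) (by simp [Preadditive.comp_sub, h₁])
  have h : (e - 𝟙 _) ≫ (e - 𝟙 _) = 0 := by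
    calc (e - 𝟙 _) ≫ (e - 𝟙 _) = (e - 𝟙 _) ≫ P.h ≫ t := by rw [ht]
      _ = 0 := by rw [← Category.assoc, Preadditive.sub_comp, h₂]; simp
  have h' : e ≫ e = e + e - 𝟙 _ := by
    simp only [Preadditive.comp_sub, Preadditive.sub_comp, Category.comp_id,
      Category.id_comp] at h
    rw [← sub_eq_zero, ← h]
    abel
  refine ⟨𝟙 _ + 𝟙 _ - e, ?_, ?_⟩
  · simp only [Preadditive.comp_sub, Preadditive.comp_add, Category.comp_id, h']
    abel
  · simp only [Preadditive.sub_comp, Preadditive.add_comp, Category.id_comp, h']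
    abel

/-- Two triangles on isomorphic morphisms are isomorphic. -/
lemma exists_iso (H : IsPreRight S Δ) {P Q : RightSeq S} (hP : P ∈ Δ) (hQ : Q ∈ Δ)
    (a : P.A ≅ Q.A) (b : P.B ≅ Q.B) (h : P.f ≫ b.hom = a.hom ≫ Q.f) :
    ∃ c : P.C ≅ Q.C, P.g ≫ c.hom = b.hom ≫ Q.g ∧ P.h ≫ S.map a.hom = c.hom ≫ Q.h := by
  obtain ⟨c, h₁, h₂⟩ := H.rt3 P hP Q hQ a.hom b.hom h
  obtain ⟨d, h₃, h₄⟩ := H.rt3 Q hQ P hP a.inv b.inv (by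
    rw [← cancel_epi a.hom, ← reassoc_of% h]; simp)
  have i₁ : IsIso (c ≫ d) := H.isIso_of_endo hP _ (by rw [reassoc_of% h₁, h₃]; simp) (by
    rw [Category.assoc, ← h₄, ← reassoc_of% h₂, ← S.map_comp]; simp)
  have i₂ : IsIso (d ≫ c) := H.isIso_of_endo hQ _ (by rw [reassoc_of% h₃, h₁]; simp) (by
    rw [Category.assoc, ← h₂, ← reassoc_of% h₄, ← S.map_comp]; simp)
  -- The fillers `c` and `d` need not be mutually inverse, but both composites are invertible, so
  -- `c` is split mono and split epi.
  have s₁ : IsSplitMono c := ⟨⟨d ≫ inv (c ≫ d), by rw [← Category.assoc, IsIso.hom_inv_id]⟩⟩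
  have s₂ : IsSplitEpi c := ⟨⟨inv (d ≫ c) ≫ d, by rw [Category.assoc, IsIso.inv_hom_id]⟩⟩
  have : IsIso c := isIso_of_mono_of_isSplitEpi c
  exact ⟨asIso c, h₁, h₂⟩

/-- (RT4) for all triangles on `f`, `g` and `f ≫ g` follows from (RT4) for some triangles on
a pair isomorphic to `(f, g)`. -/
lemma rt4 (H : IsPreRight S Δ) {A B D C' A' B' : T} (f : A ⟶ B) (l : B ⟶ C')
    (m : C' ⟶ S.obj A) (g : B ⟶ D) (k : D ⟶ A') (j : A' ⟶ S.obj B) (p : D ⟶ B')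
    (q : B' ⟶ S.obj A) (hf : RightSeq.mk f l m ∈ Δ) (hg : RightSeq.mk g k j ∈ Δ)
    (hfg : RightSeq.mk (f ≫ g) p q ∈ Δ) {A₁ B₁ D₁ : T} (a : A ≅ A₁) (b : B ≅ B₁) (d : D ≅ D₁)
    (f₁ : A₁ ⟶ B₁) (g₁ : B₁ ⟶ D₁) (h₁ : f ≫ b.hom = a.hom ≫ f₁) (h₂ : g ≫ d.hom = b.hom ≫ g₁)
    (O : HasOctahedron Δ f₁ g₁) :
    ∃ (r : C' ⟶ B') (s : B' ⟶ A'), l ≫ r = g ≫ p ∧ r ≫ q = m ∧ p ≫ s = k ∧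
      s ≫ j = q ≫ S.map f ∧ RightSeq.mk r s (j ≫ S.map l) ∈ Δ := by
  obtain ⟨C₁, E₁, F₁, l₁, m₁, k₁, j₁, p₁, q₁, r₁, s₁, t₁, t₂, t₃, e₁, e₂, e₃, e₄, t₄⟩ := O
  obtain ⟨c, c₁, c₂⟩ := H.exists_iso hf t₁ a b h₁
  obtain ⟨e, i₁, i₂⟩ := H.exists_iso hg t₂ b d h₂
  obtain ⟨w, w₁, w₂⟩ := H.exists_iso hfg t₃ a d (by
    simp only [Category.assoc, h₂, reassoc_of% h₁])
  dsimp only at c c₁ c₂ e i₁ i₂ w w₁ w₂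
  have c₂' : c.inv ≫ m = m₁ ≫ S.map a.inv := by
    rw [Iso.inv_comp_eq, ← reassoc_of% c₂, ← S.map_comp]; simp
  have i₂' : e.inv ≫ j = j₁ ≫ S.map b.inv := by
    rw [Iso.inv_comp_eq, ← reassoc_of% i₂, ← S.map_comp]; simp
  have w₂' : w.inv ≫ q = q₁ ≫ S.map a.inv := by
    rw [Iso.inv_comp_eq, ← reassoc_of% w₂, ← S.map_comp]; simp
  have f₂ : a.hom ≫ f₁ ≫ b.inv = f := by rw [← reassoc_of% h₁]; simp
  -- The required `r` and `s` are `r₁` and `s₁` conjugated by the isomorphisms between third terms.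
  -- Every identity needed is compatible with the choice of these isomorphisms.
  refine ⟨c.hom ≫ r₁ ≫ w.inv, w.hom ≫ s₁ ≫ e.inv, ?_, ?_, ?_, ?_, ?_⟩
  · rw [reassoc_of% c₁, reassoc_of% e₁, ← reassoc_of% h₂, ← reassoc_of% w₁]; simp
  · simp only [Category.assoc, w₂', reassoc_of% e₂]
    rw [← reassoc_of% c₂, ← S.map_comp]; simp
  · rw [reassoc_of% w₁, reassoc_of% e₃, ← reassoc_of% i₁]; simp
  · simp only [Category.assoc, i₂', reassoc_of% e₄]
    rw [← reassoc_of% w₂, ← S.map_comp, ← S.map_comp, f₂]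
  · refine H.isoClosed _ _ (RightSeq.Isomorphic.symm ⟨c, w, e, ?_, ?_, ?_⟩) t₄
    · simp
    · simp
    · simp only [Category.assoc]
      rw [← S.map_comp, c₁, S.map_comp, reassoc_of% i₂]

end IsPreRight

/-! ### Left sequences as right sequences of the opposite category -/

/-- The class of right sequences of the opposite category given by a class of left sequences. -/
def opSet {W : T ⥤ T} (Λ : Set (LeftSeq W)) : Set (RightSeq W.op) :=
  {P | LeftSeq.mk P.h.unop P.g.unop P.f.unop ∈ Λ}

lemma LeftSeq.isomorphic_of_op {W : T ⥤ T} (P Q : RightSeq W.op) (h : P.Isomorphic Q) :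
    (LeftSeq.mk (W := W) Q.h.unop Q.g.unop Q.f.unop).Isomorphic
      (LeftSeq.mk P.h.unop P.g.unop P.f.unop) := by
  obtain ⟨a, b, c, h₁, h₂, h₃⟩ := h
  exact ⟨c.unop, b.unop, a.unop, congr($(h₃.symm).unop), congr($(h₂.symm).unop),
    congr($(h₁.symm).unop)⟩

lemma RightSeq.isomorphic_op {W : T ⥤ T} (P Q : LeftSeq W) (h : P.Isomorphic Q) :
    (RightSeq.mk (S := W.op) Q.h.op Q.g.op Q.f.op).Isomorphic
      (RightSeq.mk P.h.op P.g.op P.f.op) := by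
  obtain ⟨a, b, c, h₁, h₂, h₃⟩ := h
  exact ⟨c.op, b.op, a.op, congr($(h₃.symm).op), congr($(h₂.symm).op),
    congr($(h₁.symm).op)⟩

/-- Reversing arrows exchanges first and third terms, and each axiom becomes literally its dual.
Only closure under isomorphisms needs an inversion, because an isomorphism of sequences changes
direction. -/
lemma IsRightTriangulated.unop [HasZeroObject T] [HasBinaryBiproducts T] {W : T ⥤ T}
    [W.Additive] {Λ : Set (LeftSeq W)} (H : IsRightTriangulated W.op (opSet Λ)) :
    IsLeftTriangulated W Λ where
  hasZeroObject := inferInstance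
  hasBinaryBiproducts := inferInstance
  additive := inferInstance
  isoClosed P Q h hP := H.isoClosed _ _ (RightSeq.isomorphic_op Q P (by
    obtain ⟨a, b, c, h₁, h₂, h₃⟩ := h
    refine ⟨a.symm, b.symm, c.symm, ?_, ?_, ?_⟩
    · simp only [Iso.symm_hom]
      rw [Iso.comp_inv_eq, Category.assoc, h₁, ← W.map_comp_assoc]
      simp
    · simp only [Iso.symm_hom]
      rw [Iso.comp_inv_eq, Category.assoc, h₂, Iso.inv_hom_id_assoc]
    · simp only [Iso.symm_hom]
      rw [Iso.comp_inv_eq, Category.assoc, h₃, Iso.inv_hom_id_assoc])) hP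
  lt1_exists h := by
    obtain ⟨K, g, f, hK⟩ := H.rt1_exists h.op
    exact ⟨K.unop, f.unop, g.unop, hK⟩
  lt1_id Z A hZ := H.rt1_id (Opposite.op Z) (Opposite.op A) hZ.op
  lt2 f g h hP := H.rt2 h.op g.op f.op hP
  lt3 P hP Q hQ β γ h := by
    obtain ⟨α, h₁, h₂⟩ := H.rt3 (.mk Q.h.op Q.g.op Q.f.op) hQ (.mk P.h.op P.g.op P.f.op) hP
      γ.op β.op congr($(h.symm).op)
    exact ⟨α.unop, congr($(h₁.symm).unop), congr($(h₂.symm).unop)⟩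
  lt4 f l m g k j p q hf hg hfg := by
    obtain ⟨r, s, h₁, h₂, h₃, h₄, h₅⟩ := H.rt4 f.op l.op m.op g.op k.op j.op p.op q.op hf hg hfg
    exact ⟨r.unop, s.unop, congr($(h₁).unop), congr($(h₂).unop), congr($(h₃).unop),
      congr($(h₄).unop), h₅⟩

end Generic

end

section

/-! ### Consequences of the axioms of a partial right triangulated category -/

section Partial

variable {𝒜 : Type u} [Category.{v} 𝒜] [Preadditive 𝒜] [HasZeroObject 𝒜]
  [HasBinaryBiproducts 𝒜]

lemma IsRelMonic.of_comp {X : ObjectProperty 𝒜} {A B D : 𝒜} {f : A ⟶ B} {g : B ⟶ D}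
    (h : IsRelMonic X (f ≫ g)) : IsRelMonic X f := by
  intro Y hY k
  obtain ⟨t, ht⟩ := h hY k
  exact ⟨g ≫ t, by simpa using ht⟩

lemma IsRelMonic.comp {X : ObjectProperty 𝒜} {A B D : 𝒜} {f : A ⟶ B} {g : B ⟶ D}
    (hf : IsRelMonic X f) (hg : IsRelMonic X g) : IsRelMonic X (f ≫ g) := by
  intro Y hY k
  obtain ⟨t, ht⟩ := hf hY k
  obtain ⟨s, hs⟩ := hg hY t
  exact ⟨s, by rw [Category.assoc, hs, ht]⟩

/-- The isomorphism exchanging the first two of three summands. -/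
noncomputable def biprodSwap (U V W : 𝒜) : U ⊞ (V ⊞ W) ≅ V ⊞ (U ⊞ W) where
  hom := biprod.lift (biprod.snd ≫ biprod.fst)
    (biprod.lift biprod.fst (biprod.snd ≫ biprod.snd))
  inv := biprod.lift (biprod.snd ≫ biprod.fst)
    (biprod.lift biprod.fst (biprod.snd ≫ biprod.snd))

/-- The isomorphism moving the second of three summands to the front. -/
noncomputable def biprodRotate (U V W : 𝒜) : (U ⊞ V) ⊞ W ≅ V ⊞ (U ⊞ W) where
  hom := biprod.lift (biprod.fst ≫ biprod.snd)
    (biprod.lift (biprod.fst ≫ biprod.fst) biprod.snd)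
  inv := biprod.lift (biprod.lift (biprod.snd ≫ biprod.fst) biprod.fst)
    (biprod.snd ≫ biprod.snd)

namespace IsPartialRightTriangulated

variable {S : 𝒜 ⥤ 𝒜} [S.Additive] {C X : ObjectProperty 𝒜} {R : Set (RightSeq S)}

lemma comp_zero (H : IsPartialRightTriangulated S C X R) {A B E : 𝒜} {f : A ⟶ B} {g : B ⟶ E}
    {h : E ⟶ S.obj A} (hP : RightSeq.mk f g h ∈ R) : f ≫ g = 0 :=
  (H.isRightCSeq _ hP).2.1.1

lemma comp_zero' (H : IsPartialRightTriangulated S C X R) {A B E : 𝒜} {f : A ⟶ B} {g : B ⟶ E}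
    {h : E ⟶ S.obj A} (hP : RightSeq.mk f g h ∈ R) : g ≫ h = 0 :=
  (H.isRightCSeq _ hP).2.2.1

lemma exists_desc (H : IsPartialRightTriangulated S C X R) {A B E : 𝒜} {f : A ⟶ B} {g : B ⟶ E}
    {h : E ⟶ S.obj A} (hP : RightSeq.mk f g h ∈ R) {Z : 𝒜} (k : B ⟶ Z) (hk : f ≫ k = 0) :
    ∃ t : E ⟶ Z, g ≫ t = k :=
  (H.isRightCSeq _ hP).2.1.2 k hk

lemma exists_desc' (H : IsPartialRightTriangulated S C X R) {A B E : 𝒜} {f : A ⟶ B}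
    {g : B ⟶ E} {h : E ⟶ S.obj A} (hP : RightSeq.mk f g h ∈ R) {Z : 𝒜} (k : E ⟶ Z)
    (hk : g ≫ k = 0) : ∃ t : S.obj A ⟶ Z, h ≫ t = k :=
  (H.isRightCSeq _ hP).2.2.2 k hk

lemma mem_of_iso (H : IsPartialRightTriangulated S C X R) {A B E A' B' E' : 𝒜} {f : A ⟶ B}
    {g : B ⟶ E} {h : E ⟶ S.obj A} (hP : RightSeq.mk f g h ∈ R) {f' : A' ⟶ B'} {g' : B' ⟶ E'}
    {h' : E' ⟶ S.obj A'} (a : A ≅ A') (b : B ≅ B') (c : E ≅ E') (h₁ : f ≫ b.hom = a.hom ≫ f')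
    (h₂ : g ≫ c.hom = b.hom ≫ g') (h₃ : h ≫ S.map a.hom = c.hom ≫ h') :
    RightSeq.mk f' g' h' ∈ R :=
  H.isoClosed _ _ ⟨a, b, c, h₁, h₂, h₃⟩ hP

lemma exists_cone (H : IsPartialRightTriangulated S C X R) {A Y U B : 𝒜} {i : A ⟶ Y}
    {p : Y ⟶ U} {q : U ⟶ S.obj A} (hA : C A) (hR : RightSeq.mk i p q ∈ R)
    (hi : IsPreenvelope X i) (hB : C B) (f : A ⟶ B) :
    ∃ (N : 𝒜) (g : Y ⊞ B ⟶ N) (h : N ⟶ S.obj A), RightSeq.mk (biprod.lift i f) g h ∈ R :=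
  H.prt1_iii _ hR hA hi hB f

/-- The third component of a morphism of triangles to a triangle with second term in `X` is
unique up to morphisms factoring through `X`. -/
lemma filler_sub (H : IsPartialRightTriangulated S C X R) {P Q : RightSeq S} (hP : P ∈ R)
    (hQ : Q ∈ R) (hX : X Q.B) {α : P.A ⟶ Q.A} {β β' : P.B ⟶ Q.B} {γ γ' : P.C ⟶ Q.C}
    (h₁ : P.f ≫ β = α ≫ Q.f) (h₂ : P.g ≫ γ = β ≫ Q.g) (h₃ : P.h ≫ S.map α = γ ≫ Q.h)
    (h₁' : P.f ≫ β' = α ≫ Q.f) (h₂' : P.g ≫ γ' = β' ≫ Q.g)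
    (h₃' : P.h ≫ S.map α = γ' ≫ Q.h) : FactorsThroughObj X (γ - γ') := by
  obtain ⟨t, ht⟩ := H.prt2 P hP Q hQ hX 0 (β - β') (γ - γ')
    (by simp [Preadditive.comp_sub, h₁, h₁']) (by simp [Preadditive.comp_sub,
      Preadditive.sub_comp, h₂, h₂']) (by simp [Preadditive.sub_comp, ← h₃, ← h₃'])
    ⟨0, by simp⟩
  exact ⟨_, hX, _, _, ht⟩

/-- This is (PRT1)(ii) for the zero morphism out of `Z`, with the summand `Z` removed. The component
`-𝟙 E` of the isomorphism cancels the sign in `(f, -1)`. -/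
lemma zero_mem [IsAdditiveSubcategory C] (H : IsPartialRightTriangulated S C X R) {Z E : 𝒜}
    (hZ : IsZero Z) (hE : C E) :
    RightSeq.mk (S := S) (0 : Z ⟶ E) (𝟙 E) (0 : E ⟶ S.obj Z) ∈ R := by
  refine H.isoClosed _ _ ?_ (H.prt1_ii (IsAdditiveSubcategory.zero Z hZ) hE 0)
  refine ⟨Iso.refl _, ⟨biprod.snd, biprod.inr, ?_, by simp⟩, ⟨-𝟙 E, -𝟙 E, by simp, by simp⟩,
    ?_, ?_, ?_⟩
  · ext
    · exact hZ.eq_of_src _ _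
    · simp
    · simp
    · simp
  · simp
  · ext <;> simp
  · simp

/-- (PRT1)(iii) only speaks of morphisms `(i, f)` into a sum whose first summand is the target of
the preenvelope. This version reorders summands in order to expose such a component. -/
lemma exists_triangle (H : IsPartialRightTriangulated S C X R) {A Y U B' Z : 𝒜} {i : A ⟶ Y}
    {p : Y ⟶ U} {q : U ⟶ S.obj A} (hA : C A) (hR : RightSeq.mk i p q ∈ R)
    (hi : IsPreenvelope X i) (hB' : C B') (φ : A ⟶ Z) (e : Z ≅ Y ⊞ B')
    (he : φ ≫ e.hom ≫ biprod.fst = i) :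
    ∃ (N : 𝒜) (g : Z ⟶ N) (h : N ⟶ S.obj A), RightSeq.mk φ g h ∈ R := by
  obtain ⟨N, g, h, hN⟩ := H.exists_cone hA hR hi hB' (φ ≫ e.hom ≫ biprod.snd)
  refine ⟨N, e.hom ≫ g, h, H.mem_of_iso hN (Iso.refl _) e.symm (Iso.refl _) ?_ ?_ ?_⟩
  · dsimp only [Iso.symm_hom]
    rw [Iso.comp_inv_eq]
    ext <;> simp [he]
  · simp
  · simp

/-- The rotation of a right triangle on an `X`-monic `f : A ⟶ B`, in terms of the cones of
`A ⟶ Y ⊞ Y'` and `B ⟶ (Y ⊞ Y') ⊞ E`, where `A ⟶ Y` and `B ⟶ Y'` are `X`-preenvelopes. -/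
lemma rotation [IsAdditiveSubcategory C] (H : IsPartialRightTriangulated S C X R)
    {A B E Y Y' U U' : 𝒜} {i : A ⟶ Y} {p : Y ⟶ U} {q : U ⟶ S.obj A} {i' : B ⟶ Y'}
    {p' : Y' ⟶ U'} {q' : U' ⟶ S.obj B} {f : A ⟶ B} {g : B ⟶ E} {h : E ⟶ S.obj A}
    (hA : C A) (hB : C B) (hR : RightSeq.mk i p q ∈ R) (hi : IsPreenvelope X i)
    (hR' : RightSeq.mk i' p' q' ∈ R) (hi' : IsPreenvelope X i') (hP : RightSeq.mk f g h ∈ R)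
    (hf : IsRelMonic X f) (δ : B ⟶ Y) (hδ : f ≫ δ = i) :
    ∃ (N : 𝒜) (a : Y ⊞ Y' ⟶ N) (b : N ⟶ S.obj A) (M : 𝒜) (k : (Y ⊞ Y') ⊞ E ⟶ M)
      (j : M ⟶ S.obj B) (r : E ⟶ N) (s : N ≅ M),
      RightSeq.mk (biprod.lift i (f ≫ i')) a b ∈ R ∧
      RightSeq.mk (biprod.lift (biprod.lift δ i') g) k j ∈ R ∧
      g ≫ r = biprod.lift δ i' ≫ a ∧ r ≫ b = h ∧ biprod.inl ≫ k = a ≫ s.hom ∧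
      biprod.inr ≫ k = -(r ≫ s.hom) ∧ s.hom ≫ j = b ≫ S.map f := by
  have hE : C E := (H.isRightCSeq _ hP).1
  -- Both `Y` and `Y'` are carried along: `Y` makes `i` a component of the morphism out of `A`, and
  -- `Y'` makes `i'` a component of the morphism out of `B`. Both morphisms then have cones.
  obtain ⟨N, a, b, hN⟩ := H.exists_cone hA hR hi (H.le _ hi'.1) (f ≫ i')
  -- Since `f ≫ g = 0`, the composite is `(i, f ≫ i', 0)`. A triangle on it is the direct sum of the
  -- triangle with third term `N` and `0 ⟶ E ⟶ E`.
  have hN' : RightSeq.mk (f ≫ biprod.lift (biprod.lift δ i') g) (biprod.map a (𝟙 E))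
      (biprod.desc b 0) ∈ R := by
    refine H.mem_of_iso (H.directSum _ hN _ (H.zero_mem (isZero_zero 𝒜) hE))
      ⟨biprod.fst, biprod.inl, ?_, by simp⟩ (Iso.refl _) (Iso.refl _) ?_ ?_ ?_
    · ext
      simp
    · ext
      · simp [hδ]
      · simp
      · simp [H.comp_zero hP]
    · simp
    · ext
      · simp [← S.map_comp]
      · simp
  have hY : C (Y ⊞ E) := IsAdditiveSubcategory.biprod (H.le _ hi.1) hE
  have hg' : IsRelMonic X (biprod.lift (biprod.lift δ i') g) := by
    refine IsRelMonic.of_comp (g := biprod.fst ≫ biprod.snd) ?_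
    simpa using hi'.2
  obtain ⟨M, k, j, hM⟩ := H.exists_triangle hB hR' hi' hY (biprod.lift (biprod.lift δ i') g)
    (biprodRotate Y Y' E) (by simp [biprodRotate])
  have hZ : C ((Y ⊞ Y') ⊞ E) :=
    IsAdditiveSubcategory.biprod (IsAdditiveSubcategory.biprod (H.le _ hi.1) (H.le _ hi'.1)) hE
  -- (PRT4) yields a triangle `E ⟶ N ⊞ E ⟶ M`. The aim is to show that the summand `E` cancels,
  -- leaving `N ≅ M`.
  obtain ⟨r, s, h₁, h₂, h₃, h₄, h₅, -⟩ := H.prt4 f g h (biprod.lift (biprod.lift δ i') g) k j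
    (biprod.map a (𝟙 E)) (biprod.desc b 0) hA hB hZ hf hg' hP hM hN'
  have e₁ : (r ≫ biprod.fst) ≫ b = h := by
    rw [← h₂, Category.assoc]
    congr 1
    ext <;> simp
  have e₂ : g ≫ r ≫ biprod.fst = biprod.lift δ i' ≫ a := by
    rw [reassoc_of% h₁]; simp
  have e₃ : g ≫ r ≫ biprod.snd = g := by
    rw [reassoc_of% h₁]; simp
  -- The second component of `r` is the identity only after composition with `g`, so it differs from
  -- `𝟙 E` by `h ≫ t`. The shear `θ` of `N ⊞ E` removes this error.
  obtain ⟨t, ht⟩ := H.exists_desc' hP (r ≫ biprod.snd - 𝟙 E)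
    (by rw [Preadditive.comp_sub, e₃]; simp)
  let θ : N ⊞ E ≅ N ⊞ E :=
    { hom := 𝟙 _ - biprod.fst ≫ b ≫ t ≫ biprod.inr
      inv := 𝟙 _ + biprod.fst ≫ b ≫ t ≫ biprod.inr
      hom_inv_id := by simp [Preadditive.sub_comp, Preadditive.comp_add]
      inv_hom_id := by simp [Preadditive.comp_sub, Preadditive.add_comp] }
  have hθ : r ≫ θ.hom = biprod.lift (r ≫ biprod.fst) (𝟙 E) := by
    ext
    · simp [θ, Preadditive.comp_sub, Preadditive.sub_comp]
    · simp only [θ, Preadditive.comp_sub, Preadditive.sub_comp, Category.assoc,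
        Category.comp_id, biprod.lift_snd, biprod.inr_snd]
      rw [← sub_eq_zero, sub_right_comm, ← ht, ← e₁]
      simp
  have hT : RightSeq.mk (biprod.lift (r ≫ biprod.fst) (𝟙 E)) (θ.inv ≫ s) (j ≫ S.map g) ∈ R := by
    refine H.mem_of_iso h₅ (Iso.refl _) θ (Iso.refl _) ?_ ?_ ?_
    · simpa using hθ
    · simp
    · simp
  obtain ⟨σ, hσ⟩ : ∃ σ, σ = θ.inv ≫ s := ⟨_, rfl⟩
  rw [← hσ] at hT
  -- The triangle on `(r₁, 𝟙)` is compared with the split triangle on `(𝟙, r₁)`. The connecting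
  -- morphism of the latter is zero, which forces `j ≫ S.map g = 0`.
  have hT' := H.prt1_ii hE (H.isRightCSeq _ hN).1 (r ≫ biprod.fst)
  obtain ⟨γ, h₆, h₇⟩ := H.prt3 _ hT _ hT' (𝟙 E) (biprod.lift biprod.snd biprod.fst)
    (by ext <;> simp)
  have hj : j ≫ S.map g = 0 := by simpa using h₇
  dsimp only at γ h₆
  have h₈ := H.comp_zero hT
  have h₉ : biprod.inr ≫ σ = -((r ≫ biprod.fst) ≫ biprod.inl ≫ σ) := by
    rw [eq_neg_iff_add_eq_zero, ← h₈, biprod.lift_eq, Preadditive.add_comp, add_comm]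
    simp only [Category.assoc, Category.id_comp]
  have hi₁ : (biprod.inl ≫ σ) ≫ (-γ) = 𝟙 N := by
    rw [Preadditive.comp_neg, Category.assoc, h₆]
    simp [biprod.lift_desc]
  -- The difference of the two sides is killed by `σ`, hence factors through the connecting
  -- morphism, which has just been shown to vanish.
  have hi₂ : (-γ) ≫ (biprod.inl ≫ σ) = 𝟙 M := by
    obtain ⟨x, hx⟩ := H.exists_desc' hT ((-γ) ≫ (biprod.inl ≫ σ) - 𝟙 M) (by
      rw [Preadditive.comp_sub, Preadditive.neg_comp, Preadditive.comp_neg, ← Category.assoc, h₆]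
      apply biprod.hom_ext'
      · simp [Preadditive.comp_sub]
      · simp only [Preadditive.comp_sub, Preadditive.comp_neg, Category.comp_id, h₉]
        simp)
    rw [← sub_eq_zero, ← hx, hj, zero_comp]
  refine ⟨N, a, b, M, k, j, r ≫ biprod.fst, ⟨_, _, hi₁, hi₂⟩, hN, hM, e₂, e₁, ?_, ?_, ?_⟩
  · have hab := H.comp_zero' hN
    dsimp only
    rw [← h₃, hσ]
    simp [θ, Preadditive.add_comp, Preadditive.comp_add, reassoc_of% hab]
  · dsimp only
    rw [← h₉, ← h₃, hσ]
    simp [θ, Preadditive.add_comp]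
  · dsimp only
    rw [hσ]
    simp [θ, Preadditive.add_comp, Preadditive.comp_add, h₄]

end IsPartialRightTriangulated

end Partial

end

/-! ### Models of factor categories, covering `C / X` and the opposite of `F / X` -/

section

section Models

variable {𝒜 : Type u} [Category.{v} 𝒜] [Preadditive 𝒜] [HasZeroObject 𝒜]
  [HasBinaryBiproducts 𝒜]

/-- `T` is a model of the factor category `C / X`: its objects represent all objects of `C`, and
its morphisms are classes of morphisms of `𝒜` modulo those factoring through `X`. -/
structure FactorModel (C X : ObjectProperty 𝒜) (T : Type u) [Category.{v} T]
    [Preadditive T] where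
  o : T → 𝒜
  prop : ∀ A, C (o A)
  ess : ∀ Z, C Z → ∃ A, o A = Z
  cls : ∀ {A B : T}, (o A ⟶ o B) → (A ⟶ B)
  cls_surjective : ∀ {A B : T} (f : A ⟶ B), ∃ f' : o A ⟶ o B, cls f' = f
  cls_comp : ∀ {A B D : T} (f : o A ⟶ o B) (g : o B ⟶ o D),
    (cls (f ≫ g) : A ⟶ D) = cls (B := B) f ≫ cls g
  cls_id : ∀ A : T, cls (𝟙 (o A)) = 𝟙 A
  cls_add : ∀ {A B : T} (f g : o A ⟶ o B), (cls (f + g) : A ⟶ B) = cls f + cls g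
  cls_eq_iff : ∀ {A B : T} (f g : o A ⟶ o B),
    (cls f : A ⟶ B) = cls g ↔ FactorsThroughObj X (f - g)

namespace FactorModel

variable {C X : ObjectProperty 𝒜} {T : Type u} [Category.{v} T] [Preadditive T]

lemma cls_zero (M : FactorModel C X T) (A B : T) :
    (M.cls (0 : M.o A ⟶ M.o B) : A ⟶ B) = 0 := by
  have h := M.cls_add (A := A) (B := B) 0 0
  rw [add_zero] at h
  simpa using h

lemma cls_neg (M : FactorModel C X T) {A B : T} (f : M.o A ⟶ M.o B) :
    (M.cls (-f) : A ⟶ B) = -M.cls f := by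
  rw [eq_neg_iff_add_eq_zero, ← M.cls_add, neg_add_cancel, M.cls_zero]

lemma cls_eq_zero_iff (M : FactorModel C X T) {A B : T} (f : M.o A ⟶ M.o B) :
    (M.cls f : A ⟶ B) = 0 ↔ FactorsThroughObj X f := by
  rw [← M.cls_zero, M.cls_eq_iff, sub_zero]

lemma exists_isZero [IsAdditiveSubcategory C] (M : FactorModel C X T) :
    ∃ Z : T, IsZero (M.o Z) ∧ IsZero Z := by
  obtain ⟨Z, hZ⟩ := M.ess 0 (IsAdditiveSubcategory.zero _ (isZero_zero 𝒜))
  have h : IsZero (M.o Z) := hZ ▸ isZero_zero 𝒜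
  refine ⟨Z, h, (IsZero.iff_id_eq_zero Z).2 ?_⟩
  rw [← M.cls_id, (IsZero.iff_id_eq_zero _).1 h, M.cls_zero]

lemma hasZeroObject [IsAdditiveSubcategory C] (M : FactorModel C X T) : HasZeroObject T := by
  obtain ⟨Z, -, h⟩ := M.exists_isZero
  exact ⟨Z, h⟩

/-- The biproduct of `𝒜` is represented in `T` only up to an equality of objects, so its five
defining equations are transported first and their classes taken afterwards. -/
lemma hasBinaryBiproducts [IsAdditiveSubcategory C] (M : FactorModel C X T) :
    HasBinaryBiproducts T where
  has_binary_biproduct A B := by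
    obtain ⟨Z, hZ⟩ := M.ess (M.o A ⊞ M.o B)
      (IsAdditiveSubcategory.biprod (M.prop A) (M.prop B))
    obtain ⟨l, r, a, b, h₁, h₂, h₃, h₄, h₅⟩ : ∃ (l : M.o A ⟶ M.o Z) (r : M.o B ⟶ M.o Z)
        (a : M.o Z ⟶ M.o A) (b : M.o Z ⟶ M.o B), l ≫ a = 𝟙 _ ∧ l ≫ b = 0 ∧ r ≫ a = 0 ∧
          r ≫ b = 𝟙 _ ∧ a ≫ l + b ≫ r = 𝟙 _ := by
      rw [hZ]
      exact ⟨biprod.inl, biprod.inr, biprod.fst, biprod.snd, by simp⟩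
    exact hasBinaryBiproduct_of_total
      { pt := Z
        fst := M.cls a
        snd := M.cls b
        inl := M.cls l
        inr := M.cls r
        inl_fst := by rw [← M.cls_comp, h₁, M.cls_id]
        inl_snd := by rw [← M.cls_comp, h₂, M.cls_zero]
        inr_fst := by rw [← M.cls_comp, h₃, M.cls_zero]
        inr_snd := by rw [← M.cls_comp, h₄, M.cls_id] }
      (show M.cls a ≫ M.cls l + M.cls b ≫ M.cls r = 𝟙 Z from
        (by rw [← M.cls_comp, ← M.cls_comp, ← M.cls_add, h₅, M.cls_id]))

end FactorModel

/-- A model of `C / X` with a suspension functor induced by fixed right triangles. -/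
structure RightModel (S : 𝒜 ⥤ 𝒜) (C X : ObjectProperty 𝒜) (R : Set (RightSeq S)) (T : Type u)
    [Category.{v} T] [Preadditive T] extends FactorModel C X T where
  Ψ : T ⥤ T
  Y : T → 𝒜
  i : ∀ A, o A ⟶ Y A
  p : ∀ A, Y A ⟶ o (Ψ.obj A)
  q : ∀ A, o (Ψ.obj A) ⟶ S.obj (o A)
  preenvelope : ∀ A, IsPreenvelope X (i A)
  mem : ∀ A, RightSeq.mk (i A) (p A) (q A) ∈ R
  map_cls : ∀ {A B : T} (f : o A ⟶ o B) (σ : Y A ⟶ Y B) (κ : o (Ψ.obj A) ⟶ o (Ψ.obj B)),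
    i A ≫ σ = f ≫ i B → p A ≫ κ = σ ≫ p B → q A ≫ S.map f = κ ≫ q B →
    Ψ.map (cls f : A ⟶ B) = cls κ

namespace RightModel

variable {S : 𝒜 ⥤ 𝒜} [S.Additive] {C X : ObjectProperty 𝒜} {R : Set (RightSeq S)}
  {T : Type u} [Category.{v} T] [Preadditive T]

/-- The data defining a standard right triangle of `C / X`. -/
structure IsStd (M : RightModel S C X R T) {A B E : T} (f : M.o A ⟶ M.o B)
    (g : M.o B ⟶ M.o E) (h : M.o E ⟶ S.obj (M.o A)) (δ : M.o B ⟶ M.Y A)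
    (ξ : M.o E ⟶ M.o (M.Ψ.obj A)) : Prop where
  mem : RightSeq.mk f g h ∈ R
  monic : IsRelMonic X f
  hδ : f ≫ δ = M.i A
  comm : g ≫ ξ = δ ≫ M.p A
  hξ : h = ξ ≫ M.q A

/-- The distinguished right triangles. -/
def Δ (M : RightModel S C X R T) : Set (RightSeq M.Ψ) :=
  {P | ∃ (A B E : T) (f : M.o A ⟶ M.o B) (g : M.o B ⟶ M.o E) (h : M.o E ⟶ S.obj (M.o A))
    (δ : M.o B ⟶ M.Y A) (ξ : M.o E ⟶ M.o (M.Ψ.obj A)), M.IsStd f g h δ ξ ∧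
    P.Isomorphic (RightSeq.mk (M.cls f : A ⟶ B) (M.cls g : B ⟶ E) (M.cls ξ))}

lemma exists_std (M : RightModel S C X R T) (H : IsPartialRightTriangulated S C X R) {A B E : T}
    {f : M.o A ⟶ M.o B} {g : M.o B ⟶ M.o E} {h : M.o E ⟶ S.obj (M.o A)}
    (hP : RightSeq.mk f g h ∈ R) (hf : IsRelMonic X f) :
    ∃ δ ξ, M.IsStd f g h δ ξ := by
  obtain ⟨δ, hδ⟩ := hf (M.preenvelope A).1 (M.i A)
  obtain ⟨ξ, h₁, h₂⟩ := H.prt3 _ hP _ (M.mem A) (𝟙 (M.o A)) δ (by simp [hδ])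
  exact ⟨δ, ξ, hP, hf, hδ, h₁, by simpa using h₂⟩

lemma IsStd.mem_Δ {M : RightModel S C X R T} {A B E : T} {f : M.o A ⟶ M.o B}
    {g : M.o B ⟶ M.o E} {h : M.o E ⟶ S.obj (M.o A)} {δ ξ} (hP : M.IsStd f g h δ ξ) :
    RightSeq.mk (M.cls f : A ⟶ B) (M.cls g : B ⟶ E) (M.cls ξ) ∈ M.Δ :=
  ⟨_, _, _, _, _, _, _, _, hP, RightSeq.Isomorphic.refl _⟩

lemma isoClosed (M : RightModel S C X R T) (P Q : RightSeq M.Ψ) (h : P.Isomorphic Q)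
    (hP : P ∈ M.Δ) : Q ∈ M.Δ := by
  obtain ⟨A, B, E, f, g, h', δ, ξ, hs, hi⟩ := hP
  exact ⟨A, B, E, f, g, h', δ, ξ, hs, h.symm.trans hi⟩

lemma mem_of_iso (M : RightModel S C X R T) {A B E A' B' E' : T} {f : A ⟶ B} {g : B ⟶ E}
    {h : E ⟶ M.Ψ.obj A} (hP : RightSeq.mk f g h ∈ M.Δ) {f' : A' ⟶ B'} {g' : B' ⟶ E'}
    {h' : E' ⟶ M.Ψ.obj A'} (a : A ≅ A') (b : B ≅ B') (c : E ≅ E') (h₁ : f ≫ b.hom = a.hom ≫ f')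
    (h₂ : g ≫ c.hom = b.hom ≫ g') (h₃ : h ≫ M.Ψ.map a.hom = c.hom ≫ h') :
    RightSeq.mk f' g' h' ∈ M.Δ :=
  M.isoClosed _ _ ⟨a, b, c, h₁, h₂, h₃⟩ hP

lemma exists_map (M : RightModel S C X R T) (H : IsPartialRightTriangulated S C X R) {A B : T}
    (f : M.o A ⟶ M.o B) : ∃ (σ : M.Y A ⟶ M.Y B) (κ : M.o (M.Ψ.obj A) ⟶ M.o (M.Ψ.obj B)),
      M.i A ≫ σ = f ≫ M.i B ∧ M.p A ≫ κ = σ ≫ M.p B ∧ M.q A ≫ S.map f = κ ≫ M.q B ∧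
      M.Ψ.map (M.cls f : A ⟶ B) = M.cls κ := by
  obtain ⟨σ, hσ⟩ := (M.preenvelope A).2 (M.preenvelope B).1 (f ≫ M.i B)
  obtain ⟨κ, h₁, h₂⟩ := H.prt3 _ (M.mem A) _ (M.mem B) f σ hσ
  exact ⟨σ, κ, hσ, h₁, h₂, M.map_cls f σ κ hσ h₁ h₂⟩

/-- This is the uniqueness given by (PRT2) in the form used throughout: two morphisms to a
suspension agree in the factor category as soon as both complete the same `α` to a morphism into a
fixed triangle, whatever the middle components are. -/
lemma cls_eq (M : RightModel S C X R T) (H : IsPartialRightTriangulated S C X R) {A' E : T}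
    {A B : 𝒜} {f : A ⟶ B} {g : B ⟶ M.o E} {h : M.o E ⟶ S.obj A} (hP : RightSeq.mk f g h ∈ R)
    {α : A ⟶ M.o A'} {β β' : B ⟶ M.Y A'} {γ γ' : M.o E ⟶ M.o (M.Ψ.obj A')}
    (h₁ : f ≫ β = α ≫ M.i A') (h₂ : g ≫ γ = β ≫ M.p A') (h₃ : h ≫ S.map α = γ ≫ M.q A')
    (h₁' : f ≫ β' = α ≫ M.i A') (h₂' : g ≫ γ' = β' ≫ M.p A')
    (h₃' : h ≫ S.map α = γ' ≫ M.q A') : (M.cls γ : E ⟶ _) = M.cls γ' :=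
  (M.cls_eq_iff _ _).2 (H.filler_sub hP (M.mem A') (M.preenvelope A').1 h₁ h₂ h₃ h₁' h₂' h₃')

/-- Sums of fillers are fillers since `S` is additive, and any filler computes `Ψ`. -/
lemma additive (M : RightModel S C X R T) (H : IsPartialRightTriangulated S C X R) :
    M.Ψ.Additive where
  map_add {A B f g} := by
    obtain ⟨f, rfl⟩ := M.cls_surjective f
    obtain ⟨g, rfl⟩ := M.cls_surjective g
    obtain ⟨σ, κ, h₁, h₂, h₃, h₄⟩ := M.exists_map H f
    obtain ⟨σ', κ', h₁', h₂', h₃', h₄'⟩ := M.exists_map H g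
    rw [h₄, h₄', ← M.cls_add, ← M.cls_add]
    exact M.map_cls _ (σ + σ') _ (by simp [h₁, h₁']) (by simp [h₂, h₂'])
      (by simp [S.map_add, h₃, h₃'])

/-- The morphism from the third term of a triangle on an `X`-preenvelope to the suspension is
an isomorphism. -/
lemma isIso_cls (M : RightModel S C X R T) (H : IsPartialRightTriangulated S C X R) {A N : T}
    {Y : 𝒜} {f : M.o A ⟶ Y} {g : Y ⟶ M.o N} {h : M.o N ⟶ S.obj (M.o A)}
    (hP : RightSeq.mk f g h ∈ R) (hf : IsPreenvelope X f) {δ : Y ⟶ M.Y A}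
    {ξ : M.o N ⟶ M.o (M.Ψ.obj A)} (hδ : f ≫ δ = M.i A) (comm : g ≫ ξ = δ ≫ M.p A)
    (hξ : h = ξ ≫ M.q A) : ∃ (ε : M.Y A ⟶ Y) (ζ : M.o (M.Ψ.obj A) ⟶ M.o N),
      M.p A ≫ ζ = ε ≫ g ∧ M.q A = ζ ≫ h ∧ (M.cls ξ : N ⟶ _) ≫ M.cls ζ = 𝟙 _ ∧
        (M.cls ζ : _ ⟶ N) ≫ M.cls ξ = 𝟙 _ := by
  obtain ⟨ε, hε⟩ := (M.preenvelope A).2 hf.1 f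
  obtain ⟨ζ, h₁, h₂⟩ := H.prt3 _ (M.mem A) _ hP (𝟙 (M.o A)) ε (by simp [hε])
  dsimp only at ζ h₁ h₂
  rw [S.map_id, Category.comp_id] at h₂
  refine ⟨ε, ζ, h₁, h₂, ?_, ?_⟩
  · rw [← M.cls_comp, ← M.cls_id, M.cls_eq_iff]
    -- Each composite is the third part of an endomorphism of a triangle over the identity, with
    -- middle term in `X`, and so is the identity; hence they agree modulo `X`.
    refine H.filler_sub (α := 𝟙 _) (β := δ ≫ ε) (β' := 𝟙 _) hP hP hf.1 ?_ ?_ ?_ ?_ ?_ ?_ <;>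
      simp [reassoc_of% hδ, hε, reassoc_of% comm, h₁, ← hξ, ← h₂]
  · rw [← M.cls_comp, ← M.cls_id]
    refine M.cls_eq H (α := 𝟙 _) (β := ε ≫ δ) (β' := 𝟙 _) (M.mem A) ?_ ?_ ?_ ?_ ?_ ?_ <;>
      simp [reassoc_of% hε, hδ, reassoc_of% h₁, comm, ← hξ, ← h₂]

/-! ### The axioms (RT1)–(RT3) for a factor category -/

section Axioms

variable [IsAdditiveSubcategory C] [IsAdditiveSubcategory X]

lemma rt1_id (M : RightModel S C X R T) (H : IsPartialRightTriangulated S C X R) (Z A : T)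
    (hZ : IsZero Z) : RightSeq.mk (S := M.Ψ) (0 : Z ⟶ A) (𝟙 A) (0 : A ⟶ M.Ψ.obj Z) ∈ M.Δ := by
  -- An object that is zero in `T` may be represented by a nonzero object of `𝒜`, so the triangle is
  -- built on an object `Z₀` that is zero in both and then transported.
  obtain ⟨Z₀, h, hZ₀⟩ := M.exists_isZero
  have hs : M.IsStd (0 : M.o Z₀ ⟶ M.o A) (𝟙 _) 0 0 (0 : M.o A ⟶ M.o (M.Ψ.obj Z₀)) :=
    ⟨H.zero_mem h (M.prop A), fun _ _ k => ⟨0, h.eq_of_src _ _⟩, h.eq_of_src _ _, by simp,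
      by simp⟩
  have := M.additive H
  refine M.mem_of_iso hs.mem_Δ (hZ₀.iso hZ) (Iso.refl _) (Iso.refl _) ?_ ?_ ?_
  · exact hZ₀.eq_of_src _ _
  · simp [M.cls_id]
  · simp [M.cls_zero]

/-- Adding the preenvelope of `A` as a component changes nothing modulo `X` but makes the morphism
`X`-monic, so that (PRT1)(iii) provides a standard triangle. Every morphism of the factor category
is thus isomorphic to the first morphism of a standard triangle. -/
lemma exists_cone (M : RightModel S C X R T) (H : IsPartialRightTriangulated S C X R) {A B : T}
    (f : M.o A ⟶ M.o B) : ∃ (Z E : T) (e : M.o Z ≅ M.Y A ⊞ M.o B) (φ : M.o A ⟶ M.o Z)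
      (g : M.o Z ⟶ M.o E) (h : M.o E ⟶ S.obj (M.o A)) (δ : M.o Z ⟶ M.Y A)
      (ξ : M.o E ⟶ M.o (M.Ψ.obj A)), M.IsStd φ g h δ ξ ∧
      φ ≫ e.hom = biprod.lift (M.i A) f := by
  obtain ⟨N, g, h, hN⟩ := H.exists_cone (M.prop A) (M.mem A) (M.preenvelope A) (M.prop B) f
  obtain ⟨Z, hZ⟩ := M.ess (M.Y A ⊞ M.o B)
    (IsAdditiveSubcategory.biprod (H.le _ (M.preenvelope A).1) (M.prop B))
  obtain ⟨E, rfl⟩ := M.ess N (H.isRightCSeq _ hN).1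
  let e : M.o Z ≅ M.Y A ⊞ M.o B := eqToIso hZ
  have hP := H.mem_of_iso hN (f' := biprod.lift (M.i A) f ≫ e.inv) (g' := e.hom ≫ g) (h' := h)
    (Iso.refl _) e.symm (Iso.refl _) (by simp) (by simp) (by simp)
  obtain ⟨δ, ξ, hs⟩ := M.exists_std H hP (by
    refine IsRelMonic.of_comp (g := e.hom ≫ biprod.fst) ?_
    simpa using (M.preenvelope A).2)
  exact ⟨Z, E, e, _, _, _, _, _, hs, by simp⟩

/-- Projection from a biproduct with an object of `X`. -/
noncomputable def projIso (M : RightModel S C X R T) {Z B : T} {Y : 𝒜} (hY : X Y)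
    (e : M.o Z ≅ Y ⊞ M.o B) : Z ≅ B where
  hom := M.cls (e.hom ≫ biprod.snd)
  inv := M.cls (biprod.inr ≫ e.inv)
  hom_inv_id := by
    rw [← M.cls_comp, ← M.cls_id, M.cls_eq_iff]
    refine ⟨Y, hY, e.hom ≫ biprod.fst, -(biprod.inl ≫ e.inv), ?_⟩
    rw [← cancel_mono e.hom, ← cancel_epi e.inv]
    ext <;> simp [Preadditive.sub_comp, Preadditive.comp_sub]
  inv_hom_id := by
    rw [← M.cls_comp, ← M.cls_id]
    simp

lemma rt1_exists (M : RightModel S C X R T) (H : IsPartialRightTriangulated S C X R) {A B : T}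
    (f : A ⟶ B) : ∃ (E : T) (g : B ⟶ E) (h : E ⟶ M.Ψ.obj A), RightSeq.mk f g h ∈ M.Δ := by
  obtain ⟨f, rfl⟩ := M.cls_surjective f
  obtain ⟨Z, E, e, φ, g, h, δ, ξ, hs, he⟩ := M.exists_cone H f
  let π := M.projIso (M.preenvelope A).1 e
  refine ⟨E, π.inv ≫ M.cls g, M.cls ξ, M.mem_of_iso hs.mem_Δ
    (Iso.refl _) π (Iso.refl _) ?_ ?_ ?_⟩
  · simp [π, projIso, ← M.cls_comp, reassoc_of% he]
  · simp
  · simp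

/-- A square commuting modulo `X` can be made to commute in `𝒜`: the error starts with a morphism
from the source of an `X`-monic to an object of `X`, which extends and is subtracted from `β`. Then
(PRT3) applies. Sequences isomorphic to standard ones are handled by conjugation. -/
lemma rt3 (M : RightModel S C X R T) (H : IsPartialRightTriangulated S C X R)
    (P : RightSeq M.Ψ) (hP : P ∈ M.Δ) (Q : RightSeq M.Ψ) (hQ : Q ∈ M.Δ) (α : P.A ⟶ Q.A)
    (β : P.B ⟶ Q.B) (h : P.f ≫ β = α ≫ Q.f) :
    ∃ γ : P.C ⟶ Q.C, P.g ≫ γ = β ≫ Q.g ∧ P.h ≫ M.Ψ.map α = γ ≫ Q.h := by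
  have key : ∀ {A B E A' B' E' : T} {f : M.o A ⟶ M.o B} {g : M.o B ⟶ M.o E}
      {h : M.o E ⟶ S.obj (M.o A)} {δ ξ} (_ : M.IsStd f g h δ ξ) {f' : M.o A' ⟶ M.o B'}
      {g' : M.o B' ⟶ M.o E'} {h' : M.o E' ⟶ S.obj (M.o A')} {δ' ξ'}
      (_ : M.IsStd f' g' h' δ' ξ') (α : A ⟶ A') (β : B ⟶ B'), M.cls f ≫ β = α ≫ M.cls f' →
      ∃ γ : E ⟶ E', M.cls g ≫ γ = β ≫ M.cls g' ∧ M.cls ξ ≫ M.Ψ.map α = γ ≫ M.cls ξ' := by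
    intro A B E A' B' E' f g h δ ξ hs f' g' h' δ' ξ' hs' α β hαβ
    obtain ⟨α, rfl⟩ := M.cls_surjective α
    obtain ⟨β, rfl⟩ := M.cls_surjective β
    rw [← M.cls_comp, ← M.cls_comp, M.cls_eq_iff] at hαβ
    obtain ⟨Y, hY, a, b, hab⟩ := hαβ
    obtain ⟨t, ht⟩ := hs.monic hY a
    -- The corrected `β - t ≫ b` has the same class as `β` and makes the square commute strictly.
    have hβ : f ≫ (β - t ≫ b) = α ≫ f' := by
      rw [Preadditive.comp_sub, reassoc_of% ht, hab]; abel
    obtain ⟨γ, h₁, h₂⟩ := H.prt3 _ hs.mem _ hs'.mem α (β - t ≫ b) hβ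
    obtain ⟨σ, κ, k₁, k₂, k₃, k₄⟩ := M.exists_map H α
    have hβ' : (M.cls (β - t ≫ b) : B ⟶ B') = M.cls β :=
      (M.cls_eq_iff _ _).2 ⟨Y, hY, -t, b, by simp⟩
    refine ⟨M.cls γ, ?_, ?_⟩
    · rw [← hβ', ← M.cls_comp, ← M.cls_comp]
      exact congrArg _ h₁
    · rw [k₄, ← M.cls_comp, ← M.cls_comp]
      dsimp only at γ h₁ h₂
      -- Both sides complete `α` to a morphism from the given triangle to the fixed triangle of
      -- `A'`: one route goes through the fixed triangle of `A`, the other through the second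
      -- standard triangle.
      refine M.cls_eq H hs.mem (α := α) (β := δ ≫ σ) (β' := (β - t ≫ b) ≫ δ') ?_ ?_ ?_ ?_ ?_ ?_
      · rw [reassoc_of% hs.hδ, k₁]
      · rw [reassoc_of% hs.comm, k₂, Category.assoc]
      · rw [hs.hξ, Category.assoc, k₃, Category.assoc]
      · rw [reassoc_of% hβ, hs'.hδ]
      · rw [reassoc_of% h₁, hs'.comm, Category.assoc]
      · rw [h₂, hs'.hξ, Category.assoc]
  obtain ⟨A, B, E, f, g, h', δ, ξ, hs, a, b, c, e₁, e₂, e₃⟩ := hP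
  obtain ⟨A', B', E', f', g', h'', δ', ξ', hs', a', b', c', e₁', e₂', e₃'⟩ := hQ
  dsimp only at a b c e₁ e₂ e₃ a' b' c' e₁' e₂' e₃'
  obtain ⟨γ, h₁, h₂⟩ := key hs hs' (a.inv ≫ α ≫ a'.hom) (b.inv ≫ β ≫ b'.hom) (by
    rw [← cancel_epi a.hom, ← reassoc_of% e₁]
    simp [reassoc_of% h, e₁'])
  refine ⟨c.hom ≫ γ ≫ c'.inv, ?_, ?_⟩
  · rw [reassoc_of% e₂, reassoc_of% h₁]
    simp [← reassoc_of% e₂']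
  · rw [← cancel_mono (M.Ψ.map a'.hom)]
    simp only [Category.assoc, e₃', Iso.inv_hom_id_assoc, ← h₂]
    simp only [← reassoc_of% e₃, ← M.Ψ.map_comp, Iso.hom_inv_id_assoc]

/-- By `rotation`, the class of `g` is isomorphic to that of `(δ, i', g)`, whose cone is the cone
`N` of an `X`-preenvelope of `A`, hence isomorphic to the suspension of `A`. -/
lemma rt2 (M : RightModel S C X R T) (H : IsPartialRightTriangulated S C X R) {A B E : T}
    (f : A ⟶ B) (g : B ⟶ E) (h : E ⟶ M.Ψ.obj A) (hP : RightSeq.mk f g h ∈ M.Δ) :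
    RightSeq.mk g h (-M.Ψ.map f) ∈ M.Δ := by
  have key : ∀ {A B E : T} {f : M.o A ⟶ M.o B} {g : M.o B ⟶ M.o E}
      {h : M.o E ⟶ S.obj (M.o A)} {δ ξ} (_ : M.IsStd f g h δ ξ),
      RightSeq.mk (M.cls g : B ⟶ E) (M.cls ξ) (-M.Ψ.map (M.cls f)) ∈ M.Δ := by
    intro A B E f g h δ ξ hs
    obtain ⟨N, a, b, K, k, j, r, s, hN, hK, h₁, h₂, h₃, h₄, h₅⟩ :=
      H.rotation (M.prop A) (M.prop B) (M.mem A) (M.preenvelope A) (M.mem B) (M.preenvelope B)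
        hs.mem hs.monic δ hs.hδ
    obtain ⟨N, rfl⟩ := M.ess N (H.isRightCSeq _ hN).1
    obtain ⟨K, rfl⟩ := M.ess K (H.isRightCSeq _ hK).1
    have hY : X (M.Y A ⊞ M.Y B) :=
      IsAdditiveSubcategory.biprod (M.preenvelope A).1 (M.preenvelope B).1
    obtain ⟨Z, hZ⟩ := M.ess ((M.Y A ⊞ M.Y B) ⊞ M.o E)
      (IsAdditiveSubcategory.biprod (H.le _ hY) (M.prop E))
    let e : M.o Z ≅ (M.Y A ⊞ M.Y B) ⊞ M.o E := eqToIso hZ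
    have hK' := H.mem_of_iso hK (f' := biprod.lift (biprod.lift δ (M.i B)) g ≫ e.inv)
      (g' := e.hom ≫ k) (h' := j) (Iso.refl _) e.symm (Iso.refl _) (by simp) (by simp) (by simp)
    obtain ⟨δ', ξ', hs'⟩ := M.exists_std H hK' (by
      refine IsRelMonic.of_comp (g := e.hom ≫ biprod.fst ≫ biprod.snd) ?_
      simpa using (M.preenvelope B).2)
    have hNe : IsPreenvelope X (biprod.lift (M.i A) (f ≫ M.i B)) :=
      ⟨hY, IsRelMonic.of_comp (g := biprod.fst) (by simpa using (M.preenvelope A).2)⟩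
    obtain ⟨ξN, n₁, n₂⟩ := H.prt3 _ hN _ (M.mem A) (𝟙 _) biprod.fst (by simp)
    dsimp only at ξN n₁ n₂
    rw [S.map_id, Category.comp_id] at n₂
    obtain ⟨ε, ζ, -, -, z₁, z₂⟩ := M.isIso_cls H hN hNe (by simp) n₁ n₂
    let π := M.projIso hY e
    let ν : N ≅ M.Ψ.obj A := ⟨M.cls ξN, M.cls ζ, z₁, z₂⟩
    -- The sign comes from the relation `biprod.inr ≫ k = -(r ≫ s.hom)` in `rotation`. It is what
    -- produces the sign in `-Ψ f`.
    let τ : N ≅ K := ⟨-M.cls s.hom, -M.cls s.inv, by simp [← M.cls_comp, M.cls_id],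
      by simp [← M.cls_comp, M.cls_id]⟩
    obtain ⟨σ, κ, k₁, k₂, k₃, k₄⟩ := M.exists_map H f
    have hr : (M.cls r : E ⟶ N) ≫ M.cls ξN = M.cls ξ := by
      rw [← M.cls_comp]
      refine M.cls_eq H hs.mem (α := 𝟙 _) (β := δ) (β' := δ) ?_ ?_ ?_ ?_ ?_ ?_
      · simp [hs.hδ]
      · rw [reassoc_of% h₁, n₁]; simp
      · simp [← n₂, h₂]
      · simp [hs.hδ]
      · exact hs.comm
      · simp [hs.hξ]
    -- Both composites complete `f` to a morphism from the triangle of `N` to the fixed triangle of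
    -- `B`.
    have hξ : (M.cls ξN : N ⟶ _) ≫ M.cls κ = M.cls s.hom ≫ M.cls ξ' := by
      rw [← M.cls_comp, ← M.cls_comp]
      have w := hs'.hδ
      have w' := hs'.comm
      refine M.cls_eq H hN (α := f) (β := biprod.fst ≫ σ) (β' := biprod.inl ≫ e.inv ≫ δ')
        ?_ ?_ ?_ ?_ ?_ ?_
      · simp [k₁]
      · simp [reassoc_of% n₁, k₂]
      · rw [n₂, Category.assoc, k₃, Category.assoc]
      · have w₂ : biprod.lift (M.i A) (f ≫ M.i B) ≫ biprod.inl =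
            f ≫ biprod.lift (biprod.lift δ (M.i B)) g := by
          ext <;> simp [hs.hδ, H.comp_zero hs.mem]
        rw [reassoc_of% w₂, ← Category.assoc (biprod.lift _ _), w]
      · rw [← reassoc_of% h₃]
        simp only [Category.assoc, ← w', Iso.inv_hom_id_assoc]
      · rw [Category.assoc, ← hs'.hξ, h₅]
    -- The standard triangle on `(δ, i', g)` is identified with the rotation by projecting away the
    -- summand in `X` and by `K ≅ N ≅ Ψ A`.
    refine M.mem_of_iso hs'.mem_Δ (Iso.refl _) π (τ.symm ≪≫ ν) ?_ ?_ ?_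
    · simp [π, projIso, ← M.cls_comp]
    · dsimp only [Iso.trans_hom, Iso.symm_hom]
      rw [← cancel_epi π.inv, Iso.inv_hom_id_assoc]
      simp only [π, projIso, τ, ν, ← hr]
      have w : (biprod.inr ≫ e.inv) ≫ e.hom ≫ k = -(r ≫ s.hom) := by simp [h₄]
      rw [← Category.assoc, ← M.cls_comp, w, M.cls_neg, M.cls_comp]
      simp only [Preadditive.neg_comp, Preadditive.comp_neg, neg_neg, Category.assoc]
      rw [← Category.assoc (M.cls s.hom), ← M.cls_comp, s.hom_inv_id, M.cls_id,
        Category.id_comp]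
    · dsimp only [Iso.trans_hom, Iso.symm_hom, Iso.refl_hom]
      rw [Category.assoc, eq_comm, Iso.inv_comp_eq]
      simp [τ, ν, k₄, hξ]
  obtain ⟨A', B', E', f', g', h', δ, ξ, hs, a, b, c, e₁, e₂, e₃⟩ := hP
  have := M.additive H
  dsimp only at a b c e₁ e₂ e₃
  refine M.isoClosed _ _ (RightSeq.Isomorphic.symm (P := .mk g h (-M.Ψ.map f))
    ⟨b, c, M.Ψ.mapIso a, e₂, e₃, ?_⟩) (key hs)
  simp only [Functor.mapIso_hom, Preadditive.neg_comp, Preadditive.comp_neg, ← M.Ψ.map_comp]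
  exact congr(-M.Ψ.map $e₁)

lemma isPreRight (M : RightModel S C X R T) (H : IsPartialRightTriangulated S C X R) :
    IsPreRight M.Ψ M.Δ where
  additive := M.additive H
  isoClosed := M.isoClosed
  rt1_exists := M.rt1_exists H
  rt1_id := M.rt1_id H
  rt2 := M.rt2 H
  rt3 := M.rt3 H

end Axioms

end RightModel

end Models

end

/-! ### The octahedral axiom for a factor category -/

section

namespace RightModel

variable {𝒜 : Type u} [Category.{v} 𝒜] [Preadditive 𝒜] [HasZeroObject 𝒜]
  [HasBinaryBiproducts 𝒜]
variable {S : 𝒜 ⥤ 𝒜} [S.Additive] {C X : ObjectProperty 𝒜} {R : Set (RightSeq S)}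
  {T : Type u} [Category.{v} T] [Preadditive T]
variable [IsAdditiveSubcategory C] [IsAdditiveSubcategory X]

/-- (RT4) for composable standard triangles whose composite has a standard triangle. -/
lemma hasOctahedron (M : RightModel S C X R T) (H : IsPartialRightTriangulated S C X R)
    {A B D C' A' B' : T} {f : M.o A ⟶ M.o B} {l : M.o B ⟶ M.o C'} {m : M.o C' ⟶ S.obj (M.o A)}
    {g : M.o B ⟶ M.o D} {k : M.o D ⟶ M.o A'} {j : M.o A' ⟶ S.obj (M.o B)}
    {p : M.o D ⟶ M.o B'} {q : M.o B' ⟶ S.obj (M.o A)} {δ₁ ξ₁ δ₂ ξ₂ δ₃ ξ₃}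
    (h₁ : M.IsStd f l m δ₁ ξ₁) (h₂ : M.IsStd g k j δ₂ ξ₂) (h₃ : M.IsStd (f ≫ g) p q δ₃ ξ₃) :
    HasOctahedron M.Δ (M.cls f : A ⟶ B) (M.cls g : B ⟶ D) := by
  obtain ⟨r, s, e₁, e₂, e₃, e₄, hrs, hr⟩ := H.prt4 f l m g k j p q (M.prop A) (M.prop B)
    (M.prop D) h₁.monic h₂.monic h₁.mem h₂.mem h₃.mem
  obtain ⟨δ₄, ξ₄, h₄⟩ := M.exists_std H hrs hr
  obtain ⟨σ, κ, k₁, k₂, k₃, k₄⟩ := M.exists_map H f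
  obtain ⟨σ', κ', k₁', k₂', k₃', k₄'⟩ := M.exists_map H l
  have a₁ : (M.cls r : C' ⟶ B') ≫ M.cls ξ₃ = M.cls ξ₁ := by
    rw [← M.cls_comp]
    refine M.cls_eq H h₁.mem (α := 𝟙 _) (β := g ≫ δ₃) (β' := δ₁) ?_ ?_ ?_ ?_ ?_ ?_
    · simpa using h₃.hδ
    · rw [reassoc_of% e₁, h₃.comm, Category.assoc]
    · simp [← h₃.hξ, e₂]
    · simpa using h₁.hδ
    · exact h₁.comm
    · simpa using h₁.hξ
  have a₂ : (M.cls s : B' ⟶ A') ≫ M.cls ξ₂ = M.cls ξ₃ ≫ M.Ψ.map (M.cls f) := by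
    rw [k₄, ← M.cls_comp, ← M.cls_comp]
    refine M.cls_eq H h₃.mem (α := f) (β := δ₂) (β' := δ₃ ≫ σ) ?_ ?_ ?_ ?_ ?_ ?_
    · rw [Category.assoc, h₂.hδ]
    · rw [reassoc_of% e₃, h₂.comm]
    · rw [Category.assoc, ← h₂.hξ, e₄]
    · rw [← Category.assoc, h₃.hδ, k₁]
    · rw [reassoc_of% h₃.comm, k₂, Category.assoc]
    · rw [h₃.hξ, Category.assoc, Category.assoc, k₃]
  have a₃ : (M.cls ξ₂ : A' ⟶ _) ≫ M.Ψ.map (M.cls l) = M.cls ξ₄ := by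
    rw [k₄', ← M.cls_comp]
    refine M.cls_eq H h₂.mem (α := l) (β := δ₂ ≫ σ') (β' := p ≫ δ₄) ?_ ?_ ?_ ?_ ?_ ?_
    · rw [reassoc_of% h₂.hδ, k₁']
    · rw [reassoc_of% h₂.comm, k₂', Category.assoc]
    · rw [h₂.hξ, Category.assoc, Category.assoc, k₃']
    · rw [← reassoc_of% e₁, h₄.hδ]
    · rw [← e₃, Category.assoc, h₄.comm, Category.assoc]
    · exact h₄.hξ
  refine ⟨C', A', B', M.cls l, M.cls ξ₁, M.cls k, M.cls ξ₂, M.cls p, M.cls ξ₃, M.cls r, M.cls s,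
    h₁.mem_Δ, h₂.mem_Δ, ?_, ?_, a₁, ?_, a₂, ?_⟩
  · rw [← M.cls_comp]
    exact h₃.mem_Δ
  · rw [← M.cls_comp, e₁, M.cls_comp]
  · rw [← M.cls_comp, e₃]
  · rw [a₃]
    exact h₄.mem_Δ

/-- (PRT4) requires `X`-monic representatives of `f` and `g` whose composite also begins a triangle.
Successive enlargement by preenvelopes achieves this, provided that the first preenvelope survives
in the composite. -/
lemma exists_octahedron (M : RightModel S C X R T) (H : IsPartialRightTriangulated S C X R)
    {A B D : T} (f : A ⟶ B) (g : B ⟶ D) : ∃ (B₁ D₁ : T) (b : B ≅ B₁) (d : D ≅ D₁)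
      (f₁ : A ⟶ B₁) (g₁ : B₁ ⟶ D₁), f ≫ b.hom = f₁ ∧ g ≫ d.hom = b.hom ≫ g₁ ∧
      HasOctahedron M.Δ f₁ g₁ := by
  obtain ⟨f, rfl⟩ := M.cls_surjective f
  obtain ⟨g, rfl⟩ := M.cls_surjective g
  obtain ⟨Z₁, E₁, e₁, φ₁, l, m, δ₁, ξ₁, h₁, he₁⟩ := M.exists_cone H f
  obtain ⟨V, hV⟩ := M.ess (M.Y A ⊞ M.o D)
    (IsAdditiveSubcategory.biprod (H.le _ (M.preenvelope A).1) (M.prop D))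
  let e : M.o V ≅ M.Y A ⊞ M.o D := eqToIso hV
  -- The morphism enlarged here is the identity on `M.Y A` together with `g`. Keeping that identity
  -- leaves `M.i A` as a component of `φ₁ ≫ φ₂`.
  obtain ⟨Z₂, E₂, e₂, φ₂, k, j, δ₂, ξ₂, h₂, he₂⟩ := M.exists_cone H
    (biprod.lift (e₁.hom ≫ biprod.fst) (e₁.hom ≫ biprod.snd ≫ g) ≫ e.inv)
  -- `biprodSwap` brings the summand `M.Y A` to the front, where the composite has component `M.i
  -- A`.
  obtain ⟨N, p, q, hN⟩ := H.exists_triangle (M.prop A) (M.mem A) (M.preenvelope A)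
    (IsAdditiveSubcategory.biprod (H.le _ (M.preenvelope Z₁).1) (M.prop D)) (φ₁ ≫ φ₂)
    (e₂ ≪≫ biprod.mapIso (Iso.refl _) e ≪≫ biprodSwap _ _ _) (by
      simp [biprodSwap, reassoc_of% he₂, reassoc_of% he₁])
  obtain ⟨E₃, rfl⟩ := M.ess N (H.isRightCSeq _ hN).1
  obtain ⟨δ₃, ξ₃, h₃⟩ := M.exists_std H hN (h₁.monic.comp h₂.monic)
  let π₁ := M.projIso (M.preenvelope A).1 e₁
  let π₂ := M.projIso (M.preenvelope Z₁).1 e₂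
  let π₃ := M.projIso (M.preenvelope A).1 e
  refine ⟨Z₁, Z₂, π₁.symm, (π₂ ≪≫ π₃).symm, M.cls φ₁, M.cls φ₂, ?_, ?_,
    M.hasOctahedron H h₁ h₂ h₃⟩
  · rw [Iso.symm_hom, Iso.comp_inv_eq]
    simp [π₁, projIso, ← M.cls_comp, reassoc_of% he₁]
  · rw [Iso.symm_hom, Iso.symm_hom, Iso.comp_inv_eq, Category.assoc, Iso.eq_inv_comp]
    simp only [π₁, π₂, π₃, projIso, Iso.trans_hom, ← M.cls_comp, Category.assoc,
      reassoc_of% he₂]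
    simp

/-- The factor category `C / X` of a partial right triangulated category is right
triangulated. -/
theorem isRightTriangulated (M : RightModel S C X R T) (H : IsPartialRightTriangulated S C X R) :
    IsRightTriangulated M.Ψ M.Δ where
  hasZeroObject := M.hasZeroObject
  hasBinaryBiproducts := M.hasBinaryBiproducts
  additive := M.additive H
  isoClosed := M.isoClosed
  rt1_exists := M.rt1_exists H
  rt1_id := M.rt1_id H
  rt2 := M.rt2 H
  rt3 := M.rt3 H
  rt4 f l m g k j p q hf hg hfg := by
    have := M.hasZeroObject
    obtain ⟨B₁, D₁, b, d, f₁, g₁, h₁, h₂, O⟩ := M.exists_octahedron H f g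
    exact (M.isPreRight H).rt4 f l m g k j p q hf hg hfg (Iso.refl _) b d f₁ g₁
      (by simpa using h₁) h₂ O

/-- Every distinguished triangle `A ⟶ B ⟶ K` is isomorphic to a standard one
`A ⟶ Z ⟶ N`, with `Z` the direct sum of `B` and of an object of `X`. -/
lemma exists_std_iso (M : RightModel S C X R T) (H : IsPartialRightTriangulated S C X R)
    {A B K : T} {f : A ⟶ B} {g : B ⟶ K} {h : K ⟶ M.Ψ.obj A} (hP : RightSeq.mk f g h ∈ M.Δ) :
    ∃ (Z N : T) (_ : M.o Z ≅ M.Y A ⊞ M.o B) (φ : M.o A ⟶ M.o Z) (g' : M.o Z ⟶ M.o N)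
      (h' : M.o N ⟶ S.obj (M.o A)) (δ : M.o Z ⟶ M.Y A) (ξ : M.o N ⟶ M.o (M.Ψ.obj A))
      (b : B ≅ Z) (c : K ≅ N), M.IsStd φ g' h' δ ξ ∧ f ≫ b.hom = M.cls φ ∧
      g ≫ c.hom = b.hom ≫ M.cls g' ∧ h = c.hom ≫ M.cls ξ := by
  have := M.hasZeroObject
  obtain ⟨f, rfl⟩ := M.cls_surjective f
  obtain ⟨Z, N, e, φ, g', h', δ, ξ, hs, he⟩ := M.exists_cone H f
  let π := M.projIso (M.preenvelope A).1 e
  have hf : M.cls f ≫ π.inv = M.cls φ := by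
    rw [Iso.comp_inv_eq]
    simp [π, projIso, ← M.cls_comp, reassoc_of% he]
  obtain ⟨c, c₁, c₂⟩ := (M.isPreRight H).exists_iso hP hs.mem_Δ (Iso.refl _) π.symm
    (by simpa using hf)
  exact ⟨Z, N, e, φ, g', h', δ, ξ, π.symm, c, hs, hf, c₁, by simpa using c₂⟩

end RightModel

end

section

/-! ### Right triangulated structures on reflective subcategories -/

section Reflective

variable {T T' : Type u} [Category.{v} T] [Category.{v} T'] {Ψ : T ⥤ T} {E : T' ⥤ T}
  {R : T ⥤ T'}

/-- The class of right sequences of a reflective subcategory induced by `Δ`, where `e B` is the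
isomorphism from `B` to its reflection. -/
def reflectedTriangles (Δ : Set (RightSeq Ψ)) (e : ∀ B, B ⟶ R.obj (E.obj B)) :
    Set (RightSeq (E ⋙ Ψ ⋙ R)) :=
  {P | ∃ (A B : T') (K : T) (f : A ⟶ B) (g : E.obj B ⟶ K) (h : K ⟶ Ψ.obj (E.obj A)),
    RightSeq.mk (E.map f) g h ∈ Δ ∧
      P.Isomorphic (RightSeq.mk (S := E ⋙ Ψ ⋙ R) f (e B ≫ R.map g) (R.map h))}

/-- The reflection is compatible with the triangles in `Δ`. -/
def StabilizesTriangles (Δ : Set (RightSeq Ψ)) (adj : R ⊣ E) : Prop :=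
  ∀ {A B K M : T} (f : A ⟶ B) (g : B ⟶ K) (h : K ⟶ Ψ.obj A) (g' : E.obj (R.obj B) ⟶ M)
    (h' : M ⟶ Ψ.obj (E.obj (R.obj A))), RightSeq.mk f g h ∈ Δ →
    RightSeq.mk (E.map (R.map f)) g' h' ∈ Δ →
    ∃ t : K ⟶ M, g ≫ t = adj.unit.app B ≫ g' ∧ h ≫ Ψ.map (adj.unit.app A) = t ≫ h' ∧
      IsIso (R.map t)

variable [E.Full] [E.Faithful] (adj : R ⊣ E) {e : ∀ B, B ⟶ R.obj (E.obj B)}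
  (he : ∀ B, E.map (e B) = adj.unit.app (E.obj B))

include he

lemma reflection_comp_counit (B : T') : e B ≫ adj.counit.app B = 𝟙 B := by
  apply E.map_injective
  simp [he]

/-- An object of the subcategory is isomorphic to its reflection. -/
noncomputable def reflectionIso (B : T') : B ≅ R.obj (E.obj B) :=
  ⟨e B, adj.counit.app B, reflection_comp_counit adj he B, by
    rw [← cancel_mono (adj.counit.app B), Category.assoc, reflection_comp_counit adj he]
    simp⟩

lemma reflection_naturality {A B : T'} (f : A ⟶ B) :
    f ≫ e B = e A ≫ R.map (E.map f) := by
  apply E.map_injective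
  simp [he]

/-- Composition with the counit, a monomorphism because `E` is fully faithful, turns both sides into
the identity. -/
lemma map_unit_eq (K : T) : R.map (adj.unit.app K) = e (R.obj K) := by
  rw [← cancel_mono (adj.counit.app (R.obj K))]
  exact (adj.left_triangle_components K).trans (reflection_comp_counit adj he _).symm

variable {Δ : Set (RightSeq Ψ)} [Preadditive T] [Preadditive T'] [E.Additive]
  [HasZeroObject T] [HasZeroObject T']

/-- A reflected triangle must start from a triangle on `E (R f)`. Stabilization compares that
triangle with the given one on `f`, by a morphism which `R` inverts. The unit in the third morphism
accounts for the change from `A` to `E (R A)`. -/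
lemma map_mem_reflectedTriangles (H : IsPreRight Ψ Δ) (hst : StabilizesTriangles Δ adj)
    {A B K : T} {f : A ⟶ B} {g : B ⟶ K} {h : K ⟶ Ψ.obj A} (hP : RightSeq.mk f g h ∈ Δ) :
    RightSeq.mk (S := E ⋙ Ψ ⋙ R) (R.map f) (R.map g)
      (R.map (h ≫ Ψ.map (adj.unit.app A))) ∈ reflectedTriangles Δ e := by
  obtain ⟨M, g', h', hM⟩ := H.rt1_exists (E.map (R.map f))
  obtain ⟨t, h₁, h₂, h₃⟩ := hst f g h g' h' hP hM
  refine ⟨_, _, _, R.map f, g', h', hM, Iso.refl _, Iso.refl _, asIso (R.map t), by simp, ?_, ?_⟩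
  · simp only [asIso_hom, ← R.map_comp, h₁]
    simp [map_unit_eq adj he]
  · simp [h₂]

/-- Existence and (RT3) are inherited by applying `R`. Rotation is the only axiom here that needs
stabilization, since the rotated triangle involves the third term `K`, which need not lie in the
subcategory. -/
lemma reflectedTriangles_isPreRight (H : IsPreRight Ψ Δ) (hst : StabilizesTriangles Δ adj) :
    IsPreRight (E ⋙ Ψ ⋙ R) (reflectedTriangles Δ e) where
  additive := by
    have := H.additive
    have := adj.left_adjoint_additive
    infer_instance
  isoClosed P Q h := by
    rintro ⟨A, B, K, f, g, k, hP, hi⟩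
    exact ⟨A, B, K, f, g, k, hP, h.symm.trans hi⟩
  rt1_exists {A B} f := by
    obtain ⟨K, g, h, hK⟩ := H.rt1_exists (E.map f)
    exact ⟨_, _, _, A, B, K, f, g, h, hK, RightSeq.Isomorphic.refl _⟩
  rt1_id Z A hZ := by
    have := adj.left_adjoint_additive
    have hZ' : IsZero (E.obj Z) := by
      rw [IsZero.iff_id_eq_zero, ← E.map_id, (IsZero.iff_id_eq_zero Z).1 hZ, E.map_zero]
    have h := H.rt1_id (E.obj Z) (E.obj A) hZ'
    refine ⟨Z, A, E.obj A, 0, 𝟙 _, 0, by simpa using h, Iso.refl _, Iso.refl _,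
      reflectionIso adj he A, by simp, by simp [reflectionIso], by simp⟩
  rt2 {A' B' C'} f' g' h' := by
    have := H.additive
    have := adj.left_adjoint_additive
    rintro ⟨A, B, K, f, g, h, hP, a, b, c, h₁, h₂, h₃⟩
    dsimp only at a b c h₁ h₂ h₃
    obtain ⟨A₁, B₁, K₁, f₁, g₁, k₁, hP₁, hi⟩ :=
      map_mem_reflectedTriangles adj he H hst (H.rt2 _ _ _ hP)
    refine ⟨A₁, B₁, K₁, f₁, g₁, k₁, hP₁, RightSeq.Isomorphic.trans ?_ hi⟩
    -- The reflected rotation starts at `R (E B)` rather than at `B`, so the isomorphism `B ≅ R (E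
    -- B)` is inserted. The unit in its third morphism is then absorbed by naturality.
    refine ⟨b ≪≫ reflectionIso adj he B, c, (E ⋙ Ψ ⋙ R).mapIso a, ?_, ?_, ?_⟩
    · simpa [reflectionIso] using h₂
    · exact h₃
    · have w : f' ≫ b.hom ≫ e B = a.hom ≫ f ≫ e B := by rw [reassoc_of% h₁]
      have w' : (E ⋙ Ψ ⋙ R).map (f ≫ e B) = R.map (Ψ.map (E.map f) ≫
          Ψ.map (adj.unit.app (E.obj B))) := by
        simp only [Functor.comp_map, E.map_comp, he, Ψ.map_comp]
      dsimp only [Functor.mapIso_hom, Iso.trans_hom, reflectionIso]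
      rw [Preadditive.neg_comp, ← Functor.map_comp, w, Functor.map_comp, w',
        Preadditive.neg_comp, R.map_neg, Preadditive.comp_neg]
  rt3 := by
    have key : ∀ {A B A' B' : T'} {K K' : T} {f : A ⟶ B} {g : E.obj B ⟶ K}
        {h : K ⟶ Ψ.obj (E.obj A)} (_ : RightSeq.mk (E.map f) g h ∈ Δ) {f' : A' ⟶ B'}
        {g' : E.obj B' ⟶ K'} {h' : K' ⟶ Ψ.obj (E.obj A')}
        (_ : RightSeq.mk (E.map f') g' h' ∈ Δ) (α : A ⟶ A') (β : B ⟶ B'), f ≫ β = α ≫ f' →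
        ∃ γ : R.obj K ⟶ R.obj K', (e B ≫ R.map g) ≫ γ = β ≫ e B' ≫ R.map g' ∧
          R.map h ≫ R.map (Ψ.map (E.map α)) = γ ≫ R.map h' := by
      intro A B A' B' K K' f g h hP f' g' h' hP' α β hαβ
      obtain ⟨γ, h₁, h₂⟩ := H.rt3 _ hP _ hP' (E.map α) (E.map β) (by
        dsimp only; rw [← E.map_comp, ← E.map_comp, hαβ])
      dsimp only at γ h₁ h₂
      refine ⟨R.map γ, ?_, ?_⟩
      · rw [Category.assoc, ← R.map_comp, h₁, R.map_comp,
          reassoc_of% reflection_naturality adj he β]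
      · rw [← R.map_comp, h₂, R.map_comp]
    rintro P ⟨A, B, K, f, g, h, hP, a, b, c, e₁, e₂, e₃⟩ Q ⟨A', B', K', f', g', h', hP', a', b',
      c', e₁', e₂', e₃'⟩ α β hαβ
    dsimp only at a b c e₁ e₂ e₃ a' b' c' e₁' e₂' e₃'
    obtain ⟨γ, h₁, h₂⟩ := key hP hP' (a.inv ≫ α ≫ a'.hom) (b.inv ≫ β ≫ b'.hom) (by
      rw [← cancel_epi a.hom, ← reassoc_of% e₁]
      simp [reassoc_of% hαβ, e₁'])
    refine ⟨c.hom ≫ γ ≫ c'.inv, ?_, ?_⟩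
    · simp only [Category.assoc] at h₁
      simp only [reassoc_of% e₂, reassoc_of% h₁]
      simp only [Iso.hom_inv_id_assoc, ← reassoc_of% e₂', Iso.hom_inv_id,
        Category.comp_id]
    · rw [← cancel_mono ((E ⋙ Ψ ⋙ R).map a'.hom)]
      simp only [Category.assoc, e₃', Iso.inv_hom_id_assoc, ← h₂]
      rw [← reassoc_of% e₃]
      simp only [Functor.comp_map, ← R.map_comp, ← Ψ.map_comp, ← E.map_comp,
        Iso.hom_inv_id_assoc]

/-- A reflective subcategory of a right triangulated category is right triangulated if the
reflection is compatible with the triangles. -/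
theorem reflectedTriangles_isRightTriangulated [HasBinaryBiproducts T']
    (H : IsRightTriangulated Ψ Δ) (hst : StabilizesTriangles Δ adj) :
    IsRightTriangulated (E ⋙ Ψ ⋙ R) (reflectedTriangles Δ e) := by
  have H' := reflectedTriangles_isPreRight adj he H.isPreRight hst
  refine ⟨inferInstance, inferInstance, H'.additive, H'.isoClosed, H'.rt1_exists, H'.rt1_id,
    H'.rt2, H'.rt3, ?_⟩
  intro A B D C' A' B' f l m g k j p q hf hg hfg
  -- It suffices to find one octahedron on `f` and `g`; the reflection of an octahedron in `T` is
  -- taken.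
  refine H'.rt4 f l m g k j p q hf hg hfg (Iso.refl _) (Iso.refl _) (Iso.refl _) f g
    (by simp) (by simp) ?_
  obtain ⟨C₁, l₁, m₁, t₁⟩ := H.rt1_exists (E.map f)
  obtain ⟨A₁, k₁, j₁, t₂⟩ := H.rt1_exists (E.map g)
  obtain ⟨B₁, p₁, q₁, t₃⟩ := H.rt1_exists (E.map f ≫ E.map g)
  obtain ⟨r, s, e₁, e₂, e₃, e₄, t₄⟩ := H.rt4 _ _ _ _ _ _ _ _ t₁ t₂ t₃
  refine ⟨R.obj C₁, R.obj A₁, R.obj B₁, e B ≫ R.map l₁, R.map m₁, e D ≫ R.map k₁, R.map j₁,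
    e D ≫ R.map p₁, R.map q₁, R.map r, R.map s,
    ⟨_, _, _, _, _, _, t₁, RightSeq.Isomorphic.refl _⟩,
    ⟨_, _, _, _, _, _, t₂, RightSeq.Isomorphic.refl _⟩,
    ⟨_, _, _, f ≫ g, _, _, by simpa using t₃, RightSeq.Isomorphic.refl _⟩, ?_, ?_, ?_, ?_, ?_⟩
  · rw [Category.assoc, ← R.map_comp, e₁, R.map_comp,
      reassoc_of% reflection_naturality adj he g]
  · rw [← R.map_comp, e₂]
  · rw [Category.assoc, ← R.map_comp, e₃]
  · rw [← R.map_comp, e₄, R.map_comp]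
    rfl
  · have h := map_mem_reflectedTriangles adj he H.isPreRight hst t₄
    have w : R.map ((j₁ ≫ Ψ.map l₁) ≫ Ψ.map (adj.unit.app C₁)) =
        R.map j₁ ≫ (E ⋙ Ψ ⋙ R).map (e B ≫ R.map l₁) := by
      have w' : E.map (e B ≫ R.map l₁) = l₁ ≫ adj.unit.app C₁ := by simp [he]
      simp only [Functor.comp_map, w', Category.assoc, R.map_comp, Ψ.map_comp]
    rw [w] at h
    exact h

end Reflective

end

section

variable {𝒜 : Type u} [Category.{v} 𝒜] [Preadditive 𝒜] [HasZeroObject 𝒜]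
  [HasBinaryBiproducts 𝒜]

/-! ### Duality -/

lemma FactorsThroughObj.op {X : ObjectProperty 𝒜} {A B : 𝒜} {f : A ⟶ B}
    (h : FactorsThroughObj X f) : FactorsThroughObj X.op f.op := by
  obtain ⟨Y, hY, a, b, rfl⟩ := h
  exact ⟨Opposite.op Y, hY, b.op, a.op, rfl⟩

lemma FactorsThroughObj.unop {X : ObjectProperty 𝒜} {A B : 𝒜ᵒᵖ} {f : A ⟶ B}
    (h : FactorsThroughObj X.op f) : FactorsThroughObj X f.unop := by
  obtain ⟨Y, hY, a, b, rfl⟩ := h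
  exact ⟨Opposite.unop Y, hY, b.unop, a.unop, rfl⟩

lemma IsRelMonic.unop {X : ObjectProperty 𝒜} {A B : 𝒜ᵒᵖ} {f : A ⟶ B} (h : IsRelMonic X.op f) :
    IsRelEpic X f.unop := by
  intro Y hY k
  obtain ⟨t, ht⟩ := h (Y := Opposite.op Y) hY k.op
  exact ⟨t.unop, congr($(ht).unop)⟩

lemma IsRelEpic.op {X : ObjectProperty 𝒜} {A B : 𝒜} {f : A ⟶ B} (h : IsRelEpic X f) :
    IsRelMonic X.op f.op := by
  intro Y hY k
  obtain ⟨t, ht⟩ := h hY k.unop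
  exact ⟨t.op, congr($(ht).op)⟩

lemma IsRelEpic.unop {X : ObjectProperty 𝒜} {A B : 𝒜ᵒᵖ} {f : A ⟶ B} (h : IsRelEpic X.op f) :
    IsRelMonic X f.unop := by
  intro Y hY k
  obtain ⟨t, ht⟩ := h (Y := Opposite.op Y) hY k.op
  exact ⟨t.unop, congr($(ht).unop)⟩

lemma IsRelMonic.op {X : ObjectProperty 𝒜} {A B : 𝒜} {f : A ⟶ B} (h : IsRelMonic X f) :
    IsRelEpic X.op f.op := by
  intro Y hY k
  obtain ⟨t, ht⟩ := h hY k.unop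
  exact ⟨t.op, congr($(ht).op)⟩

/-- The biproduct in the opposite category. -/
noncomputable def opBiprodIso (A B : 𝒜ᵒᵖ) : Opposite.op (A.unop ⊞ B.unop) ≅ A ⊞ B where
  hom := biprod.lift biprod.inl.op biprod.inr.op
  inv := biprod.desc biprod.fst.op biprod.snd.op
  hom_inv_id := by
    rw [biprod.lift_desc]
    exact congr($(biprod.total (X := A.unop) (Y := B.unop)).op)
  inv_hom_id := by
    apply biprod.hom_ext' <;> apply biprod.hom_ext <;> simp [← op_comp]

instance (P : ObjectProperty 𝒜) [IsAdditiveSubcategory P] : IsAdditiveSubcategory P.op where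
  of_iso e h := IsAdditiveSubcategory.of_iso (P := P) e.unop.symm h
  zero _ hZ := IsAdditiveSubcategory.zero (P := P) _ hZ.unop
  biprod {A B} hA hB := IsAdditiveSubcategory.of_iso (P := P)
    (opBiprodIso A B).unop.symm (IsAdditiveSubcategory.biprod (P := P) hA hB)

section OpPartial

variable {W : 𝒜 ⥤ 𝒜} {F X : ObjectProperty 𝒜} {L : Set (LeftSeq W)}

lemma IsPartialLeftTriangulated.opSet_mem_of_iso (H : IsPartialLeftTriangulated W F X L)
    {P Q : RightSeq W.op} (hP : P ∈ opSet L) (h : P.Isomorphic Q) : Q ∈ opSet L :=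
  H.isoClosed _ _ (LeftSeq.isomorphic_of_op Q P h.symm) hP

/-- A partial left triangulated structure is a partial right triangulated structure on the
opposite category. -/
theorem IsPartialLeftTriangulated.op (H : IsPartialLeftTriangulated W F X L) :
    IsPartialRightTriangulated W.op F.op X.op (opSet L) where
  le A hA := H.le _ hA
  isRightCSeq P hP := by
    obtain ⟨h₁, ⟨h₂, h₃⟩, ⟨h₄, h₅⟩⟩ := H.isLeftFSeq _ hP
    refine ⟨h₁, ⟨congr($(h₂).op), fun _ k hk ↦ ?_⟩, ⟨congr($(h₄).op), fun _ k hk ↦ ?_⟩⟩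
    · obtain ⟨t, ht⟩ := h₃ k.unop congr($(hk).unop)
      exact ⟨t.op, congr($(ht).op)⟩
    · obtain ⟨t, ht⟩ := h₅ k.unop congr($(hk).unop)
      exact ⟨t.op, congr($(ht).op)⟩
  isoClosed P Q h hP := H.opSet_mem_of_iso hP h
  directSum P hP Q hQ := by
    -- The chosen biproduct of the opposite category is only isomorphic to the opposite of the
    -- biproduct, hence the passage through `opBiprodIso`.
    refine H.opSet_mem_of_iso (P := .mk
      (biprod.map P.f.unop Q.f.unop).op (biprod.map P.g.unop Q.g.unop).op
      (biprod.lift (W.map biprod.fst ≫ P.h.unop) (W.map biprod.snd ≫ Q.h.unop)).op)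
      (H.directSum _ hP _ hQ)
      ⟨opBiprodIso _ _, opBiprodIso _ _, opBiprodIso _ _, ?_, ?_, ?_⟩
    · apply biprod.hom_ext <;> simp [opBiprodIso, ← op_comp] <;> rfl
    · apply biprod.hom_ext <;> simp [opBiprodIso, ← op_comp] <;> rfl
    · rw [← Iso.inv_comp_eq]
      have e₁ : biprod.inl ≫ (opBiprodIso P.C Q.C).inv = biprod.fst.op := by simp [opBiprodIso]
      have e₂ : biprod.inr ≫ (opBiprodIso P.C Q.C).inv = biprod.snd.op := by simp [opBiprodIso]
      have e₃ : biprod.fst.op ≫ (opBiprodIso P.A Q.A).hom = biprod.inl := by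
        rw [← Iso.eq_comp_inv]; simp [opBiprodIso]
      have e₄ : biprod.snd.op ≫ (opBiprodIso P.A Q.A).hom = biprod.inr := by
        rw [← Iso.eq_comp_inv]; simp [opBiprodIso]
      apply biprod.hom_ext'
      · rw [reassoc_of% e₁, biprod.inl_desc, ← e₃, W.op.map_comp, ← Category.assoc,
          ← Category.assoc, ← op_comp, biprod.lift_fst]
        rfl
      · rw [reassoc_of% e₂, biprod.inr_desc, ← e₄, W.op.map_comp, ← Category.assoc,
          ← Category.assoc, ← op_comp, biprod.lift_snd]
        rfl
  prt1_i A hA := by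
    obtain ⟨U, Y, n, i, p, hp, h⟩ := H.plt1_i hA
    exact ⟨_, _, p.op, i.op, n.op, ⟨hp.1, hp.2.op⟩, h⟩
  prt1_ii A B hA hB f := by
    refine H.opSet_mem_of_iso (P := .mk (biprod.desc (𝟙 _) f.unop).op
      (biprod.lift f.unop (-𝟙 _)).op 0) (H.plt1_ii hA hB f.unop)
      ⟨Iso.refl _, opBiprodIso _ _, Iso.refl _, ?_, ?_, ?_⟩
    · apply biprod.hom_ext <;> simp [opBiprodIso, ← op_comp]
    · rw [← Iso.inv_comp_eq]
      apply biprod.hom_ext' <;> simp [opBiprodIso, ← op_comp]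
    · simp
  prt1_iii P hP hA hi B hB f := by
    obtain ⟨N, n, g, h⟩ := H.plt1_iii _ hP hA ⟨hi.1, hi.2.unop⟩ hB f.unop
    refine ⟨Opposite.op N, (opBiprodIso _ _).inv ≫ g.op, n.op, H.opSet_mem_of_iso
      (P := .mk (biprod.desc P.f.unop f.unop).op g.op n.op) h
      ⟨Iso.refl _, opBiprodIso _ _, Iso.refl _, ?_, ?_, ?_⟩⟩
    · apply biprod.hom_ext <;> simp [opBiprodIso, ← op_comp]
    · simp
    · simp
  prt2 P hP Q hQ hX α β γ h₁ h₂ h₃ := by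
    rintro ⟨t, ht⟩
    obtain ⟨s, hs⟩ := H.plt2 _ hQ _ hP hX γ.unop β.unop α.unop congr($(h₃.symm).unop)
      congr($(h₂.symm).unop) congr($(h₁.symm).unop) ⟨t.unop, congr($(ht).unop)⟩
    exact ⟨s.op, congr($(hs).op)⟩
  prt3 P hP Q hQ α β h := by
    obtain ⟨γ, h₁, h₂⟩ := H.plt3 _ hQ _ hP β.unop α.unop congr($(h.symm).unop)
    exact ⟨γ.op, congr($(h₁.symm).op), congr($(h₂.symm).op)⟩
  prt4 f l m g k j p q hA hB hD hf hg h₁ h₂ h₃ := by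
    obtain ⟨r, s, e₁, e₂, e₃, e₄, e₅, e₆⟩ := H.plt4 f.unop l.unop m.unop g.unop k.unop j.unop
      p.unop q.unop hA hB hD hf.unop hg.unop h₁ h₂ h₃
    exact ⟨r.op, s.op, congr($(e₁).op), congr($(e₂).op), congr($(e₃).op), congr($(e₄).op), e₅,
      e₆.op⟩

end OpPartial

/-! ### Factor categories as models -/

namespace Subfactor

variable {C X : ObjectProperty 𝒜} [IsAdditiveSubcategory X]

/-- `C / X` as a model. -/
def factorModel : FactorModel C X (Subfactor C X) where
  o A := A.obj
  prop A := A.property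
  ess Z hZ := ⟨⟨Z, hZ⟩, rfl⟩
  cls f := cls f
  cls_surjective f := cls_surjective f
  cls_comp f g := cls_comp f g
  cls_id A := cls_id A
  cls_add f g := cls_add f g
  cls_eq_iff f g := cls_eq_iff f g

/-- The opposite category of `C / X` as a model. -/
def opFactorModel : FactorModel C.op X.op (Subfactor C X)ᵒᵖ where
  o A := Opposite.op A.unop.obj
  prop A := A.unop.property
  ess Z hZ := ⟨Opposite.op ⟨Z.unop, hZ⟩, rfl⟩
  cls f := (cls f.unop).op
  cls_surjective f := by
    obtain ⟨f', hf⟩ := cls_surjective f.unop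
    exact ⟨f'.op, congr($(hf).op)⟩
  cls_comp f g := congr($(cls_comp g.unop f.unop).op)
  cls_id A := congr($(cls_id A.unop).op)
  cls_add f g := congr($(cls_add f.unop g.unop).op)
  cls_eq_iff f g := by
    rw [Quiver.Hom.op_inj.eq_iff]
    exact (cls_eq_iff f.unop g.unop).trans ⟨fun h => h.op, fun h => h.unop⟩

instance [IsAdditiveSubcategory C] : HasZeroObject (Subfactor C X) := factorModel.hasZeroObject

instance [IsAdditiveSubcategory C] : HasBinaryBiproducts (Subfactor C X) :=
  factorModel.hasBinaryBiproducts

instance {G C : ObjectProperty 𝒜} (h : G ≤ C) : (incl X h).Full where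
  map_surjective f := ⟨f, rfl⟩

instance {G C : ObjectProperty 𝒜} (h : G ≤ C) : (incl X h).Faithful where
  map_injective h := h

instance {G C : ObjectProperty 𝒜} (h : G ≤ C) : (incl X h).Additive where
  map_add := rfl

end Subfactor

/-- The model of `C / X` with the suspension given by fixed right triangles. -/
noncomputable def RightChoice.model {S : 𝒜 ⥤ 𝒜} [S.Additive] {C X : ObjectProperty 𝒜}
    [IsAdditiveSubcategory X] {R : Set (RightSeq S)} (D : RightChoice S C X R)
    (H : IsPartialRightTriangulated S C X R) : RightModel S C X R (Subfactor C X) where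
  toFactorModel := Subfactor.factorModel
  Ψ := D.susp H
  Y A := D.Y A.obj A.property
  i A := D.i A.obj A.property
  p A := D.p A.obj A.property
  q A := D.q A.obj A.property
  preenvelope A := D.preenvelope A.obj A.property
  mem A := D.mem A.obj A.property
  map_cls f σ κ h₁ h₂ h₃ := D.susp_map_mk H f κ ⟨σ, h₁, h₂, h₃⟩

lemma RightChoice.distinguished_eq {S : 𝒜 ⥤ 𝒜} [S.Additive] {C X : ObjectProperty 𝒜}
    [IsAdditiveSubcategory X] {R : Set (RightSeq S)} (D : RightChoice S C X R)
    (H : IsPartialRightTriangulated S C X R) : D.distinguished H = (D.model H).Δ := by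
  ext P
  constructor
  · rintro ⟨_, ⟨A, B, E, f, g, h, δ, ξ, h₁, h₂, h₃, h₄, h₅, rfl⟩, hi⟩
    exact ⟨A, B, E, f, g, h, δ, ξ, ⟨h₁, h₂, h₃, h₄, h₅⟩, hi⟩
  · rintro ⟨A, B, E, f, g, h, δ, ξ, ⟨h₁, h₂, h₃, h₄, h₅⟩, hi⟩
    exact ⟨_, ⟨A, B, E, f, g, h, δ, ξ, h₁, h₂, h₃, h₄, h₅, rfl⟩, hi⟩

theorem RightChoice.isRightTriangulated {S : 𝒜 ⥤ 𝒜} [S.Additive] {C X : ObjectProperty 𝒜}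
    [IsAdditiveSubcategory C] [IsAdditiveSubcategory X] {R : Set (RightSeq S)}
    (D : RightChoice S C X R) (H : IsPartialRightTriangulated S C X R) :
    IsRightTriangulated (D.susp H) (D.distinguished H) := by
  rw [D.distinguished_eq]
  exact (D.model H).isRightTriangulated H

/-- The model of the opposite category of `F / X` with the suspension given by fixed left
triangles. -/
noncomputable def LeftChoice.model {W : 𝒜 ⥤ 𝒜} [W.Additive] {F X : ObjectProperty 𝒜}
    [IsAdditiveSubcategory X] {L : Set (LeftSeq W)} (D : LeftChoice W F X L)
    (H : IsPartialLeftTriangulated W F X L) :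
    RightModel W.op F.op X.op (opSet L) (Subfactor F X)ᵒᵖ where
  toFactorModel := Subfactor.opFactorModel
  Ψ := (D.loop H).op
  Y A := Opposite.op (D.Y A.unop.obj A.unop.property)
  i A := (D.π A.unop.obj A.unop.property).op
  p A := (D.ι A.unop.obj A.unop.property).op
  q A := (D.ν A.unop.obj A.unop.property).op
  preenvelope A := ⟨(D.precover A.unop.obj A.unop.property).1,
    (D.precover A.unop.obj A.unop.property).2.op⟩
  mem A := D.mem A.unop.obj A.unop.property
  map_cls f σ κ h₁ h₂ h₃ := congr($(D.loop_map_mk H f.unop κ.unop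
    ⟨σ.unop, congr($(h₁.symm).unop), congr($(h₂.symm).unop), congr($(h₃.symm).unop)⟩).op)

lemma LeftChoice.opSet_distinguished_eq {W : 𝒜 ⥤ 𝒜} [W.Additive] {F X : ObjectProperty 𝒜}
    [IsAdditiveSubcategory X] {L : Set (LeftSeq W)} (D : LeftChoice W F X L)
    (H : IsPartialLeftTriangulated W F X L) :
    opSet (D.distinguished H) = (D.model H).Δ := by
  ext P
  constructor
  · rintro ⟨_, ⟨K, A, B, f, g, h, δ, ξ, h₁, h₂, h₃, h₄, h₅, rfl⟩, hi⟩
    exact ⟨.op B, .op A, .op K, h.op, g.op, f.op, δ.op, ξ.op, ⟨h₁, h₂.op, congr($(h₃).op),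
      congr($(h₄).op), congr($(h₅).op)⟩, (RightSeq.isomorphic_op _ _ hi).symm⟩
  · rintro ⟨B, A, K, h, g, f, δ, ξ, ⟨h₁, h₂, h₃, h₄, h₅⟩, hi⟩
    exact ⟨_, ⟨K.unop, A.unop, B.unop, f.unop, g.unop, h.unop, δ.unop, ξ.unop, h₁, h₂.unop,
      congr($(h₃).unop), congr($(h₄).unop), congr($(h₅).unop), rfl⟩,
      LeftSeq.isomorphic_of_op _ _ hi.symm⟩

theorem LeftChoice.isRightTriangulated_op {W : 𝒜 ⥤ 𝒜} [W.Additive] {F X : ObjectProperty 𝒜}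
    [IsAdditiveSubcategory F] [IsAdditiveSubcategory X] {L : Set (LeftSeq W)}
    (D : LeftChoice W F X L) (H : IsPartialLeftTriangulated W F X L) :
    IsRightTriangulated (D.loop H).op (opSet (D.distinguished H)) := by
  rw [D.opSet_distinguished_eq]
  exact (D.model H).isRightTriangulated H.op

/-! ### The reflection and the coreflection -/

namespace SpecialPreenveloping

variable {S : 𝒜 ⥤ 𝒜} {C X : ObjectProperty 𝒜} [IsAdditiveSubcategory X]
  {R : Set (RightSeq S)} {G : ObjectProperty 𝒜}

lemma unit_naturality (H : IsPartialRightTriangulated S C X R)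
    (E : SpecialPreenveloping S C X R G) {A B : Subfactor C X} (f : A ⟶ B) :
    f ≫ E.unit H B = E.unit H A ≫ (Subfactor.incl X E.le_C).map ((E.reflector H).map f) := by
  obtain ⟨f, rfl⟩ := Subfactor.cls_surjective f
  obtain ⟨f', hf'⟩ := E.exists_ext A.property B.property f
  rw [E.reflector_map_mk H f f' hf']
  exact congrArg Subfactor.cls hf'.symm

/-- Since `X ⊆ G`, the first half `a` of the factorization extends along `j` to some `t`. Then `f -
t ≫ b` kills `j`, so it factors through the cone, from which every morphism to `G` is zero modulo
`X`. -/
lemma factorsThroughObj_of_comp_j (H : IsPartialRightTriangulated S C X R)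
    (E : SpecialPreenveloping S C X R G) {A B : 𝒜} (hA : C A) (hB : G B) {f : E.obj A hA ⟶ B}
    (h : FactorsThroughObj X (E.j A hA ≫ f)) : FactorsThroughObj X f := by
  obtain ⟨Z, hZ, a, b, hab⟩ := h
  obtain ⟨t, ht⟩ := (E.preenvelope A hA).2 (E.X_le _ hZ) a
  obtain ⟨l, hl⟩ := ((H.isRightCSeq _ (E.mem A hA)).2.1).2 (f - t ≫ b) (by
    simp only [Preadditive.comp_sub]
    rw [reassoc_of% ht, hab, sub_self])
  have h₁ := (E.perp A hA hB l).comp_left (E.τ A hA)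
  have h₂ : FactorsThroughObj X (t ≫ b) := ⟨Z, hZ, _, _, rfl⟩
  have h₃ := (idealSubgroup X _ _).add_mem (mem_idealSubgroup.2 h₁) (mem_idealSubgroup.2 h₂)
  dsimp only at l hl
  rwa [hl, sub_add_cancel] at h₃

/-- Universality of `A ⟶ R A` in `C / X`: the preenvelope property gives existence, and the
vanishing of morphisms from the cone to `G` gives uniqueness. -/
lemma unit_bijective (H : IsPartialRightTriangulated S C X R)
    (E : SpecialPreenveloping S C X R G) (A : Subfactor C X) (B : Subfactor G X) :
    Function.Bijective (fun f : (E.reflector H).obj A ⟶ B =>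
      E.unit H A ≫ (Subfactor.incl X E.le_C).map f) := by
  constructor
  · intro f g hfg
    obtain ⟨f, rfl⟩ := Subfactor.cls_surjective f
    obtain ⟨g, rfl⟩ := Subfactor.cls_surjective g
    have h := (Subfactor.cls_eq_iff (A := A) (B := (Subfactor.incl X E.le_C).obj B)
      (E.j A.obj A.property ≫ f) (E.j A.obj A.property ≫ g)).1 hfg
    exact (Subfactor.cls_eq_iff _ _).2 (E.factorsThroughObj_of_comp_j H _ B.property
      ((congrArg (FactorsThroughObj X) (Preadditive.comp_sub (E.j _ _) f g)).mpr h))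
  · intro f
    obtain ⟨f, rfl⟩ := Subfactor.cls_surjective f
    obtain ⟨t, ht⟩ := (E.preenvelope A.obj A.property).2 B.property f
    exact ⟨Subfactor.cls (A := (E.reflector H).obj A) t, congrArg Subfactor.cls ht⟩

/-- The functor `R : C / X ⥤ G / X` is left adjoint to the inclusion. -/
noncomputable def adj (H : IsPartialRightTriangulated S C X R)
    (E : SpecialPreenveloping S C X R G) : E.reflector H ⊣ Subfactor.incl X E.le_C :=
  Adjunction.mkOfHomEquiv
    { homEquiv := fun A B => Equiv.ofBijective _ (E.unit_bijective H A B)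
      homEquiv_naturality_left_symm := fun {A' A B} f g => by
        rw [Equiv.symm_apply_eq]
        obtain ⟨g, rfl⟩ := (E.unit_bijective H A B).2 g
        have : (Equiv.ofBijective _ (E.unit_bijective H A B)).symm
            (E.unit H A ≫ (Subfactor.incl X E.le_C).map g) = g := by
          rw [Equiv.symm_apply_eq]; rfl
        dsimp only
        rw [this]
        simp only [Equiv.ofBijective_apply, Functor.map_comp]
        rw [← Category.assoc, E.unit_naturality, Category.assoc]
      homEquiv_naturality_right := fun f g => by
        simp }

lemma adj_homEquiv (H : IsPartialRightTriangulated S C X R)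
    (E : SpecialPreenveloping S C X R G) {A : Subfactor C X} {B : Subfactor G X}
    (f : (E.reflector H).obj A ⟶ B) :
    (E.adj H).homEquiv A B f = E.unit H A ≫ (Subfactor.incl X E.le_C).map f := by
  rw [adj, Adjunction.mkOfHomEquiv_homEquiv]
  rfl

lemma adj_unit (H : IsPartialRightTriangulated S C X R)
    (E : SpecialPreenveloping S C X R G) (A : Subfactor C X) :
    (E.adj H).unit.app A = E.unit H A := by
  rw [← Adjunction.homEquiv_id, adj_homEquiv]
  simp

variable [S.Additive]

lemma distinguishedG_eq (H : IsPartialRightTriangulated S C X R) (D : RightChoice S C X R)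
    (E : SpecialPreenveloping S C X R G) : E.distinguishedG H D =
      reflectedTriangles (E := Subfactor.incl X E.le_C) (R := E.reflector H)
        (D.distinguished H) (E.unitG H) := by
  ext P
  constructor
  · rintro ⟨_, ⟨A, B, K, f, g, h, hP, rfl⟩, hi⟩
    exact ⟨A, B, K, f, g, h, hP, hi⟩
  · rintro ⟨A, B, K, f, g, h, hP, hi⟩
    exact ⟨_, ⟨A, B, K, f, g, h, hP, rfl⟩, hi⟩

/-- The special preenvelopes make `G / X` reflective in the right triangulated category `C / X`, and
the stabilizing condition is `StabilizesTriangles` for this reflection. -/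
theorem isRightTriangulated [IsAdditiveSubcategory C] [IsAdditiveSubcategory G]
    (H : IsPartialRightTriangulated S C X R) (D : RightChoice S C X R)
    (E : SpecialPreenveloping S C X R G) (hst : E.IsStabilizing H D) :
    IsRightTriangulated (E.suspG H D) (E.distinguishedG H D) := by
  rw [distinguishedG_eq]
  refine reflectedTriangles_isRightTriangulated (E.adj H) (fun B => ?_)
    (D.isRightTriangulated H) ?_
  · rw [adj_unit]
    rfl
  · intro A B K M f g h g' h' h₁ h₂
    rw [adj_unit, adj_unit]
    exact hst f g h g' h' h₁ h₂

end SpecialPreenveloping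

namespace SpecialPrecovering

variable {W : 𝒜 ⥤ 𝒜} {F X : ObjectProperty 𝒜} [IsAdditiveSubcategory X]
  {L : Set (LeftSeq W)} {G : ObjectProperty 𝒜}

lemma counit_naturality (H : IsPartialLeftTriangulated W F X L)
    (E : SpecialPrecovering W F X L G) {A B : Subfactor F X} (f : A ⟶ B) :
    E.counit H A ≫ f = (Subfactor.incl X E.le_F).map ((E.coreflector H).map f) ≫
      E.counit H B := by
  obtain ⟨f, rfl⟩ := Subfactor.cls_surjective f
  obtain ⟨f', hf'⟩ := E.exists_lift A.property B.property f
  rw [E.coreflector_map_mk H f f' hf']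
  exact congrArg Subfactor.cls hf'.symm

lemma factorsThroughObj_of_comp_r (H : IsPartialLeftTriangulated W F X L)
    (E : SpecialPrecovering W F X L G) {A B : 𝒜} (hB : F B) (hA : G A) {f : A ⟶ E.obj B hB}
    (h : FactorsThroughObj X (f ≫ E.r B hB)) : FactorsThroughObj X f := by
  obtain ⟨Z, hZ, a, b, hab⟩ := h
  obtain ⟨t, ht⟩ := (E.precover B hB).2 (E.X_le _ hZ) b
  obtain ⟨l, hl⟩ := ((H.isLeftFSeq _ (E.mem B hB)).2.1).2 (f - a ≫ t) (by
    simp only [Preadditive.sub_comp, Category.assoc]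
    rw [ht, hab, sub_self])
  have h₁ := (E.perp B hB hA l).comp_right (E.ω B hB)
  have h₂ : FactorsThroughObj X (a ≫ t) := ⟨Z, hZ, _, _, rfl⟩
  have h₃ := (idealSubgroup X _ _).add_mem (mem_idealSubgroup.2 h₁) (mem_idealSubgroup.2 h₂)
  dsimp only at l hl
  rwa [hl, sub_add_cancel] at h₃

lemma counit_bijective (H : IsPartialLeftTriangulated W F X L)
    (E : SpecialPrecovering W F X L G) (A : Subfactor G X) (B : Subfactor F X) :
    Function.Bijective (fun f : A ⟶ (E.coreflector H).obj B =>
      (Subfactor.incl X E.le_F).map f ≫ E.counit H B) := by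
  constructor
  · intro f g hfg
    obtain ⟨f, rfl⟩ := Subfactor.cls_surjective f
    obtain ⟨g, rfl⟩ := Subfactor.cls_surjective g
    have h := (Subfactor.cls_eq_iff (A := (Subfactor.incl X E.le_F).obj A) (B := B)
      (f ≫ E.r B.obj B.property) (g ≫ E.r B.obj B.property)).1 hfg
    exact (Subfactor.cls_eq_iff _ _).2 (E.factorsThroughObj_of_comp_r H _ A.property
      ((congrArg (FactorsThroughObj X) (Preadditive.sub_comp f g (E.r _ _))).mpr h))
  · intro f
    obtain ⟨f, rfl⟩ := Subfactor.cls_surjective f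
    obtain ⟨t, ht⟩ := (E.precover B.obj B.property).2 A.property f
    exact ⟨Subfactor.cls (B := (E.coreflector H).obj B) t, congrArg Subfactor.cls ht⟩

/-- The functor `Q : F / X ⥤ G / X` is right adjoint to the inclusion. -/
noncomputable def adj (H : IsPartialLeftTriangulated W F X L)
    (E : SpecialPrecovering W F X L G) : Subfactor.incl X E.le_F ⊣ E.coreflector H :=
  Adjunction.mkOfHomEquiv
    { homEquiv := fun A B => (Equiv.ofBijective _ (E.counit_bijective H A B)).symm
      homEquiv_naturality_left_symm := fun f g => by
        simp
      homEquiv_naturality_right := fun {A B B'} f g => by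
        rw [Equiv.symm_apply_eq]
        obtain ⟨f, rfl⟩ := (E.counit_bijective H A B).2 f
        have : (Equiv.ofBijective _ (E.counit_bijective H A B)).symm
            ((Subfactor.incl X E.le_F).map f ≫ E.counit H B) = f := by
          rw [Equiv.symm_apply_eq]; rfl
        dsimp only
        rw [this]
        simp only [Equiv.ofBijective_apply, Functor.map_comp]
        rw [Category.assoc, E.counit_naturality, Category.assoc] }

lemma adj_homEquiv_symm (H : IsPartialLeftTriangulated W F X L)
    (E : SpecialPrecovering W F X L G) {A : Subfactor G X} {B : Subfactor F X}
    (f : A ⟶ (E.coreflector H).obj B) :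
    ((E.adj H).homEquiv A B).symm f = (Subfactor.incl X E.le_F).map f ≫ E.counit H B := by
  rw [adj, Adjunction.mkOfHomEquiv_homEquiv]
  rfl

lemma adj_counit (H : IsPartialLeftTriangulated W F X L)
    (E : SpecialPrecovering W F X L G) (A : Subfactor F X) :
    (E.adj H).counit.app A = E.counit H A := by
  rw [← Adjunction.homEquiv_symm_id, adj_homEquiv_symm]
  simp

variable [W.Additive]

lemma opSet_distinguishedG_eq (H : IsPartialLeftTriangulated W F X L) (D : LeftChoice W F X L)
    (E : SpecialPrecovering W F X L G) : opSet (E.distinguishedG H D) =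
      reflectedTriangles (Ψ := (D.loop H).op) (E := (Subfactor.incl X E.le_F).op)
        (R := (E.coreflector H).op) (opSet (D.distinguished H))
        (fun B => (E.counitG H B.unop).op) := by
  ext P
  constructor
  · rintro ⟨_, ⟨A, B, K, f, g, h, hP, rfl⟩, hi⟩
    exact ⟨.op B, .op A, .op K, h.op, g.op, f.op, hP, (RightSeq.isomorphic_op _ _ hi).symm⟩
  · rintro ⟨B, A, K, h, g, f, hP, hi⟩
    exact ⟨_, ⟨A.unop, B.unop, K.unop, f.unop, g.unop, h.unop, hP, rfl⟩,
      LeftSeq.isomorphic_of_op (W := E.loopG H D) _ P hi.symm⟩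

instance [IsAdditiveSubcategory F] [IsAdditiveSubcategory G]
    (H : IsPartialLeftTriangulated W F X L) (E : SpecialPrecovering W F X L G) :
    (E.coreflector H).Additive :=
  (E.adj H).right_adjoint_additive

instance (H : IsPartialLeftTriangulated W F X L) (D : LeftChoice W F X L) :
    (D.loop H).Additive where
  map_add {A B f g} := by
    have : (D.loop H).op.Additive := (D.model H).additive H.op
    exact congr($((D.loop H).op.map_add (f := f.op) (g := g.op)).unop)

/-- In the opposite category the coreflection becomes a reflection, with adjunction `(E.adj H).op`,
so the theorem on reflective subcategories applies. -/
theorem isLeftTriangulated [IsAdditiveSubcategory F] [IsAdditiveSubcategory G]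
    (H : IsPartialLeftTriangulated W F X L) (D : LeftChoice W F X L)
    (E : SpecialPrecovering W F X L G) (hst : E.IsStabilizing H D) :
    IsLeftTriangulated (E.loopG H D) (E.distinguishedG H D) := by
  have : (E.loopG H D).Additive := by unfold loopG; infer_instance
  refine IsRightTriangulated.unop ?_
  rw [opSet_distinguishedG_eq]
  refine reflectedTriangles_isRightTriangulated (E.adj H).op (fun B => ?_)
    (D.isRightTriangulated_op H) ?_
  · exact congr($(E.adj_counit H _).op).symm
  · intro A B K M f g h g' h' h₁ h₂
    obtain ⟨t, e₁, e₂, e₃⟩ := hst h.unop g.unop f.unop h'.unop g'.unop h₁ h₂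
    refine ⟨t.op, ?_, ?_, ?_⟩
    · refine congr($(e₁.symm).op).trans ?_
      rw [op_comp, ← adj_counit]
      rfl
    · refine Eq.trans ?_ congr($(e₂.symm).op)
      rw [op_comp, ← adj_counit]
      rfl
    · exact inferInstanceAs (IsIso ((E.coreflector H).map t).op)

end SpecialPrecovering

end

/-! ### Gluing the right and left structures: conditions (c), (d), (e) and the filling construction
-/

section

variable {𝒜 : Type u} [Category.{v} 𝒜] [Preadditive 𝒜] [HasZeroObject 𝒜]
  [HasBinaryBiproducts 𝒜]

section Ideal

variable {X : ObjectProperty 𝒜} [IsAdditiveSubcategory X] {A B : 𝒜} {f g : A ⟶ B}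

lemma FactorsThroughObj.add (hf : FactorsThroughObj X f) (hg : FactorsThroughObj X g) :
    FactorsThroughObj X (f + g) :=
  (idealSubgroup X A B).add_mem hf hg

lemma FactorsThroughObj.sub (hf : FactorsThroughObj X f) (hg : FactorsThroughObj X g) :
    FactorsThroughObj X (f - g) :=
  (idealSubgroup X A B).sub_mem hf hg

lemma FactorsThroughObj.neg (hf : FactorsThroughObj X f) : FactorsThroughObj X (-f) :=
  (idealSubgroup X A B).neg_mem hf

end Ideal

/-- If `γ` vanishes on the third term of a standard triangle on `f : A ⟶ B`, then it extends to
the suspension of `B`, up to morphisms factoring through `X`. -/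
lemma RightModel.IsStd.exists_ext {S : 𝒜 ⥤ 𝒜} [S.Additive] {C X : ObjectProperty 𝒜}
    [IsAdditiveSubcategory C] [IsAdditiveSubcategory X] {R : Set (RightSeq S)} {T : Type u}
    [Category.{v} T] [Preadditive T] {M : RightModel S C X R T}
    (H : IsPartialRightTriangulated S C X R) {A B E Z : T} {f : M.o A ⟶ M.o B}
    {g : M.o B ⟶ M.o E} {h : M.o E ⟶ S.obj (M.o A)} {δ : M.o B ⟶ M.Y A}
    {ξ : M.o E ⟶ M.o (M.Ψ.obj A)} (hs : M.IsStd f g h δ ξ) {γ : M.o (M.Ψ.obj A) ⟶ M.o Z}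
    (hγ : FactorsThroughObj X (ξ ≫ γ)) :
    ∃ (t : M.o (M.Ψ.obj B) ⟶ M.o Z) (σ : M.Y A ⟶ M.Y B)
      (κ : M.o (M.Ψ.obj A) ⟶ M.o (M.Ψ.obj B)), M.i A ≫ σ = f ≫ M.i B ∧
      M.p A ≫ κ = σ ≫ M.p B ∧ M.q A ≫ S.map f = κ ≫ M.q B ∧
      FactorsThroughObj X (κ ≫ t - γ) := by
  have := M.hasZeroObject
  -- In the factor category `γ` kills `ξ`. In the rotated triangle the next morphism is `-Ψ f`, so
  -- `γ` factors through it.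
  obtain ⟨t, ht⟩ := (M.isPreRight H).exists_desc' (M.rt2 H _ _ _ hs.mem_Δ) (M.cls γ) (by
    rw [← M.cls_comp]; exact (M.cls_eq_zero_iff _).2 hγ)
  obtain ⟨t, rfl⟩ := M.cls_surjective t
  obtain ⟨σ, κ, k₁, k₂, k₃, k₄⟩ := M.exists_map H f
  -- The sign of the rotated triangle is moved into the extension.
  refine ⟨-t, σ, κ, k₁, k₂, k₃, ?_⟩
  dsimp only at t ht
  rw [k₄, Preadditive.neg_comp, ← M.cls_comp] at ht
  rw [Preadditive.comp_neg]
  exact (M.cls_eq_iff _ _).1 ((M.cls_neg _).trans ht)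

/-- If `α : A ⟶ U_N` vanishes in the third term of a standard left triangle on `w : M ⟶ N`, then
it lifts to the loop object of `M`, up to morphisms factoring through `X`. -/
lemma LeftChoice.exists_lift {W : 𝒜 ⥤ 𝒜} [W.Additive] {F X : ObjectProperty 𝒜}
    [IsAdditiveSubcategory F] [IsAdditiveSubcategory X] {L : Set (LeftSeq W)}
    (D : LeftChoice W F X L) (H : IsPartialLeftTriangulated W F X L) {A K M N : 𝒜} (hA : F A)
    (hM : F M) (hN : F N) {u : W.obj N ⟶ K} {v : K ⟶ M} {w : M ⟶ N}
    (hQ : LeftSeq.mk u v w ∈ L) (hw : IsRelEpic X w) {δ : D.Y N hN ⟶ M} {ξ : D.U N hN ⟶ K}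
    (hδ : δ ≫ w = D.π N hN) (comm : ξ ≫ v = D.ι N hN ≫ δ) (hξ : u = D.ν N hN ≫ ξ)
    (α : A ⟶ D.U N hN) (hα : FactorsThroughObj X (α ≫ ξ)) :
    ∃ (α' : A ⟶ D.U M hM) (κ : D.U M hM ⟶ D.U N hN), D.IsFiller hM hN w κ ∧
      FactorsThroughObj X (α' ≫ κ - α) := by
  have hs : (D.model H).IsStd (A := .op ⟨N, hN⟩) (B := .op ⟨M, hM⟩)
      (E := .op ⟨K, (H.isLeftFSeq _ hQ).1⟩) w.op v.op u.op δ.op ξ.op :=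
    ⟨hQ, hw.op, congr($(hδ).op), congr($(comm).op), congr($(hξ).op)⟩
  obtain ⟨t, σ, κ, k₁, k₂, k₃, ht⟩ := hs.exists_ext H.op (Z := (Opposite.op ⟨A, hA⟩ : (Subfactor F X)ᵒᵖ)) (γ := α.op) hα.op
  exact ⟨t.unop, κ.unop, ⟨σ.unop, congr($(k₁.symm).unop), congr($(k₂.symm).unop),
    congr($(k₃.symm).unop)⟩, ht.unop⟩

/-- If `γ : U^A ⟶ Z` vanishes on the third term of a standard right triangle on `f : A ⟶ B`,
then it extends to the suspension of `B`, up to morphisms factoring through `X`. -/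
lemma RightChoice.exists_ext {S : 𝒜 ⥤ 𝒜} [S.Additive] {C X : ObjectProperty 𝒜}
    [IsAdditiveSubcategory C] [IsAdditiveSubcategory X] {R : Set (RightSeq S)}
    (D : RightChoice S C X R) (H : IsPartialRightTriangulated S C X R) {A B K Z : 𝒜} (hZ : C Z)
    (hA : C A) (hB : C B) {f : A ⟶ B} {g : B ⟶ K} {h : K ⟶ S.obj A}
    (hP : RightSeq.mk f g h ∈ R) (hf : IsRelMonic X f) {δ : B ⟶ D.Y A hA} {ξ : K ⟶ D.U A hA}
    (hδ : f ≫ δ = D.i A hA) (comm : g ≫ ξ = δ ≫ D.p A hA) (hξ : h = ξ ≫ D.q A hA)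
    (γ : D.U A hA ⟶ Z) (hγ : FactorsThroughObj X (ξ ≫ γ)) :
    ∃ (γ' : D.U B hB ⟶ Z) (κ : D.U A hA ⟶ D.U B hB), D.IsFiller hA hB f κ ∧
      FactorsThroughObj X (κ ≫ γ' - γ) := by
  have hs : (D.model H).IsStd (A := ⟨A, hA⟩) (B := ⟨B, hB⟩) (E := ⟨K, (H.isRightCSeq _ hP).1⟩)
      f g h δ ξ := ⟨hP, hf, hδ, comm, hξ⟩
  obtain ⟨t, σ, κ, k₁, k₂, k₃, ht⟩ := hs.exists_ext H (Z := (⟨Z, hZ⟩ : Subfactor C X)) (γ := γ) hγ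
  exact ⟨t, κ, ⟨σ, k₁, k₂, k₃⟩, ht⟩

/-- Conditions (c)(i) and (d) state compatibility on the `W` side, (c)(ii) and (e) on the `S` side.
Transposing along the adjunction, which respects signs because `S` is additive, brings all of them
to the `S` side. -/
lemma comp_eq_neg_homEquiv_iff {W S : 𝒜 ⥤ 𝒜} [S.Additive] (adj : W ⊣ S) {A K E N : 𝒜}
    (h : E ⟶ S.obj A) (u : W.obj N ⟶ K) (α : A ⟶ K) (γ : E ⟶ N) :
    h ≫ S.map α = -(γ ≫ adj.homEquiv N K u) ↔
      W.map γ ≫ u = -((adj.homEquiv E A).symm h ≫ α) := by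
  rw [← (adj.homEquiv E K).injective.eq_iff, adj.homEquiv_naturality_left]
  have : adj.homEquiv E K (-((adj.homEquiv E A).symm h ≫ α)) = -(h ≫ S.map α) := by
    rw [adj.homEquiv_unit, S.map_neg, Preadditive.comp_neg, ← adj.homEquiv_unit,
      adj.homEquiv_naturality_right, Equiv.apply_symm_apply]
  rw [this, eq_comm, neg_eq_iff_eq_neg]

/-- The data of a pre-partial triangulated category entering the construction of the adjunction
and the first filling condition; it is available for both the category and its opposite. -/
structure Gluing (W S : 𝒜 ⥤ 𝒜) (L : Set (LeftSeq W)) (R : Set (RightSeq S))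
    (F C X : ObjectProperty 𝒜) where
  right : IsPartialRightTriangulated S C X R
  rightChoice : RightChoice S C X R
  leftChoice : LeftChoice W F X L
  adj : W ⊣ S
  c_i : ∀ P ∈ R, IsRelMonic X P.f → ∀ Q ∈ L, IsRelEpic X Q.h →
    ∀ (β : P.B ⟶ Q.B) (γ : P.C ⟶ Q.C), P.g ≫ γ = β ≫ Q.h →
    ∃ α : P.A ⟶ Q.A, α ≫ Q.g = P.f ≫ β ∧
      P.h ≫ S.map α = -(γ ≫ adj.homEquiv Q.C Q.A Q.f)
  c_ii : ∀ P ∈ R, IsRelMonic X P.f → ∀ Q ∈ L, IsRelEpic X Q.h →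
    ∀ (β : P.B ⟶ Q.B) (α : P.A ⟶ Q.A), α ≫ Q.g = P.f ≫ β →
    ∃ γ : P.C ⟶ Q.C, P.g ≫ γ = β ≫ Q.h ∧
      P.h ≫ S.map α = -(γ ≫ adj.homEquiv Q.C Q.A Q.f)
  d : ∀ (A : 𝒜) (hC : C A), F A → ∀ Q ∈ L, IsRelEpic X Q.h →
    ∀ (α : A ⟶ Q.A) (β : rightChoice.Y A hC ⟶ Q.B) (γ : rightChoice.U A hC ⟶ Q.C),
    α ≫ Q.g = rightChoice.i A hC ≫ β → rightChoice.p A hC ≫ γ = β ≫ Q.h →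
    rightChoice.q A hC ≫ S.map α = -(γ ≫ adj.homEquiv Q.C Q.A Q.f) →
    (∃ t : rightChoice.U A hC ⟶ Q.B, t ≫ Q.h = γ) →
    ∃ t : rightChoice.Y A hC ⟶ Q.A, rightChoice.i A hC ≫ t = α
  e : ∀ (D : 𝒜) (hF : F D), C D → ∀ P ∈ R, IsRelMonic X P.f →
    ∀ (α : P.A ⟶ leftChoice.U D hF) (β : P.B ⟶ leftChoice.Y D hF) (γ : P.C ⟶ D),
    α ≫ leftChoice.ι D hF = P.f ≫ β → P.g ≫ γ = β ≫ leftChoice.π D hF →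
    P.h ≫ S.map α = -(γ ≫ adj.homEquiv D (leftChoice.U D hF) (leftChoice.ν D hF)) →
    (∃ t : P.B ⟶ leftChoice.U D hF, P.f ≫ t = α) →
    ∃ t : P.C ⟶ leftChoice.Y D hF, t ≫ leftChoice.π D hF = γ
  -- Besides (c), (d) and (e), this is the only consequence of the left structure that the filling
  -- argument uses. It is recorded as a field so that the same argument also runs in the opposite
  -- category.
  exists_lift : ∀ {A K M N : 𝒜} (_ : F A) (hM : F M) (hN : F N) {u : W.obj N ⟶ K} {v : K ⟶ M}
    {w : M ⟶ N}, LeftSeq.mk u v w ∈ L → IsRelEpic X w →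
    ∀ {δ : leftChoice.Y N hN ⟶ M} {ξ : leftChoice.U N hN ⟶ K},
    δ ≫ w = leftChoice.π N hN → ξ ≫ v = leftChoice.ι N hN ≫ δ → u = leftChoice.ν N hN ≫ ξ →
    ∀ (α : A ⟶ leftChoice.U N hN), FactorsThroughObj X (α ≫ ξ) →
    ∃ (α' : A ⟶ leftChoice.U M hM) (κ : leftChoice.U M hM ⟶ leftChoice.U N hN),
      leftChoice.IsFiller hM hN w κ ∧ FactorsThroughObj X (α' ≫ κ - α)

namespace Gluing

variable {W S : 𝒜 ⥤ 𝒜} [S.Additive] {L : Set (LeftSeq W)}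
  {R : Set (RightSeq S)} {F C X : ObjectProperty 𝒜}

/-- `α : A ⟶ U_N` and `γ : U^A ⟶ N` are the outer components of a morphism from the fixed right
triangle of `A` to the fixed left triangle of `N`. -/
def Rel (K : Gluing W S L R F C X) {A N : 𝒜} (hA : C A) (hN : F N)
    (α : A ⟶ K.leftChoice.U N hN) (γ : K.rightChoice.U A hA ⟶ N) : Prop :=
  ∃ β : K.rightChoice.Y A hA ⟶ K.leftChoice.Y N hN,
    α ≫ K.leftChoice.ι N hN = K.rightChoice.i A hA ≫ β ∧
    K.rightChoice.p A hA ≫ γ = β ≫ K.leftChoice.π N hN ∧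
    K.rightChoice.q A hA ≫ S.map α =
      -(γ ≫ K.adj.homEquiv N (K.leftChoice.U N hN) (K.leftChoice.ν N hN))

variable (K : Gluing W S L R F C X) {A N : 𝒜} {hA : C A} {hN : F N}

variable {K} in
lemma Rel.add {α α' γ γ'} (h : K.Rel hA hN α γ) (h' : K.Rel hA hN α' γ') :
    K.Rel hA hN (α + α') (γ + γ') := by
  obtain ⟨β, h₁, h₂, h₃⟩ := h
  obtain ⟨β', h₁', h₂', h₃'⟩ := h'
  refine ⟨β + β', by simp [h₁, h₁'], by simp [h₂, h₂'], ?_⟩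
  rw [S.map_add, Preadditive.comp_add, h₃, h₃', Preadditive.add_comp, neg_add]

variable {K} in
lemma Rel.neg {α γ} (h : K.Rel hA hN α γ) : K.Rel hA hN (-α) (-γ) := by
  obtain ⟨β, h₁, h₂, h₃⟩ := h
  exact ⟨-β, by simp [h₁], by simp [h₂], by rw [S.map_neg, Preadditive.comp_neg, h₃]; simp⟩

variable {K} in
lemma Rel.sub {α α' γ γ'} (h : K.Rel hA hN α γ) (h' : K.Rel hA hN α' γ') :
    K.Rel hA hN (α - α') (γ - γ') := by
  rw [sub_eq_add_neg, sub_eq_add_neg]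
  exact h.add h'.neg

/-- The middle component comes from the precover of `N`, since the middle term of the right triangle
lies in `X`; then (c)(i) gives `α`. The companion `exists_rel_right` uses the preenvelope of `A` and
(c)(ii). -/
lemma exists_rel_left (hA : C A) (hN : F N) (γ : K.rightChoice.U A hA ⟶ N) :
    ∃ α, K.Rel hA hN α γ := by
  obtain ⟨β, hβ⟩ := (K.leftChoice.precover N hN).2 (K.rightChoice.preenvelope A hA).1
    (K.rightChoice.p A hA ≫ γ)
  obtain ⟨α, h₁, h₂⟩ := K.c_i _ (K.rightChoice.mem A hA) (K.rightChoice.preenvelope A hA).2 _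
    (K.leftChoice.mem N hN) (K.leftChoice.precover N hN).2 β γ hβ.symm
  exact ⟨α, β, h₁, hβ.symm, h₂⟩

lemma exists_rel_right (hA : C A) (hN : F N) (α : A ⟶ K.leftChoice.U N hN) :
    ∃ γ, K.Rel hA hN α γ := by
  obtain ⟨β, hβ⟩ := (K.rightChoice.preenvelope A hA).2 (K.leftChoice.precover N hN).1
    (α ≫ K.leftChoice.ι N hN)
  obtain ⟨γ, h₁, h₂⟩ := K.c_ii _ (K.rightChoice.mem A hA) (K.rightChoice.preenvelope A hA).2 _
    (K.leftChoice.mem N hN) (K.leftChoice.precover N hN).2 β α hβ.symm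
  exact ⟨γ, β, hβ.symm, h₁, h₂⟩

variable {K} in
-- If `α` factors through `X`, it extends along the preenvelope of `A`, and (e) makes `γ` factor
-- through the precover of `N`. Condition (d) gives the converse `factors_left`.
lemma Rel.factors_right {α γ} (h : K.Rel hA hN α γ) (hN' : C N)
    (hα : FactorsThroughObj X α) : FactorsThroughObj X γ := by
  obtain ⟨β, h₁, h₂, h₃⟩ := h
  obtain ⟨Y, hY, a, b, rfl⟩ := hα
  obtain ⟨t, ht⟩ := (K.rightChoice.preenvelope A hA).2 hY a
  obtain ⟨s, hs⟩ := K.e N hN hN' _ (K.rightChoice.mem A hA)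
    (K.rightChoice.preenvelope A hA).2 _ β γ h₁ h₂ h₃ ⟨t ≫ b, by simp [reassoc_of% ht]⟩
  exact ⟨_, (K.leftChoice.precover N hN).1, _, _, hs⟩

variable {K} in
lemma Rel.factors_left {α γ} (h : K.Rel hA hN α γ) (hA' : F A)
    (hγ : FactorsThroughObj X γ) : FactorsThroughObj X α := by
  obtain ⟨β, h₁, h₂, h₃⟩ := h
  obtain ⟨Y, hY, a, b, rfl⟩ := hγ
  obtain ⟨t, ht⟩ := (K.leftChoice.precover N hN).2 hY b
  obtain ⟨s, hs⟩ := K.d A hA hA' _ (K.leftChoice.mem N hN) (K.leftChoice.precover N hN).2 α β _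
    h₁ h₂ h₃ ⟨a ≫ t, by simp [ht]⟩
  exact ⟨_, (K.rightChoice.preenvelope A hA).1, _, _, hs⟩

variable {K} in
lemma Rel.comp_filler {α γ} (h : K.Rel hA hN α γ) {M : 𝒜} {hM : F M} {w : N ⟶ M}
    {κ : K.leftChoice.U N hN ⟶ K.leftChoice.U M hM} (hκ : K.leftChoice.IsFiller hN hM w κ) :
    K.Rel hA hM (α ≫ κ) (γ ≫ w) := by
  obtain ⟨β, h₁, h₂, h₃⟩ := h
  obtain ⟨σ, k₁, k₂, k₃⟩ := hκ
  refine ⟨β ≫ σ, ?_, ?_, ?_⟩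
  · rw [Category.assoc, ← k₂, reassoc_of% h₁]
  · rw [reassoc_of% h₂, k₁, Category.assoc]
  · rw [S.map_comp, reassoc_of% h₃, Preadditive.neg_comp, Category.assoc, Category.assoc,
      ← K.adj.homEquiv_naturality_right, k₃, K.adj.homEquiv_naturality_left]

variable {K} in
lemma Rel.filler_comp {α γ} (h : K.Rel hA hN α γ) {B : 𝒜} {hB : C B} {f : B ⟶ A}
    {κ : K.rightChoice.U B hB ⟶ K.rightChoice.U A hA}
    (hκ : K.rightChoice.IsFiller hB hA f κ) : K.Rel hB hN (f ≫ α) (κ ≫ γ) := by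
  obtain ⟨β, h₁, h₂, h₃⟩ := h
  obtain ⟨σ, k₁, k₂, k₃⟩ := hκ
  refine ⟨σ ≫ β, ?_, ?_, ?_⟩
  · rw [Category.assoc, h₁, reassoc_of% k₁]
  · rw [reassoc_of% k₂, h₂, Category.assoc]
  · rw [S.map_comp, reassoc_of% k₃, h₃, Preadditive.comp_neg, Category.assoc]

variable [IsAdditiveSubcategory C] [IsAdditiveSubcategory X]

/-- The first filling condition relating right and left triangles. -/
theorem exists_filler {B E Z M : 𝒜} (hA : C A) (hA' : F A) (hB : C B) {f : A ⟶ B} {g : B ⟶ E}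
    {h : E ⟶ S.obj A} (hP : RightSeq.mk f g h ∈ R) (hf : IsRelMonic X f)
    {δ : B ⟶ K.rightChoice.Y A hA} {ξ : E ⟶ K.rightChoice.U A hA}
    (hδ : f ≫ δ = K.rightChoice.i A hA) (comm : g ≫ ξ = δ ≫ K.rightChoice.p A hA)
    (hξ : h = ξ ≫ K.rightChoice.q A hA) (hN : F N) (hN' : C N) (hM : F M)
    {u : W.obj N ⟶ Z} {v : Z ⟶ M} {w : M ⟶ N} (hQ : LeftSeq.mk u v w ∈ L) (hw : IsRelEpic X w)
    {δ' : K.leftChoice.Y N hN ⟶ M} {ξ' : K.leftChoice.U N hN ⟶ Z}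
    (hδ' : δ' ≫ w = K.leftChoice.π N hN) (comm' : ξ' ≫ v = K.leftChoice.ι N hN ≫ δ')
    (hξ' : u = K.leftChoice.ν N hN ≫ ξ') {α : A ⟶ K.leftChoice.U N hN} {β : B ⟶ Z}
    (hβ : FactorsThroughObj X (f ≫ β - α ≫ ξ')) {γ : K.rightChoice.U A hA ⟶ N}
    (hγ : K.Rel hA hN α γ) :
    ∃ γ' : E ⟶ M, FactorsThroughObj X (g ≫ γ' - β ≫ v) ∧
      FactorsThroughObj X (γ' ≫ w + ξ ≫ γ) := by
  -- As `f` is `X`-monic, `β` can be changed within its class to `β₀`, so that the square commutes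
  -- strictly.
  obtain ⟨V, hV, a₀, b₀, hab⟩ := hβ
  obtain ⟨t₀, ht₀⟩ := hf hV a₀
  obtain ⟨β₀, hβ₀⟩ : ∃ β₀, β₀ = β - t₀ ≫ b₀ := ⟨_, rfl⟩
  have hfβ : f ≫ β₀ = α ≫ ξ' := by
    rw [hβ₀, Preadditive.comp_sub, reassoc_of% ht₀, hab]; abel
  obtain ⟨b, hb₁, hb₂, hb₃⟩ := id hγ
  -- First candidate for `γ'`: up to the term `δ ≫ b ≫ δ'`, which factors through `X`, it already
  -- satisfies the first requirement. Its composite with `w` is still uncontrolled.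
  obtain ⟨γ₁, hγ₁⟩ := K.right.exists_desc hP (β₀ ≫ v - δ ≫ b ≫ δ') (by
    rw [Preadditive.comp_sub, reassoc_of% hfβ, comm', reassoc_of% hδ, reassoc_of% hb₁, sub_self])
  obtain ⟨N₀, a, c, M₀, k, j, r, s, hN₀, hM₀, e₁, e₂, e₃, e₄, e₅⟩ :=
    K.right.rotation hA hB (K.rightChoice.mem A hA) (K.rightChoice.preenvelope A hA)
      (K.rightChoice.mem B hB) (K.rightChoice.preenvelope B hB) hP hf δ hδ
  have hmon : IsRelMonic X (biprod.lift (biprod.lift δ (K.rightChoice.i B hB)) g) :=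
    IsRelMonic.of_comp (g := biprod.fst ≫ biprod.snd)
      (by simpa using (K.rightChoice.preenvelope B hB).2)
  -- Condition (c)(ii) is applied to the rotated triangle, which starts at `B`, with first component
  -- `β₀` and with `γ₁` acting on the summand `E`. The result gives `γ₁ ≫ w = -(r ≫ s.hom ≫ γ₂)`.
  obtain ⟨γ₂, i₁, i₂⟩ := K.c_ii _ hM₀ hmon _ hQ hw
    (biprod.desc (biprod.desc (b ≫ δ') 0) γ₁) β₀ (by simp [biprod.lift_desc, hγ₁])
  dsimp only at γ₂ i₁ i₂
  obtain ⟨y, hy⟩ := (K.rightChoice.preenvelope A hA).2 (K.rightChoice.preenvelope B hB).1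
    (f ≫ K.rightChoice.i B hB)
  obtain ⟨ζ, z₁, z₂⟩ := K.right.prt3 _ (K.rightChoice.mem A hA) _ hN₀ (𝟙 A)
    (biprod.lift (𝟙 _) y) (by apply biprod.hom_ext <;> simp [hy])
  dsimp only at ζ z₁ z₂
  rw [S.map_id, Category.comp_id] at z₂
  -- `ζ` compares the fixed triangle of `A` with that of `N₀`; modulo `X` the morphism `r` is `ξ`
  -- followed by `ζ`.
  have hrζ : FactorsThroughObj X (ξ ≫ ζ - r) := by
    refine K.right.filler_sub (α := 𝟙 A) (β := δ ≫ biprod.lift (𝟙 _) y)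
      (β' := biprod.lift δ (K.rightChoice.i B hB)) hP hN₀ (IsAdditiveSubcategory.biprod
      (K.rightChoice.preenvelope A hA).1 (K.rightChoice.preenvelope B hB).1) ?_ ?_ ?_ ?_ ?_ ?_
    · apply biprod.hom_ext <;> simp [hy, reassoc_of% hδ]
    · simp [reassoc_of% comm, z₁]
    · simp [← z₂, hξ]
    · apply biprod.hom_ext <;> simp [hδ]
    · exact e₁
    · simp [e₂]
  -- The defect: modulo `X`, `γ₁ ≫ w + ξ ≫ γ` equals `-(ξ ≫ γ₃)`. It remains to write `γ₃`, modulo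
  -- `X`, as a morphism to `M` followed by `w`.
  obtain ⟨γ₃, hγ₃⟩ : ∃ γ₃, γ₃ = ζ ≫ s.hom ≫ γ₂ - γ := ⟨_, rfl⟩
  have hp : K.rightChoice.p A hA ≫ γ₃ = 0 := by
    rw [hγ₃, Preadditive.comp_sub, reassoc_of% z₁, ← reassoc_of% e₃, i₁, hb₂]
    simp [biprod.lift_desc_assoc, hδ']
  have hu : γ₃ ≫ K.adj.homEquiv N Z u = 0 := by
    have w₁ : s.hom ≫ γ₂ ≫ K.adj.homEquiv N Z u = -(c ≫ S.map (f ≫ β₀)) := by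
      rw [S.map_comp, ← reassoc_of% e₅, i₂]; simp
    rw [hγ₃, Preadditive.sub_comp, Category.assoc, Category.assoc, w₁, hfβ, hξ',
      K.adj.homEquiv_naturality_right, ← Category.assoc γ, ← neg_eq_iff_eq_neg.2 hb₃,
      Preadditive.comp_neg, ← reassoc_of% z₂, S.map_comp]
    simp
  -- A partner of `γ₃` is chosen over the middle component `0`, which is possible because `γ₃` kills
  -- the second morphism of the fixed triangle.
  obtain ⟨α₄, hα₄, hα₄'⟩ := K.c_i _ (K.rightChoice.mem A hA) (K.rightChoice.preenvelope A hA).2 _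
    (K.leftChoice.mem N hN) (K.leftChoice.precover N hN).2 0 γ₃ (by simp [hp])
  dsimp only at α₄ hα₄ hα₄'
  have hrel : K.Rel hA hN α₄ γ₃ := ⟨0, hα₄, by simp [hp], hα₄'⟩
  -- Since `γ₃` kills the transpose of `u`, the triple `(α₄ ≫ ξ', 0, 0)` is compatible. Condition
  -- (d), with third component `0`, shows that `α₄ ≫ ξ'` factors through `X`.
  obtain ⟨t, ht⟩ := K.d A hA hA' _ hQ hw (α₄ ≫ ξ') 0 0
    (by rw [Category.assoc, comm', reassoc_of% hα₄]; simp) (by simp)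
    (by
      rw [S.map_comp, reassoc_of% hα₄', Preadditive.neg_comp, Category.assoc,
        ← K.adj.homEquiv_naturality_right, ← hξ', hu]
      simp) ⟨0, by simp⟩
  -- Exactness of the left triangle lifts `α₄` to the loop object of `M`. The partner `γ₅` of the
  -- lift then satisfies `γ₅ ≫ w = γ₃` modulo `X`, by uniqueness of partners.
  obtain ⟨α₅, κ, hκ, hα₅⟩ := K.exists_lift hA' hM hN hQ hw hδ' comm' hξ' α₄
    ⟨_, (K.rightChoice.preenvelope A hA).1, _, _, ht⟩
  obtain ⟨γ₅, hγ₅⟩ := K.exists_rel_right hA hM α₅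
  have hγ₆ := ((hγ₅.comp_filler hκ).sub hrel).factors_right hN' hα₅
  -- The correction `ξ ≫ γ₅` cancels the defect after `w`. After `g` it factors through `X`, because
  -- `g ≫ ξ = δ ≫ p`.
  refine ⟨γ₁ + ξ ≫ γ₅, ?_, ?_⟩
  · have w₁ : g ≫ (γ₁ + ξ ≫ γ₅) - β ≫ v =
        δ ≫ (K.rightChoice.p A hA ≫ γ₅ - b ≫ δ') - t₀ ≫ b₀ ≫ v := by
      rw [Preadditive.comp_add, hγ₁, reassoc_of% comm, hβ₀]
      simp only [Preadditive.sub_comp, Preadditive.comp_sub, Category.assoc]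
      abel
    rw [w₁]
    exact FactorsThroughObj.sub ⟨_, (K.rightChoice.preenvelope A hA).1, _, _, rfl⟩
      ⟨_, hV, _, _, rfl⟩
  · have w₂ : γ₁ ≫ w = -(r ≫ s.hom ≫ γ₂) := by
      rw [← Category.assoc r, ← Preadditive.neg_comp, ← e₄, Category.assoc, i₁]
      simp
    have w₁ : (γ₁ + ξ ≫ γ₅) ≫ w + ξ ≫ γ =
        (ξ ≫ ζ - r) ≫ s.hom ≫ γ₂ + ξ ≫ (γ₅ ≫ w - γ₃) := by
      rw [Preadditive.add_comp, w₂, hγ₃]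
      simp only [Preadditive.sub_comp, Preadditive.comp_sub, Category.assoc]
      abel
    rw [w₁]
    exact (hrζ.comp_right _).add (hγ₆.comp_left _)

end Gluing

namespace PrePartialTriangulated

variable {W S : 𝒜 ⥤ 𝒜} [W.Additive] [S.Additive] {L : Set (LeftSeq W)}
  {R : Set (RightSeq S)} {F C X : ObjectProperty 𝒜} [IsAdditiveSubcategory F]
  [IsAdditiveSubcategory C] [IsAdditiveSubcategory X]

/-- The gluing data of a pre-partial triangulated category. -/
def gluing (P : PrePartialTriangulated W S L R F C X) : Gluing W S L R F C X where
  right := P.right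
  rightChoice := P.rightChoice
  leftChoice := P.leftChoice
  adj := P.adj
  c_i A hA hf Q hQ hw β γ h := by
    obtain ⟨α, h₁, h₂⟩ := P.c_i A hA hf Q hQ hw β γ h
    exact ⟨α, h₁, (comp_eq_neg_homEquiv_iff P.adj _ _ _ _).2 h₂⟩
  c_ii := P.c_ii
  d A hC hF Q hQ hw α β γ h₁ h₂ h₃ :=
    P.d A hC hF Q hQ hw α β γ h₁ h₂ ((comp_eq_neg_homEquiv_iff P.adj _ _ _ _).1 h₃)
  e := P.e
  exists_lift hA hM hN _ _ _ hQ hw _ _ h₁ h₂ h₃ :=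
    P.leftChoice.exists_lift P.left hA hM hN hQ hw h₁ h₂ h₃

lemma op_homEquiv (adj : W ⊣ S) {A B : 𝒜ᵒᵖ} (f : S.op.obj A ⟶ B) :
    adj.op.homEquiv A B f = ((adj.homEquiv B.unop A.unop).symm f.unop).op := by
  rw [Adjunction.homEquiv_unit, Adjunction.homEquiv_counit]
  rfl

/-- The compatibility condition is self-dual: the opposite adjunction inverts the transposition, and
`comp_eq_neg_homEquiv_iff` moves it back. -/
lemma op_compat_iff (adj : W ⊣ S) {A K E N : 𝒜ᵒᵖ} (h : E ⟶ W.op.obj A) (u : S.op.obj N ⟶ K)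
    (α : A ⟶ K) (γ : E ⟶ N) :
    h ≫ W.op.map α = -(γ ≫ adj.op.homEquiv N K u) ↔
      u.unop ≫ S.map γ.unop = -(α.unop ≫ adj.homEquiv _ _ h.unop) := by
  rw [op_homEquiv, comp_eq_neg_homEquiv_iff adj u.unop h.unop γ.unop α.unop]
  exact ⟨fun e => congr($(e).unop), fun e => congr($(e).op)⟩

/-- The fixed right triangles as left triangles of the opposite category. -/
def opLeftChoice (P : PrePartialTriangulated W S L R F C X) :
    LeftChoice S.op C.op X.op {Q | RightSeq.mk Q.h.unop Q.g.unop Q.f.unop ∈ R} where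
  U A hA := .op (P.rightChoice.U A.unop hA)
  Y A hA := .op (P.rightChoice.Y A.unop hA)
  ν A hA := (P.rightChoice.q A.unop hA).op
  ι A hA := (P.rightChoice.p A.unop hA).op
  π A hA := (P.rightChoice.i A.unop hA).op
  precover A hA := ⟨(P.rightChoice.preenvelope A.unop hA).1,
    (P.rightChoice.preenvelope A.unop hA).2.op⟩
  mem A hA := P.rightChoice.mem A.unop hA

/-- The fixed left triangles as right triangles of the opposite category. -/
def opRightChoice (P : PrePartialTriangulated W S L R F C X) :
    RightChoice W.op F.op X.op (opSet L) where
  U A hA := .op (P.leftChoice.U A.unop hA)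
  Y A hA := .op (P.leftChoice.Y A.unop hA)
  q A hA := (P.leftChoice.ν A.unop hA).op
  p A hA := (P.leftChoice.ι A.unop hA).op
  i A hA := (P.leftChoice.π A.unop hA).op
  preenvelope A hA := ⟨(P.leftChoice.precover A.unop hA).1,
    (P.leftChoice.precover A.unop hA).2.op⟩
  mem A hA := P.leftChoice.mem A.unop hA

/-- The gluing data of the opposite of a pre-partial triangulated category. -/
def opGluing (P : PrePartialTriangulated W S L R F C X) :
    Gluing S.op W.op {Q | RightSeq.mk Q.h.unop Q.g.unop Q.f.unop ∈ R} (opSet L)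
      C.op F.op X.op where
  right := P.left.op
  rightChoice := P.opRightChoice
  leftChoice := P.opLeftChoice
  adj := P.adj.op
  -- Passing to the opposite category exchanges (c)(i) with (c)(ii), and (d) with (e).
  c_i A hA hf Q hQ hw β γ h := by
    obtain ⟨γ', h₁, h₂⟩ := P.c_ii _ hQ hw.unop _ hA hf.unop β.unop γ.unop congr($(h).unop)
    exact ⟨γ'.op, congr($(h₁).op), (op_compat_iff P.adj _ _ _ _).2 h₂⟩
  c_ii A hA hf Q hQ hw β α h := by
    obtain ⟨α', h₁, h₂⟩ := P.gluing.c_i _ hQ hw.unop _ hA hf.unop β.unop α.unop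
      congr($(h).unop)
    exact ⟨α'.op, congr($(h₁).op), (op_compat_iff P.adj _ _ _ _).2 h₂⟩
  d A hC hF Q hQ hw α β γ h₁ h₂ h₃ h₄ := by
    obtain ⟨t, ht⟩ := P.e A.unop hC hF _ hQ hw.unop γ.unop β.unop α.unop congr($(h₂).unop)
      congr($(h₁).unop) ((op_compat_iff P.adj _ _ _ _).1 h₃)
      ⟨h₄.choose.unop, congr($(h₄.choose_spec).unop)⟩
    exact ⟨t.op, congr($(ht).op)⟩
  e D hF hC Q hQ hf α β γ h₁ h₂ h₃ h₄ := by
    obtain ⟨t, ht⟩ := P.gluing.d D.unop hF hC _ hQ hf.unop γ.unop β.unop α.unop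
      congr($(h₂).unop) congr($(h₁).unop) ((op_compat_iff P.adj _ _ _ _).1 h₃)
      ⟨h₄.choose.unop, congr($(h₄.choose_spec).unop)⟩
    exact ⟨t.op, congr($(ht).op)⟩
  exists_lift hA hM hN _ _ _ hQ hw _ _ h₁ h₂ h₃ α hα := by
    obtain ⟨γ', κ, ⟨σ, k₁, k₂, k₃⟩, h⟩ := P.rightChoice.exists_ext P.right hA hN hM hQ hw.unop
      congr($(h₁).unop) congr($(h₂).unop) congr($(h₃).unop) α.unop hα.unop
    exact ⟨γ'.op, κ.op, ⟨σ.op, congr($(k₁.symm).op), congr($(k₂.symm).op),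
      congr($(k₃.symm).op)⟩, h.op⟩

lemma rel_op (P : PrePartialTriangulated W S L R F C X) {A N : 𝒜} {hA : C A} {hN : F N}
    {α γ} (h : P.gluing.Rel hA hN α γ) :
    P.opGluing.Rel (A := .op N) (N := .op A) hN hA γ.op α.op := by
  obtain ⟨β, h₁, h₂, h₃⟩ := h
  exact ⟨β.op, congr($(h₂).op), congr($(h₁).op), (op_compat_iff P.adj _ _ _ _).2 h₃⟩

/-- The second filling condition relating right and left triangles. -/
theorem exists_filler' (P : PrePartialTriangulated W S L R F C X) {A B E Z M N : 𝒜}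
    (hA : C A) (hA' : F A) (hB : C B) {f : A ⟶ B} {g : B ⟶ E}
    {h : E ⟶ S.obj A} (hP : RightSeq.mk f g h ∈ R) (hf : IsRelMonic X f)
    {δ : B ⟶ P.rightChoice.Y A hA} {ξ : E ⟶ P.rightChoice.U A hA}
    (hδ : f ≫ δ = P.rightChoice.i A hA) (comm : g ≫ ξ = δ ≫ P.rightChoice.p A hA)
    (hξ : h = ξ ≫ P.rightChoice.q A hA) (hN : F N) (hN' : C N) (hM : F M)
    {u : W.obj N ⟶ Z} {v : Z ⟶ M} {w : M ⟶ N} (hQ : LeftSeq.mk u v w ∈ L) (hw : IsRelEpic X w)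
    {δ' : P.leftChoice.Y N hN ⟶ M} {ξ' : P.leftChoice.U N hN ⟶ Z}
    (hδ' : δ' ≫ w = P.leftChoice.π N hN) (comm' : ξ' ≫ v = P.leftChoice.ι N hN ≫ δ')
    (hξ' : u = P.leftChoice.ν N hN ≫ ξ') {γ : P.rightChoice.U A hA ⟶ N} {β : E ⟶ M}
    (hβ : FactorsThroughObj X (β ≫ w - ξ ≫ γ)) {α : A ⟶ P.leftChoice.U N hN}
    (hα : P.gluing.Rel hA hN α γ) :
    ∃ β' : B ⟶ Z, FactorsThroughObj X (β' ≫ v - g ≫ β) ∧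
      FactorsThroughObj X (f ≫ β' + α ≫ ξ') := by
  -- In the opposite category the left triangle on `w` plays the role of the right triangle, and
  -- conversely.
  obtain ⟨β', h₁, h₂⟩ := P.opGluing.exists_filler (A := .op N) (N := .op A) (B := .op M)
    (E := .op Z) (Z := .op E) (M := .op B) hN hN' hM (f := w.op) (g := v.op) (h := u.op) hQ hw.op
    (δ := δ'.op) (ξ := ξ'.op) congr($(hδ').op) congr($(comm').op) congr($(hξ').op) hA hA' hB
    (u := h.op) (v := g.op) (w := f.op) hP hf.op (δ' := δ.op) (ξ' := ξ.op) congr($(hδ).op)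
    congr($(comm).op) congr($(hξ).op) (β := β.op) hβ.op (P.rel_op hα)
  exact ⟨β'.unop, h₁.unop, h₂.unop⟩

end PrePartialTriangulated

end

/-! ### Filling conditions: invariance under isomorphism and standard representatives -/

section

section Filling

variable {T : Type u} [Category.{v} T] {Ψ Φ : T ⥤ T}

lemma LeftSeq.Isomorphic.symm {P Q : LeftSeq Φ} (h : P.Isomorphic Q) : Q.Isomorphic P := by
  obtain ⟨a, b, c, h₁, h₂, h₃⟩ := h
  refine ⟨a.symm, b.symm, c.symm, ?_, ?_, ?_⟩
  · rw [← cancel_epi (Φ.map c.hom)]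
    simp [← reassoc_of% h₁, ← Φ.map_comp_assoc]
  · rw [← cancel_epi a.hom]
    simp [← reassoc_of% h₂]
  · rw [← cancel_epi b.hom]
    simp [← reassoc_of% h₃]

lemma LeftSeq.Isomorphic.trans {P Q Q' : LeftSeq Φ} (h : P.Isomorphic Q) (h' : Q.Isomorphic Q') :
    P.Isomorphic Q' := by
  obtain ⟨a, b, c, h₁, h₂, h₃⟩ := h
  obtain ⟨a', b', c', h₁', h₂', h₃'⟩ := h'
  exact ⟨a ≪≫ a', b ≪≫ b', c ≪≫ c', by simp [reassoc_of% h₁, h₁'],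
    by simp [reassoc_of% h₂, h₂'], by simp [reassoc_of% h₃, h₃']⟩

/-- The first filling condition of a pre-triangulated category, for two given triangles. -/
def FillsThird (adj : Ψ ⊣ Φ) (P : RightSeq Ψ) (Q : LeftSeq Φ) : Prop :=
  ∀ (α : P.A ⟶ Φ.obj Q.C) (β : P.B ⟶ Q.A), P.f ≫ β = α ≫ Q.f →
    ∃ γ : P.C ⟶ Q.B, P.g ≫ γ = β ≫ Q.g ∧ P.h ≫ Ψ.map α ≫ adj.counit.app Q.C = γ ≫ Q.h

/-- The second filling condition of a pre-triangulated category, for two given triangles. -/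
def FillsFirst (adj : Ψ ⊣ Φ) (P : RightSeq Ψ) (Q : LeftSeq Φ) : Prop :=
  ∀ (α : Ψ.obj P.A ⟶ Q.C) (β : P.C ⟶ Q.B), P.h ≫ α = β ≫ Q.h →
    ∃ γ : P.B ⟶ Q.A, P.g ≫ β = γ ≫ Q.g ∧
      P.f ≫ γ = (adj.unit.app P.A ≫ Φ.map α) ≫ Q.f

lemma FillsThird.of_iso {adj : Ψ ⊣ Φ} {P P' : RightSeq Ψ} {Q Q' : LeftSeq Φ}
    (h : FillsThird adj P' Q') (hP : P.Isomorphic P') (hQ : Q.Isomorphic Q') :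
    FillsThird adj P Q := by
  obtain ⟨a, b, c, p₁, p₂, p₃⟩ := hP
  obtain ⟨a', b', c', q₁, q₂, q₃⟩ := hQ
  intro α β hαβ
  obtain ⟨γ, h₁, h₂⟩ := h (a.inv ≫ α ≫ Φ.map c'.hom) (b.inv ≫ β ≫ a'.hom) (by
    rw [← cancel_epi a.hom, ← reassoc_of% p₁]
    simp [reassoc_of% hαβ, q₁])
  refine ⟨c.hom ≫ γ ≫ b'.inv, ?_, ?_⟩
  · rw [reassoc_of% p₂, reassoc_of% h₁]
    simp [← reassoc_of% q₂]
  · rw [← cancel_mono c'.hom]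
    simp only [Category.assoc, q₃, Iso.inv_hom_id_assoc, ← h₂]
    simp only [← reassoc_of% p₃, ← Ψ.map_comp_assoc, Iso.hom_inv_id_assoc]
    simp

lemma FillsFirst.of_iso {adj : Ψ ⊣ Φ} {P P' : RightSeq Ψ} {Q Q' : LeftSeq Φ}
    (h : FillsFirst adj P' Q') (hP : P.Isomorphic P') (hQ : Q.Isomorphic Q') :
    FillsFirst adj P Q := by
  obtain ⟨a, b, c, p₁, p₂, p₃⟩ := hP
  obtain ⟨a', b', c', q₁, q₂, q₃⟩ := hQ
  intro α β hαβ
  obtain ⟨γ, h₁, h₂⟩ := h (Ψ.map a.inv ≫ α ≫ c'.hom) (c.inv ≫ β ≫ b'.hom) (by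
    rw [← cancel_epi c.hom, ← reassoc_of% p₃, ← Ψ.map_comp_assoc]
    simp [reassoc_of% hαβ, q₃])
  refine ⟨b.hom ≫ γ ≫ a'.inv, ?_, ?_⟩
  · rw [← cancel_mono b'.hom]
    simp only [Category.assoc, q₂, Iso.inv_hom_id_assoc, ← h₁]
    rw [← reassoc_of% p₂]
    simp
  · rw [reassoc_of% p₁, reassoc_of% h₂, ← cancel_mono a'.hom]
    simp [q₁]

end Filling

variable {𝒜 : Type u} [Category.{v} 𝒜] [Preadditive 𝒜] [HasZeroObject 𝒜]
  [HasBinaryBiproducts 𝒜]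

instance {C F : ObjectProperty 𝒜} [IsAdditiveSubcategory C] [IsAdditiveSubcategory F] :
    IsAdditiveSubcategory (C ⊓ F) where
  of_iso e h := ⟨IsAdditiveSubcategory.of_iso e h.1, IsAdditiveSubcategory.of_iso e h.2⟩
  zero Z hZ := ⟨IsAdditiveSubcategory.zero Z hZ, IsAdditiveSubcategory.zero Z hZ⟩
  biprod h h' := ⟨IsAdditiveSubcategory.biprod h.1 h'.1, IsAdditiveSubcategory.biprod h.2 h'.2⟩

/-- Right triangles of `G / X` have representatives whose first two terms are in `G`. -/
lemma SpecialPreenveloping.exists_std_of_mem {S : 𝒜 ⥤ 𝒜} [S.Additive] {C X : ObjectProperty 𝒜}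
    [IsAdditiveSubcategory C] [IsAdditiveSubcategory X] {R : Set (RightSeq S)}
    {G : ObjectProperty 𝒜} [IsAdditiveSubcategory G] (H : IsPartialRightTriangulated S C X R)
    (D : RightChoice S C X R) (E : SpecialPreenveloping S C X R G)
    {P : RightSeq (E.suspG H D)} (hP : P ∈ E.distinguishedG H D) :
    ∃ (A B : Subfactor G X) (K : Subfactor C X) (f : A.obj ⟶ B.obj) (g : B.obj ⟶ K.obj)
      (h : K.obj ⟶ S.obj A.obj) (δ : B.obj ⟶ D.Y A.obj (E.le_C _ A.property))
      (ξ : K.obj ⟶ D.U A.obj (E.le_C _ A.property)),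
      RightSeq.mk f g h ∈ R ∧ IsRelMonic X f ∧ f ≫ δ = D.i A.obj (E.le_C _ A.property) ∧
      g ≫ ξ = δ ≫ D.p A.obj (E.le_C _ A.property) ∧
      h = ξ ≫ D.q A.obj (E.le_C _ A.property) ∧
      P.Isomorphic (RightSeq.mk (S := E.suspG H D) (Subfactor.cls f : A ⟶ B)
        (E.unitG H B ≫ (E.reflector H).map
          (Subfactor.cls (A := (Subfactor.incl X E.le_C).obj B) (B := K) g))
        ((E.reflector H).map (Subfactor.cls (A := K)
          (B := (D.susp H).obj ((Subfactor.incl X E.le_C).obj A)) ξ))) := by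
  obtain ⟨_, ⟨A, B, K, f, g, h, hm, rfl⟩, hi⟩ := hP
  rw [D.distinguished_eq] at hm
  obtain ⟨Z, N, e, φ, g', h', δ, ξ, b, c, hs, e₁, e₂, e₃⟩ := (D.model H).exists_std_iso H hm
  -- Enlarging `B` to `Z ≅ Y ⊞ B` stays inside `G`, because `Y` is in `X ⊆ G`.
  have hZ : G Z.obj := IsAdditiveSubcategory.of_iso (show Z.obj ≅ _ from e).symm
    (IsAdditiveSubcategory.biprod
      (E.X_le _ (D.preenvelope A.obj (E.le_C _ A.property)).1) B.property)
  let b' : B ≅ ⟨Z.obj, hZ⟩ := (Subfactor.incl X E.le_C).preimageIso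
    (Y := ⟨Z.obj, hZ⟩) b
  have hb : (Subfactor.incl X E.le_C).map b'.hom = b.hom :=
    (Subfactor.incl X E.le_C).map_preimage _
  refine ⟨A, ⟨Z.obj, hZ⟩, N, φ, g', h', δ, ξ, hs.mem, hs.monic, hs.hδ, hs.comm, hs.hξ,
    hi.trans ⟨Iso.refl _, b', (E.reflector H).mapIso c, ?_, ?_, ?_⟩⟩
  · refine Eq.trans ?_ (Category.id_comp _).symm
    refine (Subfactor.incl X E.le_C).map_injective ?_
    rw [Functor.map_comp, hb]
    exact e₁
  · have hn : b'.hom ≫ E.unitG H ⟨Z.obj, hZ⟩ = E.unitG H B ≫ (E.reflector H).map b.hom := by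
      rw [← hb]
      exact E.unit_naturality H ((Subfactor.incl X E.le_C).map b'.hom)
    have hg : (E.unitG H B ≫ (E.reflector H).map g) ≫ (E.reflector H).map c.hom =
        b'.hom ≫ E.unitG H ⟨Z.obj, hZ⟩ ≫ (E.reflector H).map ((D.model H).cls g') := by
      rw [Category.assoc, ← Functor.map_comp, e₂, Functor.map_comp, ← Category.assoc,
        ← Category.assoc, hn]
      rfl
    exact hg
  · have hh : (E.reflector H).map h =
        (E.reflector H).map c.hom ≫ (E.reflector H).map ((D.model H).cls ξ) := by
      rw [← Functor.map_comp, e₃]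
      rfl
    refine Eq.trans ?_ hh
    exact (congrArg (CategoryStruct.comp _) ((E.suspG H D).map_id A)).trans (Category.comp_id _)

/-- Left triangles of `G / X` have representatives whose last two terms are in `G`. -/
lemma SpecialPrecovering.exists_std_of_mem {W : 𝒜 ⥤ 𝒜} [W.Additive] {F X : ObjectProperty 𝒜}
    [IsAdditiveSubcategory F] [IsAdditiveSubcategory X] {L : Set (LeftSeq W)}
    {G : ObjectProperty 𝒜} [IsAdditiveSubcategory G] (H : IsPartialLeftTriangulated W F X L)
    (D : LeftChoice W F X L) (E : SpecialPrecovering W F X L G)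
    {Q : LeftSeq (E.loopG H D)} (hQ : Q ∈ E.distinguishedG H D) :
    ∃ (A B : Subfactor G X) (K : Subfactor F X) (f : W.obj B.obj ⟶ K.obj) (g : K.obj ⟶ A.obj)
      (h : A.obj ⟶ B.obj) (δ : D.Y B.obj (E.le_F _ B.property) ⟶ A.obj)
      (ξ : D.U B.obj (E.le_F _ B.property) ⟶ K.obj),
      LeftSeq.mk f g h ∈ L ∧ IsRelEpic X h ∧ δ ≫ h = D.π B.obj (E.le_F _ B.property) ∧
      ξ ≫ g = D.ι B.obj (E.le_F _ B.property) ≫ δ ∧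
      f = D.ν B.obj (E.le_F _ B.property) ≫ ξ ∧
      Q.Isomorphic (LeftSeq.mk (W := E.loopG H D)
        ((E.coreflector H).map (Subfactor.cls
          (A := (D.loop H).obj ((Subfactor.incl X E.le_F).obj B)) (B := K) ξ))
        ((E.coreflector H).map
          (Subfactor.cls (A := K) (B := (Subfactor.incl X E.le_F).obj A) g) ≫ E.counitG H A)
        (Subfactor.cls h : A ⟶ B)) := by
  obtain ⟨_, ⟨A, B, K, f, g, h, hm, rfl⟩, hi⟩ := hQ
  have hm' : RightSeq.mk (S := (D.loop H).op) ((Subfactor.incl X E.le_F).map h).op g.op f.op ∈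
      (D.model H).Δ := by
    rw [← D.opSet_distinguished_eq]
    exact hm
  obtain ⟨Z, N, e, φ, g', h', δ, ξ, b, c, hs, e₁, e₂, e₃⟩ := (D.model H).exists_std_iso H.op hm'
  have hZ : G Z.unop.obj := IsAdditiveSubcategory.of_iso (P := G.op) (A := _)
    (B := .op Z.unop.obj) (show (D.model H).o Z ≅ _ from e).symm
    (IsAdditiveSubcategory.biprod (P := G.op)
      (E.X_le _ (D.precover B.obj (E.le_F _ B.property)).1) A.property)
  let b' : (⟨Z.unop.obj, hZ⟩ : Subfactor G X) ≅ A := (Subfactor.incl X E.le_F).preimageIso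
    (X := ⟨Z.unop.obj, hZ⟩) b.unop
  have hb : (Subfactor.incl X E.le_F).map b'.hom = b.hom.unop :=
    (Subfactor.incl X E.le_F).map_preimage _
  refine ⟨⟨Z.unop.obj, hZ⟩, B, N.unop, h'.unop, g'.unop, φ.unop, δ.unop, ξ.unop, hs.mem,
    hs.monic.unop, congr($(hs.hδ).unop), congr($(hs.comm).unop), congr($(hs.hξ).unop),
    hi.trans (LeftSeq.Isomorphic.symm ⟨(E.coreflector H).mapIso c.unop, b', Iso.refl _,
      ?_, ?_, ?_⟩)⟩
  · have hf : (E.coreflector H).map f = (E.coreflector H).map ((D.model H).cls ξ).unop ≫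
        (E.coreflector H).map c.hom.unop := by
      rw [← Functor.map_comp]
      exact congrArg (E.coreflector H).map congr($(e₃).unop)
    refine hf.symm.trans ?_
    exact ((congrArg (fun x => x ≫ (E.coreflector H).map f) ((E.loopG H D).map_id B)).trans
      (Category.id_comp _)).symm
  · have hn : E.counitG H ⟨Z.unop.obj, hZ⟩ ≫ b'.hom =
        (E.coreflector H).map b.hom.unop ≫ E.counitG H A := by
      rw [← hb]
      exact E.counit_naturality H ((Subfactor.incl X E.le_F).map b'.hom)
    have hg : ((E.coreflector H).map ((D.model H).cls g').unop ≫
        E.counitG H ⟨Z.unop.obj, hZ⟩) ≫ b'.hom =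
        (E.coreflector H).map c.hom.unop ≫ (E.coreflector H).map g ≫ E.counitG H A := by
      refine (Category.assoc _ _ _).trans
        ((congrArg (CategoryStruct.comp _) hn).trans ?_)
      refine (Functor.map_comp_assoc _ _ _ _).symm.trans (Eq.trans ?_
        (Functor.map_comp_assoc _ _ _ _))
      exact congrArg (fun x => (E.coreflector H).map x ≫ E.counitG H A) congr($(e₂.symm).unop)
    exact hg
  · refine (Category.comp_id _).trans ?_
    refine (Subfactor.incl X E.le_F).map_injective ?_
    rw [Functor.map_comp, hb]
    exact congr($(e₁.symm).unop)

end

/-! ### The adjunction between `G^X` and `H_X`, and the two filling conditions -/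

section

section Identities

variable {𝒜 : Type u} [Category.{v} 𝒜] [Preadditive 𝒜] [HasZeroObject 𝒜]
  [HasBinaryBiproducts 𝒜]

lemma Subfactor.cls_eq_zero_iff {C X : ObjectProperty 𝒜} [IsAdditiveSubcategory X]
    {A B : Subfactor C X} (f : A.obj ⟶ B.obj) :
    (Subfactor.cls f : A ⟶ B) = 0 ↔ FactorsThroughObj X f := by
  rw [← Subfactor.cls_zero, Subfactor.cls_eq_iff, sub_zero]

lemma FactorsThroughObj.comp_neg_sub {X : ObjectProperty 𝒜} [IsAdditiveSubcategory X]
    {A B D : 𝒜} {f : A ⟶ B} {g : B ⟶ D} {h : A ⟶ D} (hx : FactorsThroughObj X (h + f ≫ g)) :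
    FactorsThroughObj X (f ≫ (-g) - h) := by
  rw [Preadditive.comp_neg, ← neg_add', add_comm]
  exact hx.neg

lemma FactorsThroughObj.sub_neg_comp {X : ObjectProperty 𝒜} {A B D : 𝒜} {f : A ⟶ B}
    {g : B ⟶ D} {h : A ⟶ D} (hx : FactorsThroughObj X (h + f ≫ g)) :
    FactorsThroughObj X (h - (-f) ≫ g) := by
  rwa [Preadditive.neg_comp, sub_neg_eq_add]

/-- This moves a square on the second morphism of a reflected triangle from `G / X` to `C / X`,
where representatives in `𝒜` are available: transposing `t` removes the reflection. -/
lemma SpecialPreenveloping.incl_map_unitG_comp {S : 𝒜 ⥤ 𝒜} {C X : ObjectProperty 𝒜}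
    [IsAdditiveSubcategory X] {R : Set (RightSeq S)} {G : ObjectProperty 𝒜}
    (H : IsPartialRightTriangulated S C X R) (E : SpecialPreenveloping S C X R G)
    {B M : Subfactor G X} {K : Subfactor C X} (g : (Subfactor.incl X E.le_C).obj B ⟶ K)
    (t : (E.reflector H).obj K ⟶ M) :
    (Subfactor.incl X E.le_C).map ((E.unitG H B ≫ (E.reflector H).map g) ≫ t) =
      g ≫ (E.adj H).homEquiv K M t := by
  rw [← Adjunction.homEquiv_naturality_left, E.adj_homEquiv, Category.assoc]
  rfl

lemma SpecialPrecovering.incl_map_comp_counitG {W : 𝒜 ⥤ 𝒜} {F X : ObjectProperty 𝒜}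
    [IsAdditiveSubcategory X] {L : Set (LeftSeq W)} {G : ObjectProperty 𝒜}
    (H : IsPartialLeftTriangulated W F X L) (E : SpecialPrecovering W F X L G)
    {B M : Subfactor G X} {K : Subfactor F X} (t : B ⟶ (E.coreflector H).obj K)
    (v : K ⟶ (Subfactor.incl X E.le_F).obj M) :
    (Subfactor.incl X E.le_F).map (t ≫ (E.coreflector H).map v ≫ E.counitG H M) =
      ((E.adj H).homEquiv B K).symm t ≫ v := by
  rw [← Adjunction.homEquiv_naturality_right_symm, E.adj_homEquiv_symm, ← Category.assoc]
  rfl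

end Identities

namespace PrePartialTriangulated

variable {𝒜 : Type u} [Category.{v} 𝒜] [Preadditive 𝒜] [HasZeroObject 𝒜]
  [HasBinaryBiproducts 𝒜] {W S : 𝒜 ⥤ 𝒜} [W.Additive] [S.Additive] {L : Set (LeftSeq W)}
  {R : Set (RightSeq S)} {F C X : ObjectProperty 𝒜} [IsAdditiveSubcategory F]
  [IsAdditiveSubcategory C] [IsAdditiveSubcategory X]

/-- The embedding of `(C ∩ F) / X` into `C / X`. -/
abbrev inclC (P : PrePartialTriangulated W S L R F C X) :
    Subfactor (C ⊓ F) X ⥤ Subfactor C X :=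
  Subfactor.incl X P.preenv.le_C

/-- The embedding of `(C ∩ F) / X` into `F / X`. -/
abbrev inclF (P : PrePartialTriangulated W S L R F C X) :
    Subfactor (C ⊓ F) X ⥤ Subfactor F X :=
  Subfactor.incl X P.precov.le_F

/-- The suspension of `C / X`. -/
noncomputable abbrev suspC (P : PrePartialTriangulated W S L R F C X) :
    Subfactor C X ⥤ Subfactor C X :=
  P.rightChoice.susp P.right

/-- The loop functor of `F / X`. -/
noncomputable abbrev loopF (P : PrePartialTriangulated W S L R F C X) :
    Subfactor F X ⥤ Subfactor F X :=
  P.leftChoice.loop P.left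

/-- The correspondence between morphisms to the loop object and morphisms from the suspension. -/
def ClsRel (P : PrePartialTriangulated W S L R F C X) {A B : Subfactor (C ⊓ F) X}
    (a : P.inclF.obj A ⟶ P.loopF.obj (P.inclF.obj B))
    (c : P.suspC.obj (P.inclC.obj A) ⟶ P.inclC.obj B) : Prop :=
  ∃ (α : A.obj ⟶ P.leftChoice.U B.obj (P.precov.le_F _ B.property))
    (γ : P.rightChoice.U A.obj (P.preenv.le_C _ A.property) ⟶ B.obj),
    P.gluing.Rel (P.preenv.le_C _ A.property) (P.precov.le_F _ B.property) α γ ∧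
    Subfactor.cls α = a ∧ Subfactor.cls γ = c

variable (P : PrePartialTriangulated W S L R F C X) {A B : Subfactor (C ⊓ F) X}

lemma exists_clsRel_left (c : P.suspC.obj (P.inclC.obj A) ⟶ P.inclC.obj B) :
    ∃ a, P.ClsRel a c := by
  obtain ⟨γ, rfl⟩ := Subfactor.cls_surjective c
  obtain ⟨α, h⟩ := P.gluing.exists_rel_left (P.preenv.le_C _ A.property)
    (P.precov.le_F _ B.property) γ
  exact ⟨_, α, γ, h, rfl, rfl⟩

lemma exists_clsRel_right (a : P.inclF.obj A ⟶ P.loopF.obj (P.inclF.obj B)) :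
    ∃ c, P.ClsRel a c := by
  obtain ⟨α, rfl⟩ := Subfactor.cls_surjective a
  obtain ⟨γ, h⟩ := P.gluing.exists_rel_right (P.preenv.le_C _ A.property)
    (P.precov.le_F _ B.property) α
  exact ⟨_, α, γ, h, rfl, rfl⟩

variable {P}

lemma ClsRel.sub {a a' : P.inclF.obj A ⟶ P.loopF.obj (P.inclF.obj B)}
    {c c' : P.suspC.obj (P.inclC.obj A) ⟶ P.inclC.obj B} (h : P.ClsRel a c)
    (h' : P.ClsRel a' c') : P.ClsRel (a - a') (c - c') := by
  obtain ⟨α, γ, h, rfl, rfl⟩ := h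
  obtain ⟨α', γ', h', rfl, rfl⟩ := h'
  exact ⟨_, _, h.sub h', rfl, rfl⟩

lemma ClsRel.neg {a : P.inclF.obj A ⟶ P.loopF.obj (P.inclF.obj B)}
    {c : P.suspC.obj (P.inclC.obj A) ⟶ P.inclC.obj B} (h : P.ClsRel a c) :
    P.ClsRel (-a) (-c) := by
  obtain ⟨α, γ, h, rfl, rfl⟩ := h
  exact ⟨_, _, h.neg, rfl, rfl⟩

/-- The relation is additive, so uniqueness reduces to the case where one partner is zero. This
direction uses (e), hence `B` in `C`; `eq_left` uses (d), hence `A` in `F`. -/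
lemma ClsRel.eq_right {a : P.inclF.obj A ⟶ P.loopF.obj (P.inclF.obj B)}
    {c c' : P.suspC.obj (P.inclC.obj A) ⟶ P.inclC.obj B} (h : P.ClsRel a c)
    (h' : P.ClsRel a c') : c = c' := by
  obtain ⟨α, γ, h, e, e'⟩ := h.sub h'
  rw [sub_self] at e
  have := h.factors_right B.property.1 ((Subfactor.cls_eq_zero_iff (A := P.inclF.obj A)
    (B := P.loopF.obj (P.inclF.obj B)) α).1 e)
  rw [← sub_eq_zero, ← e']
  exact (Subfactor.cls_eq_zero_iff (A := P.suspC.obj (P.inclC.obj A)) (B := P.inclC.obj B) γ).2 this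

lemma ClsRel.eq_left {a a' : P.inclF.obj A ⟶ P.loopF.obj (P.inclF.obj B)}
    {c : P.suspC.obj (P.inclC.obj A) ⟶ P.inclC.obj B} (h : P.ClsRel a c)
    (h' : P.ClsRel a' c) : a = a' := by
  obtain ⟨α, γ, h, e, e'⟩ := h.sub h'
  rw [sub_self] at e'
  have := h.factors_left A.property.2 ((Subfactor.cls_eq_zero_iff
    (A := P.suspC.obj (P.inclC.obj A)) (B := P.inclC.obj B) γ).1 e')
  rw [← sub_eq_zero, ← e]
  exact (Subfactor.cls_eq_zero_iff (A := P.inclF.obj A) (B := P.loopF.obj (P.inclF.obj B)) α).2 this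

/-- With `map_comp`, this is the naturality of the correspondence: composing a morphism between
fixed triangles with a filler gives another one. -/
lemma ClsRel.comp_map {a : P.inclF.obj A ⟶ P.loopF.obj (P.inclF.obj B)}
    {c : P.suspC.obj (P.inclC.obj A) ⟶ P.inclC.obj B} (h : P.ClsRel a c)
    {B' : Subfactor (C ⊓ F) X} (w : B ⟶ B') :
    P.ClsRel (a ≫ P.loopF.map (P.inclF.map w)) (c ≫ P.inclC.map w) := by
  obtain ⟨α, γ, h, rfl, rfl⟩ := h
  obtain ⟨w, rfl⟩ := Subfactor.cls_surjective w
  obtain ⟨κ, hκ⟩ := P.leftChoice.exists_filler P.left (P.precov.le_F _ B.property)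
    (P.precov.le_F _ B'.property) w
  refine ⟨α ≫ κ, γ ≫ w, h.comp_filler hκ, ?_, rfl⟩
  exact congrArg (CategoryStruct.comp (Subfactor.cls (A := P.inclF.obj A)
    (B := P.loopF.obj (P.inclF.obj B)) α))
    (P.leftChoice.loop_map_mk P.left (A := P.inclF.obj B) (B := P.inclF.obj B') w κ hκ).symm

lemma ClsRel.map_comp {a : P.inclF.obj A ⟶ P.loopF.obj (P.inclF.obj B)}
    {c : P.suspC.obj (P.inclC.obj A) ⟶ P.inclC.obj B} (h : P.ClsRel a c)
    {A' : Subfactor (C ⊓ F) X} (f : A' ⟶ A) :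
    P.ClsRel (P.inclF.map f ≫ a) (P.suspC.map (P.inclC.map f) ≫ c) := by
  obtain ⟨α, γ, h, rfl, rfl⟩ := h
  obtain ⟨f, rfl⟩ := Subfactor.cls_surjective f
  obtain ⟨κ, hκ⟩ := P.rightChoice.exists_filler P.right (P.preenv.le_C _ A'.property)
    (P.preenv.le_C _ A.property) f
  refine ⟨f ≫ α, κ ≫ γ, h.filler_comp hκ, rfl, ?_⟩
  exact congrArg (fun x => x ≫ Subfactor.cls (A := P.suspC.obj (P.inclC.obj A))
    (B := P.inclC.obj B) γ)
    (P.rightChoice.susp_map_mk P.right (A := P.inclC.obj A') (B := P.inclC.obj A) f κ hκ).symm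

variable (P A B)

/-- The bijection between morphisms from the suspension in `C / X` and morphisms to the loop
object in `F / X`, for objects of `C ∩ F`. -/
noncomputable def middleEquiv : (P.suspC.obj (P.inclC.obj A) ⟶ P.inclC.obj B) ≃
    (P.inclF.obj A ⟶ P.loopF.obj (P.inclF.obj B)) where
  -- The sign is forced by the filling condition: `Gluing.exists_filler` produces `γ' ≫ w = -(ξ ≫
  -- γ)` modulo `X`, whereas a pre-triangulated category requires the equality without sign.
  toFun c := -(P.exists_clsRel_left c).choose
  invFun a := (P.exists_clsRel_right (-a)).choose
  left_inv c := (P.exists_clsRel_right _).choose_spec.eq_right (by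
    rw [neg_neg]
    exact (P.exists_clsRel_left c).choose_spec)
  right_inv a := by
    rw [neg_eq_iff_eq_neg]
    exact (P.exists_clsRel_left _).choose_spec.eq_left (P.exists_clsRel_right (-a)).choose_spec

variable {A B}

lemma middleEquiv_eq {a : P.inclF.obj A ⟶ P.loopF.obj (P.inclF.obj B)}
    {c : P.suspC.obj (P.inclC.obj A) ⟶ P.inclC.obj B} (h : P.ClsRel a c) :
    P.middleEquiv A B c = -a :=
  congrArg Neg.neg ((P.exists_clsRel_left c).choose_spec.eq_left h)

lemma clsRel_middleEquiv (c : P.suspC.obj (P.inclC.obj A) ⟶ P.inclC.obj B) :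
    P.ClsRel (-P.middleEquiv A B c) c := by
  obtain ⟨a, ha⟩ := P.exists_clsRel_left c
  rwa [P.middleEquiv_eq ha, neg_neg]

/-- The bijection defining the adjunction between `G^X` and `H_X`. -/
noncomputable def adjHomEquiv (A B : Subfactor (C ⊓ F) X) : (P.G.obj A ⟶ B) ≃ (A ⟶ P.H.obj B) :=
  ((P.preenv.adj P.right).homEquiv (P.suspC.obj (P.inclC.obj A)) B).trans
    ((P.middleEquiv A B).trans
      ((P.precov.adj P.left).homEquiv A (P.loopF.obj (P.inclF.obj B))))

lemma adjHomEquiv_naturality_left {A' : Subfactor (C ⊓ F) X} (f : A' ⟶ A) (g : P.G.obj A ⟶ B) :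
    P.adjHomEquiv A' B (P.G.map f ≫ g) = f ≫ P.adjHomEquiv A B g := by
  have h₁ := (P.preenv.adj P.right).homEquiv_naturality_left (P.suspC.map (P.inclC.map f)) g
  have h₂ := P.middleEquiv_eq ((P.clsRel_middleEquiv
    ((P.preenv.adj P.right).homEquiv (P.suspC.obj (P.inclC.obj A)) B g)).map_comp f)
  rw [← h₁, Preadditive.comp_neg, neg_neg] at h₂
  exact (congrArg ((P.precov.adj P.left).homEquiv _ _) h₂).trans
    ((P.precov.adj P.left).homEquiv_naturality_left _ _)

lemma adjHomEquiv_naturality_right {B' : Subfactor (C ⊓ F) X} (f : P.G.obj A ⟶ B) (g : B ⟶ B') :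
    P.adjHomEquiv A B' (f ≫ g) = P.adjHomEquiv A B f ≫ P.H.map g := by
  have h₁ := (P.preenv.adj P.right).homEquiv_naturality_right
    (X := P.suspC.obj (P.inclC.obj A)) f g
  have h₂ := P.middleEquiv_eq ((P.clsRel_middleEquiv
    ((P.preenv.adj P.right).homEquiv (P.suspC.obj (P.inclC.obj A)) B f)).comp_map g)
  rw [← h₁, Preadditive.neg_comp, neg_neg] at h₂
  exact (congrArg ((P.precov.adj P.left).homEquiv _ _) h₂).trans
    ((P.precov.adj P.left).homEquiv_naturality_right _ _)

/-- The adjunction between `G^X` and `H_X`. -/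
noncomputable def adjGH : P.G ⊣ P.H :=
  Adjunction.mkOfHomEquiv
    { homEquiv := P.adjHomEquiv
      homEquiv_naturality_left_symm := fun f g => by
        rw [Equiv.symm_apply_eq, P.adjHomEquiv_naturality_left, Equiv.apply_symm_apply]
      homEquiv_naturality_right := P.adjHomEquiv_naturality_right }

lemma adjGH_homEquiv : P.adjGH.homEquiv A B = P.adjHomEquiv A B := by
  rw [adjGH, Adjunction.mkOfHomEquiv_homEquiv]

/-- For standard representatives, `α` and `β` are transposed along the coreflection to morphisms of
`F / X`, the problem is solved in `𝒜` by `Gluing.exists_filler`, and the solution is transposed back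
along the reflection. -/
theorem fillsThird {P₁ : RightSeq P.G} (hP : P₁ ∈ P.rightTriangles) {Q₁ : LeftSeq P.H}
    (hQ : Q₁ ∈ P.leftTriangles) : FillsThird P.adjGH P₁ Q₁ := by
  obtain ⟨A, B, K, f, g, h, δ, ξ, hm, hf, hδ, comm, hξ, hi⟩ :=
    P.preenv.exists_std_of_mem P.right P.rightChoice hP
  obtain ⟨M, N, K', u, v, w, δ', ξ', hm', hw, hδ', comm', hξ', hi'⟩ :=
    P.precov.exists_std_of_mem P.left P.leftChoice hQ
  refine FillsThird.of_iso ?_ hi hi'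
  intro α β hαβ
  let adjR := P.preenv.adj P.right
  let adjQ := P.precov.adj P.left
  have hA := P.preenv.le_C _ A.property
  have hN := P.precov.le_F _ N.property
  obtain ⟨a, ha⟩ := Subfactor.cls_surjective
    ((adjQ.homEquiv A (P.loopF.obj (P.inclF.obj N))).symm α)
  obtain ⟨b, hb⟩ := Subfactor.cls_surjective ((adjQ.homEquiv B K').symm β)
  have e₁ : (Subfactor.cls (A := P.inclF.obj A) (B := P.inclF.obj B) f) ≫
      (adjQ.homEquiv B K').symm β =
      (adjQ.homEquiv A (P.loopF.obj (P.inclF.obj N))).symm α ≫ Subfactor.cls ξ' :=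
    (adjQ.homEquiv_naturality_left_symm (Subfactor.cls f) β).symm.trans
      ((congrArg (adjQ.homEquiv A K').symm hαβ).trans
        (adjQ.homEquiv_naturality_right_symm α (Subfactor.cls ξ')))
  rw [← ha, ← hb] at e₁
  obtain ⟨c, hc⟩ := P.gluing.exists_rel_right hA hN a
  obtain ⟨γ, k₁, k₂⟩ := P.gluing.exists_filler hA A.property.2 B.property.1 hm hf hδ comm hξ
    hN N.property.1 M.property.2 hm' hw hδ' comm' hξ'
    ((Subfactor.cls_eq_iff (A := P.inclF.obj A) (B := K') _ _).1 e₁) hc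
  -- Under the adjunction `α` corresponds to `-c`, where `c` is the partner of its representative
  -- `a`.
  have e₂ : adjR.homEquiv (P.suspC.obj (P.inclC.obj A)) N
      ((P.adjGH.homEquiv A N).symm α) = -Subfactor.cls c := by
    rw [P.adjGH_homEquiv]
    refine (adjR.homEquiv _ _).apply_symm_apply _ |>.trans ?_
    refine (P.middleEquiv A N).symm_apply_eq.2 (Eq.trans ?_ (P.middleEquiv_eq (a := -Subfactor.cls a)
      (ClsRel.neg ⟨a, c, hc, rfl, rfl⟩)).symm)
    exact ha.symm.trans (neg_neg _).symm
  have e₃ : adjR.homEquiv K M ((adjR.homEquiv K M).symm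
      (Subfactor.cls (B := P.inclC.obj M) γ)) = _ := (adjR.homEquiv K M).apply_symm_apply _
  refine ⟨(adjR.homEquiv K M).symm (Subfactor.cls (B := P.inclC.obj M) γ), ?_, ?_⟩
  · have l₁ := P.preenv.incl_map_unitG_comp P.right
      (Subfactor.cls (A := P.inclC.obj B) (B := K) g)
      ((adjR.homEquiv K M).symm (Subfactor.cls (B := P.inclC.obj M) γ))
    have l₂ := P.precov.incl_map_comp_counitG P.left β
      (Subfactor.cls (A := K') (B := P.inclF.obj M) v)
    rw [show (P.preenv.adj P.right) = adjR from rfl, e₃] at l₁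
    rw [show (P.precov.adj P.left) = adjQ from rfl, ← hb] at l₂
    exact Eq.trans l₁ (((Subfactor.cls_eq_iff (A := B) (B := M) _ _).2 k₁).trans l₂.symm)
  · dsimp only
    rw [show P.G.map α ≫ P.adjGH.counit.app N = (P.adjGH.homEquiv A N).symm α from
      (P.adjGH.homEquiv_counit ..).symm]
    refine (adjR.homEquiv K N).injective ?_
    refine (adjR.homEquiv_naturality_left (Subfactor.cls (A := K)
      (B := P.suspC.obj (P.inclC.obj A)) ξ) ((P.adjGH.homEquiv A N).symm α)).trans ?_
    refine Eq.trans ?_ (adjR.homEquiv_naturality_right _ (Subfactor.cls w)).symm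
    rw [e₂, e₃]
    refine (Subfactor.cls_eq_iff (A := K) (B := P.inclC.obj N) (ξ ≫ (-c)) (γ ≫ w)).2 ?_
    exact FactorsThroughObj.comp_neg_sub k₂

/-- The data are now transposed along the reflection into `C / X`, solved by `exists_filler'`, and
the solution returns along the coreflection. -/
theorem fillsFirst {P₁ : RightSeq P.G} (hP : P₁ ∈ P.rightTriangles) {Q₁ : LeftSeq P.H}
    (hQ : Q₁ ∈ P.leftTriangles) : FillsFirst P.adjGH P₁ Q₁ := by
  obtain ⟨A, B, K, f, g, h, δ, ξ, hm, hf, hδ, comm, hξ, hi⟩ :=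
    P.preenv.exists_std_of_mem P.right P.rightChoice hP
  obtain ⟨M, N, K', u, v, w, δ', ξ', hm', hw, hδ', comm', hξ', hi'⟩ :=
    P.precov.exists_std_of_mem P.left P.leftChoice hQ
  refine FillsFirst.of_iso ?_ hi hi'
  intro α β hαβ
  let adjR := P.preenv.adj P.right
  let adjQ := P.precov.adj P.left
  have hA := P.preenv.le_C _ A.property
  have hN := P.precov.le_F _ N.property
  obtain ⟨c, hc⟩ := Subfactor.cls_surjective
    (adjR.homEquiv (P.suspC.obj (P.inclC.obj A)) N α)
  obtain ⟨b, hb⟩ := Subfactor.cls_surjective (adjR.homEquiv K M β)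
  have e₁ : (Subfactor.cls (A := K) (B := P.suspC.obj (P.inclC.obj A)) ξ) ≫
      adjR.homEquiv (P.suspC.obj (P.inclC.obj A)) N α =
      adjR.homEquiv K M β ≫ Subfactor.cls (A := P.inclC.obj M) (B := P.inclC.obj N) w :=
    (adjR.homEquiv_naturality_left (Subfactor.cls ξ) α).symm.trans
      ((congrArg (adjR.homEquiv K N) hαβ).trans
        (adjR.homEquiv_naturality_right β (Subfactor.cls w)))
  rw [← hc, ← hb] at e₁
  obtain ⟨a, ha⟩ := P.gluing.exists_rel_left hA hN c
  obtain ⟨γ, k₁, k₂⟩ := P.exists_filler' hA A.property.2 B.property.1 hm hf hδ comm hξ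
    hN N.property.1 M.property.2 hm' hw hδ' comm' hξ'
    ((Subfactor.cls_eq_iff (A := K) (B := P.inclC.obj N) _ _).1 e₁.symm) ha
  have e₂ : (adjQ.homEquiv A (P.loopF.obj (P.inclF.obj N))).symm
      (P.adjGH.homEquiv A N α) = -Subfactor.cls a := by
    rw [P.adjGH_homEquiv]
    refine (adjQ.homEquiv _ _).symm_apply_apply _ |>.trans ?_
    exact (congrArg (P.middleEquiv A N) hc.symm).trans
      (P.middleEquiv_eq (a := Subfactor.cls a) ⟨a, c, ha, rfl, rfl⟩)
  have e₃ : (adjQ.homEquiv B K').symm (adjQ.homEquiv B K'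
      (Subfactor.cls (A := P.inclF.obj B) γ)) = _ := (adjQ.homEquiv B K').symm_apply_apply _
  refine ⟨adjQ.homEquiv B K' (Subfactor.cls (A := P.inclF.obj B) γ), ?_, ?_⟩
  · have l₁ := P.preenv.incl_map_unitG_comp P.right
      (Subfactor.cls (A := P.inclC.obj B) (B := K) g) β
    have l₂ := P.precov.incl_map_comp_counitG P.left
      (adjQ.homEquiv B K' (Subfactor.cls (A := P.inclF.obj B) γ))
      (Subfactor.cls (A := K') (B := P.inclF.obj M) v)
    rw [show (P.preenv.adj P.right) = adjR from rfl, ← hb] at l₁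
    rw [show (P.precov.adj P.left) = adjQ from rfl, e₃] at l₂
    exact Eq.trans l₁ (((Subfactor.cls_eq_iff (A := B) (B := M) _ _).2 k₁).symm.trans l₂.symm)
  · dsimp only
    rw [show P.adjGH.unit.app A ≫ P.H.map α = P.adjGH.homEquiv A N α from
      (P.adjGH.homEquiv_unit ..).symm]
    refine (adjQ.homEquiv A K').symm.injective ?_
    refine (adjQ.homEquiv_naturality_left_symm (Subfactor.cls f) _).trans ?_
    refine Eq.trans ?_ (adjQ.homEquiv_naturality_right_symm (P.adjGH.homEquiv A N α)
      (Subfactor.cls (A := P.loopF.obj (P.inclF.obj N)) (B := K') ξ')).symm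
    rw [e₂, e₃]
    refine (Subfactor.cls_eq_iff (A := P.inclF.obj A) (B := K') (f ≫ γ) ((-a) ≫ ξ')).2 ?_
    exact FactorsThroughObj.sub_neg_comp k₂

end PrePartialTriangulated

end

end OneSided

theorem theorem5p3 {𝒜 : Type u} [Category.{v} 𝒜] [Preadditive 𝒜] [HasZeroObject 𝒜]
    [HasBinaryBiproducts 𝒜] (W S : 𝒜 ⥤ 𝒜) [W.Additive] [S.Additive]
    (L : Set (OneSided.LeftSeq W)) (R : Set (OneSided.RightSeq S)) (F C X : ObjectProperty 𝒜)
    [OneSided.IsAdditiveSubcategory F] [OneSided.IsAdditiveSubcategory C]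
    [OneSided.IsAdditiveSubcategory X]
    (P : OneSided.PrePartialTriangulated W S L R F C X) :
    OneSided.IsPretriangulated (T := OneSided.Subfactor (C ⊓ F) X)
      P.G P.H P.rightTriangles P.leftTriangles :=
  ⟨P.preenv.isRightTriangulated P.right P.rightChoice P.preenv_stabilizing,
    P.precov.isLeftTriangulated P.left P.leftChoice P.precov_stabilizing,
    P.adjGH, fun _ hP _ hQ => P.fillsThird hP hQ, fun _ hP _ hQ => P.fillsFirst hP hQ⟩
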